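/- Let $m\ge 1$ and $n\ge 0$ be integers. Let $\Lambda_{2n}$ be the real Grassmann algebra with anticommuting generators $\theta_1,\dots,\theta_{2n}$, put $\theta_y^2=-\sum_{j=1}^n\theta_{2j-1}\theta_{2j}$, and for $s\in\mathbb R$ let $(1-\theta_y^2)^s=\sum_{j=0}^{n}\frac{s(s-1)\cdots(s-j+1)}{j!}(-\theta_y^2)^j$. Let $\mathcal O(\mathbb S^{m-1|2n})=C^\infty(\mathbb S^{m-1})\otimes\Lambda_{2n}$ be the algebra of real superfunctions on the supersphere, embedded in $\mathbb R^{m|2n}$ by the coordinates $Y_i=\sqrt{1-\theta_y^2}\,\xi_i$ $(1\le i\le m)$, where $\xi_i$ are the coordinate functions of $\mathbb S^{m-1}\subset\mathbb R^m$, and $Y_{m+k}=\theta_k$ $(1\le k\le 2n)$. Let $g=\mathrm{diag}(I_m,J)$, with $J$ block diagonal with $n$ blocks $\frac12\begin{pmatrix}0&-1\\1&0\end{pmatrix}$, so that $\sum_{i,j}Y_ig^{ij}Y_j=1$. The Lie supergroup $SOSp(m|2n)$ is the supergroup of even supermatrices $S$ preserving $g$ whose body lies in $SO(m)\times Sp(2n)$;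 it acts on the supersphere by the linear substitutions $Y_i\mapsto\sum_jS_{ij}Y_j$. A linear functional $T:\mathcal O(\mathbb S^{m-1|2n})\to\mathbb R$ (no continuity is assumed) is called $SOSp(m|2n)$-invariant if for every $N$ and every $\Lambda_N$-valued point $S$ of $SOSp(m|2n)$ the induced algebra morphism $\Phi_S:\mathcal O(\mathbb S^{m-1|2n})\to\Lambda_N\otimes\mathcal O(\mathbb S^{m-1|2n})$ satisfies $(\mathrm{id}\otimes T)(\Phi_S f)=T(f)\cdot 1$ for all $f$. Let $\int_B=\pi^{-n}\,\partial_{\theta_{2n}}\cdots\partial_{\theta_1}$ be the Berezin integral and $\int_{\mathbb S^{m-1}}$ the integral with respect to the surface measure. Then the linear functional $$\int_{\mathbb S^{m-1|2n}}f=\int_{\mathbb S^{m-1}}\int_B(1-\theta_y^2)^{\frac m2-1}f$$ is nonzero and $SOSp(m|2n)$-invariant. If $m\ge2$, it is, up to a multiplicative constant, the only one: every $SOSp(m|2n)$-invariant linear functional $T:\mathcal O(\mathbb S^{m-1|2n})\to\mathbb R$ is of the form $T=c\int_{\mathbb S^{m-1|2n}}$ with $c\in\mathbb R$. -/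

import Mathlib

open Manifold ContDiff TensorProduct MeasureTheory

noncomputable section

namespace SuperSphere

/-! ### Grassmann algebras -/

/-- The real Grassmann algebra with `k` anticommuting generators. -/
abbrev Gr (k : ℕ) : Type := ExteriorAlgebra ℝ (Fin k → ℝ)

/-- The even part (index `0`) and the odd part (index `1`) of the Grassmann algebra. -/
abbrev parity (k : ℕ) : ZMod 2 → Submodule ℝ (Gr k) :=
  CliffordAlgebra.evenOdd (0 : QuadraticForm ℝ (Fin k → ℝ))

/-- The anticommuting generators. -/
def gen {k : ℕ} (i : Fin k) : Gr k := ExteriorAlgebra.ι ℝ (Pi.single i 1)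

/-- The left derivative with respect to the `i`-th anticommuting generator. -/
def grDeriv {k : ℕ} (i : Fin k) : Gr k →ₗ[ℝ] Gr k :=
  CliffordAlgebra.contractLeft (Q := (0 : QuadraticForm ℝ (Fin k → ℝ))) (LinearMap.proj i)

/-- The body of an element of the Grassmann algebra, i.e. its component of degree zero. -/
def body {k : ℕ} : Gr k →ₐ[ℝ] ℝ := ExteriorAlgebra.algebraMapInv

/-- The Berezin integral `π⁻ⁿ ∂_{2n} ⋯ ∂_1` on the Grassmann algebra with `2n` generators
(the derivative with respect to the first generator is applied first). -/
def berezin (n : ℕ) : Gr (2 * n) →ₗ[ℝ] ℝ :=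
  (Real.pi ^ n)⁻¹ •
    (body.toLinearMap ∘ₗ
      (List.finRange (2 * n)).foldl (fun D i => grDeriv i ∘ₗ D) LinearMap.id)

/-! ### The orthosymplectic metric -/

/-- The fermionic block of the metric: block diagonal with `n` blocks `½ [[0, -1], [1, 0]]`. -/
def metricJ (n : ℕ) : Matrix (Fin (2 * n)) (Fin (2 * n)) ℝ :=
  Matrix.of fun k l =>
    if k.val % 2 = 0 ∧ l.val = k.val + 1 then -1 / 2
    else if l.val % 2 = 0 ∧ k.val = l.val + 1 then 1 / 2
    else 0

/-- The orthosymplectic metric `g = diag(I_m, J)` on `ℝ^{m|2n}`. -/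
def metric (m n : ℕ) : Matrix (Fin m ⊕ Fin (2 * n)) (Fin m ⊕ Fin (2 * n)) ℝ :=
  Matrix.fromBlocks 1 0 0 (metricJ n)

/-- `θ² = ∑ y_k J_{kl} y_l = - ∑_j y_{2j-1} y_{2j}`. -/
def thetaSq (n : ℕ) : Gr (2 * n) := ∑ k, ∑ l, metricJ n k l • (gen k * gen l)

/-- `(1 - θ²)^s` for a real exponent `s`, i.e. the (finite) Taylor expansion
`∑_j s(s-1)⋯(s-j+1)/j! (-θ²)^j`; recall that `(θ²)^(n+1) = 0`. -/
def oneSubThetaSqPow (n : ℕ) (s : ℝ) : Gr (2 * n) :=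
  ∑ j ∈ Finset.range (n + 1),
    ((∏ i ∈ Finset.range j, (s - i)) / (j.factorial : ℝ)) • (-thetaSq n) ^ j

/-! ### The supersphere and its integral -/

/-- The unit sphere `S^{m-1}` in `ℝ^m`. -/
abbrev Sph (m : ℕ) : Type := Metric.sphere (0 : EuclideanSpace ℝ (Fin m)) 1

instance factFinrank (m : ℕ) [NeZero m] :
    Fact (Module.finrank ℝ (EuclideanSpace ℝ (Fin m)) = (m - 1) + 1) :=
  ⟨by rw [finrank_euclideanSpace_fin]; exact (Nat.succ_pred (NeZero.ne m)).symm⟩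

/-- The algebra `C^∞(S^{m-1})` of real-valued smooth functions on the unit sphere. -/
abbrev SphFun (m : ℕ) [NeZero m] : Type :=
  C^∞⟮𝓡 (m - 1), Sph m; 𝓘(ℝ, ℝ), ℝ⟯

/-- The coordinate function `ξ_i` on the unit sphere. -/
def xi {m : ℕ} [NeZero m] (i : Fin m) : SphFun m :=
  ⟨fun p => (p : EuclideanSpace ℝ (Fin m)) i,
    (EuclideanSpace.proj (𝕜 := ℝ) i).contMDiff.comp
      contMDiff_coe_sphere⟩

theorem integrable_sphFun {m : ℕ} [NeZero m] (f : SphFun m) :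
    Integrable (fun p => f p)
      (volume : Measure (EuclideanSpace ℝ (Fin m))).toSphere :=
  (f.contMDiff.continuous).integrable_of_hasCompactSupport
    (HasCompactSupport.of_compactSpace _)

/-- Integration over the unit sphere with respect to the surface measure. -/
def sphIntegral (m : ℕ) [NeZero m] : SphFun m →ₗ[ℝ] ℝ where
  toFun f := ∫ p, f p ∂(volume : Measure (EuclideanSpace ℝ (Fin m))).toSphere
  map_add' f g := integral_add (integrable_sphFun f) (integrable_sphFun g)
  map_smul' c _ := integral_const_mul c _

/-- The superalgebra `O(S^{m-1|2n}) = C^∞(S^{m-1}) ⊗ Λ_{2n}` of superfunctions on the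
supersphere. -/
abbrev SFun (m n : ℕ) [NeZero m] : Type := SphFun m ⊗[ℝ] Gr (2 * n)

/-- The embedding coordinates `Y_i` of the supersphere in `ℝ^{m|2n}`, which satisfy
`∑ Y_i g^{ij} Y_j = 1`: one has `Y_i = √(1 - θ²) ξ_i` for the `m` even coordinates, and the odd
coordinates are the generators `y_k` of the Grassmann algebra. -/
def coordY {m n : ℕ} [NeZero m] : Fin m ⊕ Fin (2 * n) → SFun m n
  | Sum.inl i => xi i ⊗ₜ[ℝ] oneSubThetaSqPow n (1 / 2)
  | Sum.inr k => 1 ⊗ₜ[ℝ] gen k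

/-- The functional `∫_{S^{m-1}} ∫_B (1 - θ²)^{m/2 - 1}` on `O(S^{m-1|2n})`. -/
def superSphereIntegral (m n : ℕ) [NeZero m] : SFun m n →ₗ[ℝ] ℝ :=
  LinearMap.mul' ℝ ℝ ∘ₗ
    TensorProduct.map (sphIntegral m)
      (berezin n ∘ₗ LinearMap.mulLeft ℝ (oneSubThetaSqPow n ((m : ℝ) / 2 - 1)))

/-! ### The supergroup `SOSp(m|2n)` and its action on the supersphere -/

/-- The parity of a coordinate index of `ℝ^{m|2n}`. -/
def idxParity {m n : ℕ} : Fin m ⊕ Fin (2 * n) → ZMod 2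
  | Sum.inl _ => 0
  | Sum.inr _ => 1

/-- Square supermatrices of size `m|2n` with entries in `Λ_N`. -/
abbrev SMat (m n N : ℕ) : Type :=
  Matrix (Fin m ⊕ Fin (2 * n)) (Fin m ⊕ Fin (2 * n)) (Gr N)

/-- The supertranspose of an even supermatrix:
`[[A, B], [C, D]]` is sent to `[[Aᵀ, Cᵀ], [-Bᵀ, Dᵀ]]`. -/
def superTranspose {m n N : ℕ} (S : SMat m n N) : SMat m n N :=
  Matrix.fromBlocks S.toBlocks₁₁.transpose S.toBlocks₂₁.transpose
    (-S.toBlocks₁₂.transpose) S.toBlocks₂₂.transpose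

/-- The `Λ_N`-valued points of the Lie supergroup `SOSp(m|2n)`, that is, the morphisms
`ℝ^{0|N} → SOSp(m|2n)`: the even supermatrices `S` with entries in `Λ_N` which preserve the
orthosymplectic metric, and for which the (orthogonal) body of the even-even block has
determinant one. For `N = 0` these are the elements of `SO(m) × Sp(2n)`. -/
structure IsSOSpPoint {m n N : ℕ} (S : SMat m n N) : Prop where
  even : ∀ i j, S i j ∈ parity N (idxParity i + idxParity j)
  preserves_metric :
    superTranspose S * (metric m n).map (algebraMap ℝ (Gr N)) * S =
      (metric m n).map (algebraMap ℝ (Gr N))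
  det_body : (S.toBlocks₁₁.map body).det = 1

/-- The superalgebra `Λ_N ⊗ O(S^{m-1|2n})` of superfunctions on `ℝ^{0|N} × S^{m-1|2n}`, written
as `C^∞(S^{m-1}) ⊗ (Λ_N ⊗ Λ_{2n})`; the product of the two Grassmann algebras is the graded one,
so that the generators of `Λ_N` anticommute with those of `Λ_{2n}`. -/
abbrev SFunOver (m n N : ℕ) [NeZero m] : Type :=
  SphFun m ⊗[ℝ] (parity N ᵍ⊗[ℝ] parity (2 * n))

/-- The inclusion `a ↦ a ⊗ 1` of `Λ_N` into `Λ_N ⊗ O(S^{m-1|2n})`. -/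
def inclParam (m n N : ℕ) [NeZero m] : Gr N →ₐ[ℝ] SFunOver m n N :=
  Algebra.TensorProduct.includeRight.comp
    (GradedTensorProduct.includeLeft (parity N) (parity (2 * n)))

/-- The inclusion `f ↦ 1 ⊗ f` of `O(S^{m-1|2n})` into `Λ_N ⊗ O(S^{m-1|2n})`. -/
def inclFun (m n N : ℕ) [NeZero m] : SFun m n →ₐ[ℝ] SFunOver m n N :=
  Algebra.TensorProduct.map (AlgHom.id ℝ (SphFun m))
    (GradedTensorProduct.includeRight (parity N) (parity (2 * n)))

/-- For a linear functional `T` on `O(S^{m-1|2n})`, the map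
`id ⊗ T : Λ_N ⊗ O(S^{m-1|2n}) → Λ_N`, `a ⊗ f ↦ T(f) a`. -/
def idTensor {m n : ℕ} [NeZero m] (N : ℕ) (T : SFun m n →ₗ[ℝ] ℝ) :
    SFunOver m n N →ₗ[ℝ] Gr N :=
  (TensorProduct.rid ℝ (Gr N)).toLinearMap ∘ₗ
    TensorProduct.map LinearMap.id T ∘ₗ
      (TensorProduct.leftComm ℝ (SphFun m) (Gr N) (Gr (2 * n))).toLinearMap ∘ₗ
        TensorProduct.map LinearMap.id
          (GradedTensorProduct.of ℝ (parity N) (parity (2 * n))).symm.toLinearMap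

/-- `Φ` is the pullback of superfunctions along the morphism of supermanifolds
`ℝ^{0|N} × S^{m-1|2n} → S^{m-1|2n}` by which the `Λ_N`-point `S` of the supergroup acts. It is the
homomorphism of algebras given on the embedding coordinates by the linear substitution
`Y_i ↦ ∑_j S_{ij} Y_j`. (A homomorphism with this property exists, is unique and preserves the
parity, because homomorphisms out of an algebra of smooth functions into such an algebra are
determined by Taylor expansion from the images of the coordinates.) -/
def IsActionPullback {m n N : ℕ} [NeZero m] (S : SMat m n N)
    (Φ : SFun m n →ₐ[ℝ] SFunOver m n N) : Prop :=
  ∀ i, Φ (coordY i) = ∑ j, inclParam m n N (S i j) * inclFun m n N (coordY j)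

/-- A linear functional `T` on `O(S^{m-1|2n})` is `SOSp(m|2n)`-invariant if
`(id ⊗ T) ∘ ψ^♯ = 1 ⊗ T` for the action `ψ` of the supergroup on the supersphere. This is an
equality of superfunctions on the supergroup, and it is expressed at all its points with values in
Grassmann algebras (a superfunction on a supermanifold is determined by its values at these
points). -/
def IsSOSpInvariant {m n : ℕ} [NeZero m] (T : SFun m n →ₗ[ℝ] ℝ) : Prop :=
  ∀ (N : ℕ) (S : SMat m n N), IsSOSpPoint S →
    ∀ Φ : SFun m n →ₐ[ℝ] SFunOver m n N, IsActionPullback S Φ →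
      ∀ f : SFun m n, idTensor N T (Φ f) = algebraMap ℝ (Gr N) (T f)

end SuperSphere

end

/-! Write u = 1 - θ² and s = m/2 - 1. The embedding coordinates Y generate the superfunctions up to
a Taylor expansion argument: Hadamard's lemma on the sphere, together with nilpotency of bodiless
elements, shows that a morphism, or a derivation along one, is determined by its values on the Y_i
(`derivation_eq_zero`, `algHom_eq_of_xi`). The Lie superalgebra osp(m|2n) therefore acts by explicit
operators `genOp a b`, and both halves of the theorem pass through the condition T ∘ `genOp a b` =
0.

Invariance. The integral kills every `genOp a b`. For rotations this is integration by parts on the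
sphere, for sp(2n) integration by parts for the Berezin integral. For the odd operators the
tangential gradient contributes (m - 1) ξ_i and the odd derivative contributes 2(s + 1/2); these
balance exactly because s = m/2 - 1. To pass to a point S over Λ_N, no factorisation of S is needed.
Let E be the Euler operator of Λ_N, which multiplies degree j by j. Applying E to S^{st} g S = g
shows that X = S^{st} g E(S) has the osp symmetry and E(S) = S g⁻¹ X. Hence E ∘ Φ = (vector field
with coefficients X) ∘ Φ, since both are derivations along Φ with the same values on the Y_i.
Integration gives E(∫ Φ f) = 0, so ∫ Φ f is a scalar, equal to its value at the body of S. That body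
is a pair in O(m) × Sp(2n), for which surface measure and Berezin integral are invariant.

Uniqueness. For a parameter c of the right parity with c² = 0, the matrix 1 + cX is a point of the
supergroup and its pullback is 1 + c·`genOp a b`; invariance forces T ∘ `genOp a b` = 0. Rotations
then give T(h ⊗ w) = (∫ h) τ(w), and the odd operators say that w ↦ τ(u^{-s} w) kills all
derivatives, hence is a multiple of the Berezin integral.

The first of these steps (`exists_eq_smul_sphIntegral`) must avoid continuity. Radial integration
against r^{m-1} turns a functional killed by rotations into a functional on compactly supported
smooth functions killed by all ∂_i. The function (∫ F) φ - F * φ is explicitly the divergence of a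
compactly supported field, so the functional sends F * φ to (∫ F) times its value at φ;
commutativity of convolution then makes it proportional to the Lebesgue integral. -/

noncomputable section

namespace SuperSphere

/-! ### Contractions and parity in Grassmann algebras -/

section Grassmann

variable {k : ℕ}

/-- The left derivative of the Grassmann algebra along a linear form on the generators. -/
abbrev contr (d : Module.Dual ℝ (Fin k → ℝ)) : Gr k →ₗ[ℝ] Gr k :=
  CliffordAlgebra.contractLeft (Q := (0 : QuadraticForm ℝ (Fin k → ℝ))) d

/-- The grade involution of the Grassmann algebra. -/
abbrev invol (k : ℕ) : Gr k →ₐ[ℝ] Gr k :=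
  CliffordAlgebra.involute (Q := (0 : QuadraticForm ℝ (Fin k → ℝ)))

theorem contr_ι_mul (d : Module.Dual ℝ (Fin k → ℝ)) (v : Fin k → ℝ) (x : Gr k) :
    contr d (ExteriorAlgebra.ι ℝ v * x) = d v • x - ExteriorAlgebra.ι ℝ v * contr d x :=
  CliffordAlgebra.contractLeft_ι_mul d v x

theorem contr_ι (d : Module.Dual ℝ (Fin k → ℝ)) (v : Fin k → ℝ) :
    contr d (ExteriorAlgebra.ι ℝ v) = algebraMap ℝ (Gr k) (d v) :=
  CliffordAlgebra.contractLeft_ι _ d v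

theorem invol_ι (v : Fin k → ℝ) :
    invol k (ExteriorAlgebra.ι ℝ v) = -ExteriorAlgebra.ι ℝ v :=
  CliffordAlgebra.involute_ι v

theorem contr_mul (d : Module.Dual ℝ (Fin k → ℝ)) (x y : Gr k) :
    contr d (x * y) = contr d x * y + invol k x * contr d y := by
  induction x using CliffordAlgebra.left_induction with
  | algebraMap r =>
    simp [Algebra.algebraMap_eq_smul_one]
  | add x₁ x₂ h₁ h₂ => simp only [add_mul, map_add, h₁, h₂]; abel
  | ι_mul x v h =>
    have e : CliffordAlgebra.ι (0 : QuadraticForm ℝ (Fin k → ℝ)) v = ExteriorAlgebra.ι ℝ v := rfl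
    rw [e, mul_assoc, contr_ι_mul, h, contr_ι_mul, map_mul, invol_ι]
    simp only [sub_mul, mul_add, neg_mul, smul_mul_assoc, mul_assoc]
    abel

theorem invol_of_mem_even {x : Gr k} (hx : x ∈ parity k 0) : invol k x = x :=
  CliffordAlgebra.involute_eq_of_mem_even hx

theorem invol_of_mem_odd {x : Gr k} (hx : x ∈ parity k 1) : invol k x = -x :=
  CliffordAlgebra.involute_eq_of_mem_odd hx

theorem ι_mem_odd (v : Fin k → ℝ) : ExteriorAlgebra.ι ℝ v ∈ parity k 1 :=
  CliffordAlgebra.ι_mem_evenOdd_one _ v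

theorem gen_mem_odd (i : Fin k) : (gen i : Gr k) ∈ parity k 1 := ι_mem_odd _

theorem mul_mem_parity {p q : ZMod 2} {x y : Gr k} (hx : x ∈ parity k p) (hy : y ∈ parity k q) :
    x * y ∈ parity k (p + q) :=
  SetLike.GradedMul.mul_mem hx hy

theorem ι_mul_eq_invol_mul (v : Fin k → ℝ) (x : Gr k) :
    ExteriorAlgebra.ι ℝ v * x = invol k x * ExteriorAlgebra.ι ℝ v := by
  induction x using CliffordAlgebra.left_induction with
  | algebraMap r => simp [Algebra.commutes]
  | add x₁ x₂ h₁ h₂ => simp only [mul_add, map_add, h₁, h₂, add_mul]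
  | ι_mul x w h =>
    have e : CliffordAlgebra.ι (0 : QuadraticForm ℝ (Fin k → ℝ)) w = ExteriorAlgebra.ι ℝ w := rfl
    have hs : ExteriorAlgebra.ι ℝ v * ExteriorAlgebra.ι ℝ w
        = -(ExteriorAlgebra.ι ℝ w * ExteriorAlgebra.ι ℝ v) :=
      eq_neg_of_add_eq_zero_left (ExteriorAlgebra.ι_add_mul_swap v w)
    rw [e, ← mul_assoc, hs, map_mul, invol_ι, neg_mul, mul_assoc, h, ← mul_assoc, neg_mul, neg_mul]

theorem mul_comm_of_mem_even {x : Gr k} (hx : x ∈ parity k 0) (y : Gr k) : x * y = y * x := by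
  have h : ∀ y : Gr k, y * x = x * y := by
    intro y
    induction y using CliffordAlgebra.left_induction with
    | algebraMap r => exact Algebra.commutes _ _
    | add x₁ x₂ h₁ h₂ => simp only [mul_add, h₁, h₂, add_mul]
    | ι_mul y w h =>
      have := ι_mul_eq_invol_mul w x
      rw [invol_of_mem_even hx] at this
      rw [mul_assoc, h, ← mul_assoc, ← mul_assoc]
      exact congrArg (· * y) this
  exact (h y).symm

theorem mul_invol_of_mem_odd {x : Gr k} (hx : x ∈ parity k 1) (y : Gr k) :
    x * y = invol k y * x := by
  induction y using CliffordAlgebra.left_induction with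
  | algebraMap r => simp [Algebra.commutes]
  | add x₁ x₂ h₁ h₂ => simp only [mul_add, map_add, h₁, h₂, add_mul]
  | ι_mul y w h =>
    have e : CliffordAlgebra.ι (0 : QuadraticForm ℝ (Fin k → ℝ)) w = ExteriorAlgebra.ι ℝ w := rfl
    have h' := ι_mul_eq_invol_mul w x
    rw [invol_of_mem_odd hx] at h'
    have h'' : x * ExteriorAlgebra.ι ℝ w = -(ExteriorAlgebra.ι ℝ w * x) := by rw [h']; simp
    rw [e, ← mul_assoc, h'', map_mul, invol_ι, neg_mul, mul_assoc, h, ← mul_assoc, neg_mul, neg_mul]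

theorem mul_anticomm_of_mem_odd {x y : Gr k} (hx : x ∈ parity k 1) (hy : y ∈ parity k 1) :
    x * y = -(y * x) := by
  rw [mul_invol_of_mem_odd hx, invol_of_mem_odd hy, neg_mul]

theorem contr_invol (d : Module.Dual ℝ (Fin k → ℝ)) (x : Gr k) :
    contr d (invol k x) = -invol k (contr d x) := by
  induction x using CliffordAlgebra.left_induction with
  | algebraMap r => simp
  | add x₁ x₂ h₁ h₂ => simp only [map_add, h₁, h₂]; abel
  | ι_mul y w h =>
    have e : CliffordAlgebra.ι (0 : QuadraticForm ℝ (Fin k → ℝ)) w = ExteriorAlgebra.ι ℝ w := rfl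
    rw [e, map_mul, invol_ι, neg_mul, map_neg, contr_ι_mul, h, contr_ι_mul, map_sub, map_mul,
      invol_ι, map_smul]
    simp only [mul_neg, neg_mul]

/-- Contraction anticommutes with the grade involution, so the component of the wrong parity equals
its own negative. -/
theorem contr_mem {p : ZMod 2} (d : Module.Dual ℝ (Fin k → ℝ)) {x : Gr k} (hx : x ∈ parity k p) :
    contr d x ∈ parity k (p + 1) := by
  obtain ⟨a, ha, b, hb, hab⟩ : ∃ a ∈ parity k 0, ∃ b ∈ parity k 1, a + b = contr d x := by
    have : contr d x ∈ parity k 0 ⊔ parity k 1 := by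
      rw [(CliffordAlgebra.evenOdd_isCompl _).sup_eq_top]; trivial
    exact Submodule.mem_sup.1 this
  have h := contr_invol d x
  have hp : p = 0 ∨ p = 1 := by clear * -; revert p; decide
  rcases hp with rfl | rfl
  · rw [invol_of_mem_even hx, ← hab, map_add, invol_of_mem_even ha, invol_of_mem_odd hb] at h
    have : a = 0 := by
      have h2 : (2 : ℝ) • a = 0 := by linear_combination (norm := module) h
      exact (smul_eq_zero.1 h2).resolve_left two_ne_zero
    rw [← hab, this, zero_add, zero_add]; exact hb
  · rw [invol_of_mem_odd hx, map_neg, neg_inj, ← hab, map_add, invol_of_mem_even ha,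
      invol_of_mem_odd hb] at h
    have : b = 0 := by
      have h2 : (2 : ℝ) • b = 0 := by linear_combination (norm := module) h
      exact (smul_eq_zero.1 h2).resolve_left two_ne_zero
    rw [← hab, this, add_zero, show (1 + 1 : ZMod 2) = 0 by decide]; exact ha

theorem contr_eq_sum (d : Module.Dual ℝ (Fin k → ℝ)) (x : Gr k) :
    contr d x = ∑ i, d (Pi.single i 1) • grDeriv i x := by
  have : d = ∑ i, d (Pi.single i 1) • LinearMap.proj i := by
    refine LinearMap.pi_ext' fun i => LinearMap.ext_ring ?_
    simp [Pi.single_apply]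
  conv_lhs => rw [this]
  simp [contr, grDeriv]

theorem contr_gen (d : Module.Dual ℝ (Fin k → ℝ)) (i : Fin k) :
    contr d (gen i) = algebraMap ℝ (Gr k) (d (Pi.single i 1)) := contr_ι _ _

theorem grDeriv_gen (i j : Fin k) :
    grDeriv i (gen j : Gr k) = if i = j then 1 else 0 := by
  change contr (LinearMap.proj i) (gen j) = _
  rw [contr_gen]
  by_cases h : i = j
  · subst h; simp
  · simp [h]

theorem grDeriv_gen_mul (i j : Fin k) (x : Gr k) :
    grDeriv i (gen j * x) = (if i = j then x else 0) - gen j * grDeriv i x := by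
  have := contr_ι_mul (LinearMap.proj i) (Pi.single j 1) x
  change contr (LinearMap.proj i) (gen j * x) = _
  rw [gen, this]
  by_cases h : i = j
  · subst h; simp; rfl
  · simp [h]; rfl

/-! ### The Euler operator -/

/-- The Euler operator, which multiplies an element of degree `j` by `j`. -/
def euler (k : ℕ) : Gr k →ₗ[ℝ] Gr k := ∑ i, LinearMap.mulLeft ℝ (gen i) ∘ₗ grDeriv i

theorem euler_apply (x : Gr k) : euler k x = ∑ i, gen i * grDeriv i x := by
  simp [euler]

theorem euler_mul (x y : Gr k) : euler k (x * y) = euler k x * y + x * euler k y := by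
  simp only [euler_apply, Finset.sum_mul, Finset.mul_sum, ← Finset.sum_add_distrib]
  refine Finset.sum_congr rfl fun i _ => ?_
  have := contr_mul (LinearMap.proj i) x y
  change gen i * contr _ (x * y) = _
  rw [this, mul_add, ← mul_assoc, ← mul_assoc, ← mul_assoc]
  congr 2
  have h := ι_mul_eq_invol_mul (Pi.single i 1) (invol k x)
  rw [CliffordAlgebra.involute_involute] at h
  exact h

theorem euler_one : euler k 1 = 0 := by
  rw [euler_apply]
  exact Finset.sum_eq_zero fun i _ => by simp [grDeriv]

theorem euler_algebraMap (r : ℝ) : euler k (algebraMap ℝ _ r) = 0 := by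
  rw [Algebra.algebraMap_eq_smul_one, map_smul, euler_one, smul_zero]

theorem euler_ι (v : Fin k → ℝ) : euler k (ExteriorAlgebra.ι ℝ v) = ExteriorAlgebra.ι ℝ v := by
  have : ∀ i, grDeriv i (ExteriorAlgebra.ι ℝ v) = algebraMap ℝ (Gr k) (v i) := fun i =>
    contr_ι (LinearMap.proj i) v
  rw [euler_apply]
  simp only [this, ← Algebra.commutes, ← Algebra.smul_def, gen, ← map_smul, ← map_sum]
  congr 1
  ext j
  simp [Finset.sum_apply, Pi.single_apply]

theorem euler_mem {p : ZMod 2} {x : Gr k} (hx : x ∈ parity k p) : euler k x ∈ parity k p := by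
  rw [euler_apply]
  refine Submodule.sum_mem _ fun i _ => ?_
  have := mul_mem_parity (gen_mem_odd i) (contr_mem (LinearMap.proj i) hx)
  rwa [show 1 + (p + 1) = p by clear * -; revert p; decide] at this

theorem euler_of_mem_pow {j : ℕ} {x : Gr k} (hx : x ∈ ⋀[ℝ]^j (Fin k → ℝ)) :
    euler k x = (j : ℝ) • x := by
  change x ∈ (LinearMap.range (ExteriorAlgebra.ι ℝ)) ^ j at hx
  induction hx using Submodule.pow_induction_on_left' with
  | algebraMap r => simp [euler_algebraMap]
  | add x y i hx hy h₁ h₂ => rw [map_add, h₁, h₂, smul_add]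
  | mem_mul m hm i x hx h =>
    obtain ⟨v, rfl⟩ := hm
    rw [euler_mul, euler_ι, h, mul_smul_comm, Nat.cast_succ, add_smul, one_smul, add_comm]

/-- In characteristic zero only degree 0 has Euler eigenvalue 0. This is how both the Berezin
integral and the integral of a translated superfunction are recognised as scalars. -/
theorem eq_algebraMap_of_euler_eq_zero {x : Gr k} (hx : euler k x = 0) :
    x = algebraMap ℝ (Gr k) (body x) := by
  classical
  let 𝒜 : ℕ → Submodule ℝ (Gr k) := fun j => ⋀[ℝ]^j (Fin k → ℝ)
  have key : ∀ j (y : Gr k), (DirectSum.decompose 𝒜 (euler k y) j : Gr k)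
      = (j : ℝ) • (DirectSum.decompose 𝒜 y j : Gr k) := by
    intro j y
    induction y using DirectSum.Decomposition.inductionOn 𝒜 with
    | zero => simp
    | @homogeneous i m =>
      rw [euler_of_mem_pow m.2, DirectSum.decompose_smul, DirectSum.decompose_coe,
        DirectSum.smul_apply, Submodule.coe_smul]
      by_cases h : i = j
      · subst h; rfl
      · rw [DirectSum.of_eq_of_ne _ _ _ (Ne.symm h)]; simp
    | add a b ha hb => simp [DirectSum.decompose_add, ha, hb]
  have h0 : ∀ j ≠ 0, (DirectSum.decompose 𝒜 x j : Gr k) = 0 := by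
    intro j hj
    have := key j x
    rw [hx, DirectSum.decompose_zero] at this
    exact (smul_eq_zero.1 (this.symm.trans rfl)).resolve_left (by exact_mod_cast hj)
  have hx0 : x ∈ 𝒜 0 := by
    rw [← DirectSum.sum_support_decompose 𝒜 x]
    refine Submodule.sum_mem _ fun j _ => ?_
    by_cases hj : j = 0
    · subst hj; exact SetLike.coe_mem _
    · rw [h0 j hj]; exact Submodule.zero_mem _
  change x ∈ (LinearMap.range (ExteriorAlgebra.ι ℝ)) ^ 0 at hx0
  rw [pow_zero, Submodule.mem_one] at hx0
  obtain ⟨r, rfl⟩ := hx0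
  simp [body, ExteriorAlgebra.algebraMapInv]

/-! ### Finiteness and nilpotency -/

instance finite_gr (k : ℕ) : Module.Finite ℝ (Gr k) :=
  Module.Finite.of_basis (Pi.basisFun ℝ (Fin k)).ExteriorAlgebra

end Grassmann
-- Nilpotency of elements with zero body
section Nilp

theorem exteriorAlgebra_pow_eq_bot {V : Type*} [AddCommGroup V] [Module ℝ V]
    [Module.Finite ℝ V] {j : ℕ} (hj : Module.finrank ℝ V < j) :
    (⋀[ℝ]^j V : Submodule ℝ (ExteriorAlgebra ℝ V)) = ⊥ := by
  rw [← ExteriorAlgebra.ιMulti_span_fixedDegree, Submodule.span_eq_bot]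
  rintro _ ⟨v, rfl⟩
  refine AlternatingMap.map_linearDependent (K := ℝ) (ExteriorAlgebra.ιMulti ℝ j) v fun h => ?_
  have := h.fintype_card_le_finrank
  simp at this
  omega

/-- The spaces W j of elements of degree at least j form a multiplicative filtration. Zero body
means membership in W 1, so x^j lies in W j, which vanishes beyond the dimension of V. -/
theorem exteriorAlgebra_isNilpotent {V : Type*} [AddCommGroup V] [Module ℝ V]
    [Module.Finite ℝ V] {x : ExteriorAlgebra ℝ V}
    (hx : ExteriorAlgebra.algebraMapInv x = 0) : IsNilpotent x := by
  classical
  set W : ℕ → Submodule ℝ (ExteriorAlgebra ℝ V) := fun j => ⨆ i : ℕ, ⋀[ℝ]^(j + i) V with hW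
  have hmul : ∀ i j, W i * W j ≤ W (i + j) := by
    intro i j
    simp only [hW, Submodule.iSup_mul, Submodule.mul_iSup]
    refine iSup_le fun a => iSup_le fun b => ?_
    refine le_trans (le_of_eq ?_) (le_iSup (fun c : ℕ => ⋀[ℝ]^(i + j + c) V) (a + b))
    change (LinearMap.range (ExteriorAlgebra.ι ℝ (M := V))) ^ (i + b) *
      (LinearMap.range (ExteriorAlgebra.ι ℝ (M := V))) ^ (j + a) =
        (LinearMap.range (ExteriorAlgebra.ι ℝ (M := V))) ^ (i + j + (a + b))
    rw [← pow_add]; congr 1; omega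
  have h1 : ∀ y : ExteriorAlgebra ℝ V,
      y - algebraMap ℝ _ (ExteriorAlgebra.algebraMapInv y) ∈ W 1 := by
    intro y
    induction y using CliffordAlgebra.left_induction with
    | algebraMap r =>
      have : ExteriorAlgebra.algebraMapInv (algebraMap ℝ (ExteriorAlgebra ℝ V) r) = r := by simp
      simp only [ExteriorAlgebra] at this
      rw [this, sub_self]; exact Submodule.zero_mem _
    | add a b ha hb =>
      rw [map_add, map_add, add_sub_add_comm]; exact Submodule.add_mem _ ha hb
    | ι_mul y w h =>
      have e : ExteriorAlgebra.algebraMapInv (CliffordAlgebra.ι (0 : QuadraticForm ℝ V) w) = 0 := by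
        change ExteriorAlgebra.algebraMapInv (ExteriorAlgebra.ι ℝ w) = 0
        simp [ExteriorAlgebra.algebraMapInv]
      rw [map_mul, e, zero_mul, map_zero, sub_zero]
      have hw : CliffordAlgebra.ι (0 : QuadraticForm ℝ V) w ∈ ⋀[ℝ]^(1 + 0) V := by
        change ExteriorAlgebra.ι ℝ w ∈ (LinearMap.range (ExteriorAlgebra.ι ℝ)) ^ 1
        rw [pow_one]; exact ⟨w, rfl⟩
      have hw' : CliffordAlgebra.ι (0 : QuadraticForm ℝ V) w ∈ W 1 :=
        Submodule.mem_iSup_of_mem 0 hw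
      have hy : y ∈ W 0 := by
        have h2 : W 1 ≤ W 0 := by
          refine iSup_le fun i => ?_
          refine le_trans (le_of_eq ?_) (le_iSup (fun c : ℕ => ⋀[ℝ]^(0 + c) V) (1 + i))
          rw [zero_add]
        have h3 : algebraMap ℝ (ExteriorAlgebra ℝ V) (ExteriorAlgebra.algebraMapInv y) ∈ W 0 := by
          refine Submodule.mem_iSup_of_mem 0 ?_
          change _ ∈ (LinearMap.range (ExteriorAlgebra.ι ℝ)) ^ 0
          rw [pow_zero, Submodule.mem_one]; exact ⟨_, rfl⟩
        have := Submodule.add_mem _ (h2 h) h3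
        rwa [sub_add_cancel] at this
      exact hmul 1 0 (Submodule.mul_mem_mul hw' hy)
  have hpow : ∀ j, x ^ j ∈ W j := by
    intro j
    induction j with
    | zero =>
      refine Submodule.mem_iSup_of_mem 0 ?_
      change _ ∈ (LinearMap.range (ExteriorAlgebra.ι ℝ)) ^ 0
      rw [pow_zero, pow_zero]; exact Submodule.one_le.1 le_rfl
    | succ j ih =>
      rw [pow_succ]
      refine hmul j 1 (Submodule.mul_mem_mul ih ?_)
      have := h1 x
      rwa [hx, map_zero, sub_zero] at this
  refine ⟨Module.finrank ℝ V + 1, ?_⟩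
  have hb : W (Module.finrank ℝ V + 1) = ⊥ := by
    refine le_bot_iff.1 (iSup_le fun i => ?_)
    rw [exteriorAlgebra_pow_eq_bot (by omega)]
  have := hpow (Module.finrank ℝ V + 1)
  rwa [hb, Submodule.mem_bot] at this

end Nilp

/-- Left multiplications are endomorphisms of a finite-dimensional space, where one-sided inverses
are two-sided. It is needed for supermatrices, whose entries do not commute. -/
theorem mul_eq_one_comm_of_finite {R : Type*} [Ring R] [Algebra ℝ R] [Module.Finite ℝ R] {a b : R}
    (h : a * b = 1) : b * a = 1 := by
  have h1 : Algebra.lmul ℝ R a * Algebra.lmul ℝ R b = 1 := by rw [← map_mul, h, map_one]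
  have h2 := mul_eq_one_comm.1 h1
  rw [← map_mul] at h2
  simpa using LinearMap.congr_fun h2 1

/-! ### The symplectic form and the powers of `1 - θ²` -/

section Theta

variable {n : ℕ}

theorem metricJ_antisymm (k l : Fin (2 * n)) : metricJ n k l = -metricJ n l k := by
  simp only [metricJ, Matrix.of_apply]
  split_ifs <;> first | omega | norm_num

theorem metricJ_mul_metricJ (k l : Fin (2 * n)) :
    ∑ q, metricJ n k q * metricJ n q l = if k = l then -1 / 4 else 0 := by
  have hk := k.2
  have hl := l.2
  have hkl : k = l ↔ k.val = l.val := Fin.ext_iff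
  by_cases h : k.val % 2 = 0
  · rw [Finset.sum_eq_single (⟨k.val + 1, by omega⟩ : Fin (2 * n))]
    · simp only [metricJ, Matrix.of_apply, hkl, and_true]
      split_ifs <;> first | omega | norm_num
    · intro b _ hb
      have hb' : b.val ≠ k.val + 1 := fun h => hb (Fin.ext h)
      simp only [metricJ, Matrix.of_apply]
      split_ifs <;> first | omega | norm_num
    · simp
  · rw [Finset.sum_eq_single (⟨k.val - 1, by omega⟩ : Fin (2 * n))]
    · simp only [metricJ, Matrix.of_apply, hkl]
      split_ifs <;> first | omega | norm_num
    · intro b _ hb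
      have hb' : b.val ≠ k.val - 1 := fun h => hb (Fin.ext h)
      simp only [metricJ, Matrix.of_apply]
      split_ifs <;> first | omega | norm_num
    · simp

theorem metricJ_mul_self : metricJ n * metricJ n = (-1 / 4 : ℝ) • 1 := by
  ext k l
  rw [Matrix.mul_apply, metricJ_mul_metricJ, Matrix.smul_apply, Matrix.one_apply]
  split_ifs <;> simp

/-- The linear form on the generators which is dual to `θ_k` with respect to the symplectic
form. -/
def dualForm (k : Fin (2 * n)) : Module.Dual ℝ (Fin (2 * n) → ℝ) :=
  ∑ p, (-4 * metricJ n p k) • LinearMap.proj p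

theorem dualForm_single (k p : Fin (2 * n)) :
    dualForm k (Pi.single p 1) = -4 * metricJ n p k := by
  simp [dualForm, Pi.single_apply]

/-- Antisymmetry of J doubles the contribution of one factor, and J² = -1/4 cancels the -4 in
`dualForm`. -/
theorem contr_thetaSq (k : Fin (2 * n)) :
    contr (dualForm k) (thetaSq n) = (-2 : ℝ) • gen k := by
  have h1 : ∀ p q : Fin (2 * n), contr (dualForm k) (gen p * gen q) =
      (-4 * metricJ n p k) • gen q - (-4 * metricJ n q k) • gen p := by
    intro p q
    rw [gen, contr_ι_mul, dualForm_single]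
    congr 1
    change _ * contr (dualForm k) (gen q) = _
    rw [contr_gen, dualForm_single, ← Algebra.commutes, ← Algebra.smul_def]
  have h2 : contr (dualForm k) (thetaSq n)
      = ∑ q, (∑ p, (-8 : ℝ) * (metricJ n p q * metricJ n p k)) • gen q := by
    simp only [thetaSq, map_sum, map_smul, h1, smul_sub, Finset.sum_sub_distrib, smul_smul,
      Finset.sum_smul]
    rw [Finset.sum_comm, sub_eq_iff_eq_add, ← Finset.sum_add_distrib]
    refine Finset.sum_congr rfl fun q _ => ?_
    rw [← Finset.sum_add_distrib]
    refine Finset.sum_congr rfl fun p _ => ?_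
    rw [← add_smul, metricJ_antisymm q p]
    congr 1
    ring
  rw [h2]
  have h3 : ∀ q, ∑ p, (-8 : ℝ) * (metricJ n p q * metricJ n p k) = if k = q then -2 else 0 := by
    intro q
    rw [← Finset.mul_sum]
    have : ∑ p, metricJ n p q * metricJ n p k = -∑ p, metricJ n k p * metricJ n p q := by
      rw [← Finset.sum_neg_distrib]
      refine Finset.sum_congr rfl fun p _ => ?_
      rw [metricJ_antisymm p k]; ring
    rw [this, metricJ_mul_metricJ]
    split_ifs <;> norm_num
  simp only [h3, ite_smul, zero_smul, Finset.sum_ite_eq, Finset.mem_univ, if_true]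

theorem odd_mul_odd_mem {k : ℕ} {x y : Gr k} (hx : x ∈ parity k 1) (hy : y ∈ parity k 1) :
    x * y ∈ parity k 0 := by
  have := mul_mem_parity hx hy
  rwa [show (1 + 1 : ZMod 2) = 0 by decide] at this

theorem even_mul_mem {k : ℕ} {p : ZMod 2} {x y : Gr k} (hx : x ∈ parity k 0)
    (hy : y ∈ parity k p) : x * y ∈ parity k p := by
  have := mul_mem_parity hx hy
  rwa [zero_add] at this

theorem one_mem_even {k : ℕ} : (1 : Gr k) ∈ parity k 0 :=
  Submodule.one_le.1 (CliffordAlgebra.one_le_evenOdd_zero _)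

theorem thetaSq_mem_even : thetaSq n ∈ parity (2 * n) 0 :=
  Submodule.sum_mem _ fun _ _ => Submodule.sum_mem _ fun _ _ => Submodule.smul_mem _ _
    (odd_mul_odd_mem (gen_mem_odd _) (gen_mem_odd _))

theorem pow_mem_even {k : ℕ} {x : Gr k} (hx : x ∈ parity k 0) (j : ℕ) : x ^ j ∈ parity k 0 := by
  induction j with
  | zero => rw [pow_zero]; exact one_mem_even
  | succ j ih => rw [pow_succ]; exact even_mul_mem ih hx

theorem thetaSq_pow_mem (j : ℕ) : thetaSq n ^ j ∈ ⋀[ℝ]^(2 * j) (Fin (2 * n) → ℝ) := by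
  change _ ∈ (LinearMap.range (ExteriorAlgebra.ι ℝ (M := Fin (2 * n) → ℝ))) ^ (2 * j)
  rw [pow_mul]
  refine Submodule.pow_mem_pow _ ?_ _
  rw [pow_two]
  exact Submodule.sum_mem _ fun _ _ => Submodule.sum_mem _ fun _ _ => Submodule.smul_mem _ _
    (Submodule.mul_mem_mul ⟨_, rfl⟩ ⟨_, rfl⟩)

theorem thetaSq_pow_succ : thetaSq n ^ (n + 1) = 0 := by
  have h := thetaSq_pow_mem (n := n) (n + 1)
  rwa [exteriorAlgebra_pow_eq_bot (by simp), Submodule.mem_bot] at h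

theorem contr_pow {k : ℕ} (d : Module.Dual ℝ (Fin k → ℝ)) {x : Gr k} (hx : x ∈ parity k 0)
    (j : ℕ) : contr d (x ^ (j + 1)) = ((j : ℝ) + 1) • (x ^ j * contr d x) := by
  induction j with
  | zero => simp
  | succ j ih =>
    rw [pow_succ, contr_mul, ih, invol_of_mem_even (pow_mem_even hx _), smul_mul_assoc, mul_assoc,
      ← mul_comm_of_mem_even hx, ← mul_assoc, ← pow_succ]
    push_cast
    module

/-- Differentiating the vanishing power in the direction dual to θ_k leaves a nonzero multiple of
the product. -/
theorem gen_mul_thetaSq_pow_of_eq_zero (k : Fin (2 * n)) {j : ℕ} (h : thetaSq n ^ (j + 1) = 0) :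
    gen k * thetaSq n ^ j = 0 := by
  have := contr_pow (dualForm k) thetaSq_mem_even j
  rw [h, map_zero, contr_thetaSq, mul_smul_comm, smul_smul,
    mul_comm_of_mem_even (pow_mem_even thetaSq_mem_even _)] at this
  refine (smul_eq_zero.1 this.symm).resolve_left ?_
  have : (0 : ℝ) ≤ j := Nat.cast_nonneg j
  intro h
  linarith

theorem sum_grDeriv_gen_mul {k : ℕ} (x : Gr k) :
    ∑ i, grDeriv i (gen i * x) = (k : ℝ) • x - euler k x := by
  simp only [grDeriv_gen_mul, if_true, Finset.sum_sub_distrib, euler_apply]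
  simp [Nat.cast_smul_eq_nsmul]

/-- If the power j + 1 vanished, every generator would annihilate x = (θ²)^j. Then ∑ ∂_i(θ_i x) =
(2n - 2j) x would be zero, against the induction hypothesis since j < n. -/
theorem thetaSq_pow_ne_zero {j : ℕ} (hj : j ≤ n) : thetaSq n ^ j ≠ 0 := by
  induction j with
  | zero => simp
  | succ j ih =>
    intro h
    have h1 := sum_grDeriv_gen_mul (thetaSq n ^ j)
    simp only [gen_mul_thetaSq_pow_of_eq_zero _ h, map_zero, Finset.sum_const_zero] at h1
    rw [euler_of_mem_pow (thetaSq_pow_mem j), ← sub_smul] at h1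
    refine ih (by omega) ((smul_eq_zero.1 h1.symm).resolve_left ?_)
    have : (j : ℝ) + 1 ≤ n := by exact_mod_cast hj
    push_cast
    intro h
    linarith

/-- The coefficients of the binomial series. -/
theorem prod_div_factorial_eq_choose (s : ℝ) (j : ℕ) :
    (∏ i ∈ Finset.range j, (s - i)) / (j.factorial : ℝ) = Ring.choose s j := by
  have h1 : ∀ i : ℕ, (descPochhammer ℤ i).smeval s = ∏ l ∈ Finset.range i, (s - l) := by
    intro i
    induction i with
    | zero => simp [Polynomial.smeval_one]
    | succ i ih =>
      rw [descPochhammer_succ_right, Polynomial.smeval_mul, ih, Finset.prod_range_succ]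
      simp [Polynomial.smeval_sub, Polynomial.smeval_X, Polynomial.smeval_natCast]
  have h := Ring.descPochhammer_eq_factorial_smul_choose s j
  rw [h1, nsmul_eq_mul] at h
  rw [h, mul_div_cancel_left₀ _ (by positivity)]

theorem oneSubThetaSqPow_eq (s : ℝ) : oneSubThetaSqPow n s =
    ∑ j ∈ Finset.range (n + 1), Ring.choose s j • (-thetaSq n) ^ j := by
  simp only [oneSubThetaSqPow, prod_div_factorial_eq_choose]

theorem neg_thetaSq_mem_even : -thetaSq n ∈ parity (2 * n) 0 :=
  Submodule.neg_mem _ thetaSq_mem_even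

theorem neg_thetaSq_pow_eq_zero {j : ℕ} (hj : n < j) : (-thetaSq n) ^ j = 0 := by
  obtain ⟨i, rfl⟩ := Nat.exists_eq_add_of_le hj
  rw [pow_add, neg_pow, Nat.succ_eq_add_one, thetaSq_pow_succ]; simp

theorem oneSubThetaSqPow_mem_even (s : ℝ) : oneSubThetaSqPow n s ∈ parity (2 * n) 0 :=
  Submodule.sum_mem _ fun _ _ => Submodule.smul_mem _ _ (pow_mem_even neg_thetaSq_mem_even _)

theorem oneSubThetaSqPow_zero : oneSubThetaSqPow n 0 = 1 := by
  rw [oneSubThetaSqPow_eq, Finset.sum_eq_single 0]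
  · simp
  · intro j _ hj
    obtain ⟨i, rfl⟩ := Nat.exists_eq_succ_of_ne_zero hj
    rw [Nat.succ_eq_add_one, Ring.choose_zero_succ, zero_smul]
  · simp

/-- Vandermonde's identity for generalised binomial coefficients. Truncation is harmless: the
products of total exponent above n are zero. -/
theorem oneSubThetaSqPow_mul (s t : ℝ) :
    oneSubThetaSqPow n s * oneSubThetaSqPow n t = oneSubThetaSqPow n (s + t) := by
  simp only [oneSubThetaSqPow_eq]
  have h1 : ∀ j, Ring.choose (s + t) j • (-thetaSq n) ^ j = ∑ i ∈ Finset.range (j + 1),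
      (fun a b => (Ring.choose s a * Ring.choose t b) • (-thetaSq n) ^ (a + b)) i (j - i) := by
    intro j
    rw [Ring.add_choose_eq j (Commute.all s t), Finset.sum_smul,
      Finset.Nat.sum_antidiagonal_eq_sum_range_succ_mk]
    refine Finset.sum_congr rfl fun i hi => ?_
    simp only
    rw [Nat.add_sub_cancel' (by simpa [Nat.lt_succ_iff] using hi)]
  simp_rw [h1]
  rw [Finset.sum_range_diag_flip (n + 1)
    (fun a b => (Ring.choose s a * Ring.choose t b) • (-thetaSq n) ^ (a + b)), Finset.sum_mul_sum]
  refine Finset.sum_congr rfl fun i _ => ?_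
  symm
  simp only [smul_mul_smul_comm, ← pow_add]
  refine Finset.sum_subset (Finset.range_subset_range.2 (by omega)) fun b _ hb => ?_
  rw [neg_thetaSq_pow_eq_zero (by simp at hb; omega), smul_zero]

theorem contr_oneSubThetaSqPow (d : Module.Dual ℝ (Fin (2 * n) → ℝ)) (s : ℝ) :
    contr d (oneSubThetaSqPow n s) = (-s) • (oneSubThetaSqPow n (s - 1) * contr d (thetaSq n)) := by
  have hc : ∀ j : ℕ, Ring.choose s (j + 1) * ((j : ℝ) + 1) = s * Ring.choose (s - 1) j := by
    intro j
    simp only [← prod_div_factorial_eq_choose]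
    rw [Finset.prod_range_succ', Nat.factorial_succ]
    have : ∏ k ∈ Finset.range j, (s - ((k + 1 : ℕ) : ℝ)) = ∏ k ∈ Finset.range j, (s - 1 - k) :=
      Finset.prod_congr rfl fun k _ => by push_cast; ring
    rw [this]
    push_cast
    have h1 : (j.factorial : ℝ) ≠ 0 := by positivity
    have h2 : (j : ℝ) + 1 ≠ 0 := by positivity
    field_simp
    ring
  -- The truncated series for s - 1 has one term more than the derivative of the truncated series
  -- for s. That term comes from the derivative of the vanishing power n + 1.
  have hz : (-thetaSq n) ^ n * contr d (-thetaSq n) = 0 := by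
    have := contr_pow d (neg_thetaSq_mem_even (n := n)) n
    rw [neg_thetaSq_pow_eq_zero (Nat.lt_succ_self n), map_zero] at this
    exact (smul_eq_zero.1 this.symm).resolve_left (by positivity)
  have e : (-s) • (oneSubThetaSqPow n (s - 1) * contr d (thetaSq n)) =
      s • (oneSubThetaSqPow n (s - 1) * contr d (-thetaSq n)) := by
    rw [map_neg, mul_neg, smul_neg, neg_smul]
  rw [e, oneSubThetaSqPow_eq, oneSubThetaSqPow_eq, map_sum, Finset.sum_range_succ', Finset.sum_mul,
    Finset.sum_range_succ, smul_mul_assoc, hz, smul_zero, add_zero, Finset.smul_sum]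
  rw [map_smul, pow_zero]
  have : contr d (1 : Gr (2 * n)) = 0 := CliffordAlgebra.contractLeft_one _ d
  rw [this, smul_zero, add_zero]
  refine Finset.sum_congr rfl fun j _ => ?_
  rw [map_smul, contr_pow d neg_thetaSq_mem_even, smul_smul, hc, smul_mul_assoc, smul_smul]

theorem contr_dualForm_oneSubThetaSqPow (k : Fin (2 * n)) (s : ℝ) :
    contr (dualForm k) (oneSubThetaSqPow n s) =
      (2 * s) • (oneSubThetaSqPow n (s - 1) * gen k) := by
  rw [contr_oneSubThetaSqPow, contr_thetaSq, mul_smul_comm, smul_smul]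
  congr 1; ring

end Theta

/-! ### The Berezin integral -/

section Berezin

variable {k : ℕ}

/-- Iterated left derivatives along a list of generators. -/
def iterDeriv (l : List (Fin k)) : Gr k →ₗ[ℝ] Gr k :=
  l.foldl (fun D i => grDeriv i ∘ₗ D) LinearMap.id

theorem iterDeriv_append (l : List (Fin k)) (i : Fin k) (x : Gr k) :
    iterDeriv (l ++ [i]) x = grDeriv i (iterDeriv l x) := by
  simp [iterDeriv, List.foldl_append]

theorem grDeriv_comm (i j : Fin k) (x : Gr k) :
    grDeriv i (grDeriv j x) = -grDeriv j (grDeriv i x) :=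
  CliffordAlgebra.contractLeft_comm _ _ _

theorem grDeriv_grDeriv (i : Fin k) (x : Gr k) : grDeriv i (grDeriv i x) = 0 :=
  CliffordAlgebra.contractLeft_contractLeft _ _

theorem iterDeriv_grDeriv (l : List (Fin k)) (i : Fin k) (x : Gr k) :
    iterDeriv l (grDeriv i x) = (-1 : ℝ) ^ l.length • grDeriv i (iterDeriv l x) := by
  induction l using List.reverseRecOn with
  | nil => simp [iterDeriv]
  | append_singleton l j ih =>
    rw [iterDeriv_append, ih, iterDeriv_append, map_smul, grDeriv_comm j i]
    simp [pow_succ]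

theorem grDeriv_iterDeriv_of_mem {l : List (Fin k)} {i : Fin k} (hi : i ∈ l) (x : Gr k) :
    grDeriv i (iterDeriv l x) = 0 := by
  induction l using List.reverseRecOn with
  | nil => simp at hi
  | append_singleton l j ih =>
    rw [iterDeriv_append]
    by_cases h : i = j
    · subst h; exact grDeriv_grDeriv _ _
    · have : i ∈ l := by simpa [h] using hi
      rw [grDeriv_comm, ih this, map_zero, neg_zero]

theorem eq_algebraMap_of_grDeriv_eq_zero {x : Gr k} (hx : ∀ i, grDeriv i x = 0) :
    x = algebraMap ℝ (Gr k) (body x) := by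
  refine eq_algebraMap_of_euler_eq_zero ?_
  simp [euler_apply, hx]

/-- An element already differentiated in every direction is killed by each derivative, hence is a
scalar. -/
theorem iterDeriv_finRange (x : Gr k) : iterDeriv (List.finRange k) x =
    algebraMap ℝ (Gr k) (body (iterDeriv (List.finRange k) x)) :=
  eq_algebraMap_of_grDeriv_eq_zero fun i => grDeriv_iterDeriv_of_mem (List.mem_finRange i) x

theorem berezin_apply (n : ℕ) (x : Gr (2 * n)) :
    berezin n x = (Real.pi ^ n)⁻¹ * body (iterDeriv (List.finRange (2 * n)) x) := rfl

theorem berezin_grDeriv {n : ℕ} (i : Fin (2 * n)) (x : Gr (2 * n)) :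
    berezin n (grDeriv i x) = 0 := by
  rw [berezin_apply, iterDeriv_grDeriv, grDeriv_iterDeriv_of_mem (List.mem_finRange i), smul_zero,
    map_zero, mul_zero]

theorem berezin_contr {n : ℕ} (d : Module.Dual ℝ (Fin (2 * n) → ℝ)) (x : Gr (2 * n)) :
    berezin n (contr d x) = 0 := by
  rw [contr_eq_sum, map_sum]
  exact Finset.sum_eq_zero fun i _ => by rw [map_smul, berezin_grDeriv, smul_zero]

/-- Integration by parts. If P does not involve θ_i, then ∂_i(θ_i P y) = P y - θ_i P' ∂_i y with P'
the grade involution of P, so σ(P y) = σ(θ_i P' ∂_i y). Thus P is, up to sign, the product of the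
generators in l. -/
theorem exists_forall_eq_mul_iterDeriv (l : List (Fin k)) (hl : l.Nodup) :
    ∃ P : Gr k, (∀ j ∉ l, grDeriv j P = 0) ∧ ∀ σ : Gr k →ₗ[ℝ] ℝ,
      (∀ i x, σ (grDeriv i x) = 0) → ∀ x, σ x = σ (P * iterDeriv l x) := by
  induction l using List.reverseRecOn with
  | nil => exact ⟨1, fun j _ => CliffordAlgebra.contractLeft_one _ _, fun σ _ x => by simp [iterDeriv]⟩
  | append_singleton l i ih =>
    rw [List.nodup_append] at hl
    obtain ⟨hl1, -, hl2⟩ := hl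
    have hi : i ∉ l := fun h => hl2 i h i (by simp) rfl
    obtain ⟨P, hP, hσ⟩ := ih hl1
    have hinv : ∀ j, grDeriv j P = 0 → grDeriv j (invol k P) = 0 := fun j hj => by
      have := contr_invol (LinearMap.proj j) P
      change grDeriv j (invol k P) = -invol k (grDeriv j P) at this
      rw [this, hj, map_zero, neg_zero]
    refine ⟨gen i * invol k P, fun j hj => ?_, fun σ h x => ?_⟩
    · have hj' : j ∉ l ∧ ¬ j = i := by simpa using hj
      rw [grDeriv_gen_mul, if_neg hj'.2, hinv j (hP j hj'.1), mul_zero, sub_zero]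
    · rw [hσ σ h x, iterDeriv_append]
      set y := iterDeriv l x
      have h1 := grDeriv_gen_mul i i (P * y)
      have h2 : grDeriv i (P * y) = invol k P * grDeriv i y := by
        have := contr_mul (LinearMap.proj i) P y
        change grDeriv i (P * y) = grDeriv i P * y + invol k P * grDeriv i y at this
        rw [this, hP i hi, zero_mul, zero_add]
      rw [if_pos rfl, h2, ← mul_assoc (gen i) (invol k P)] at h1
      have h3 := congrArg σ h1
      rw [h, map_sub] at h3
      linarith

/-- Integrating by parts in all generators replaces x by its full derivative, which is a scalar. -/
theorem exists_eq_smul_berezin {n : ℕ} (σ : Gr (2 * n) →ₗ[ℝ] ℝ)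
    (hσ : ∀ i x, σ (grDeriv i x) = 0) : ∃ c : ℝ, σ = c • berezin n := by
  obtain ⟨P, -, hP⟩ := exists_forall_eq_mul_iterDeriv _ (List.nodup_finRange (2 * n))
  refine ⟨σ P * Real.pi ^ n, LinearMap.ext fun x => ?_⟩
  rw [hP σ hσ x, iterDeriv_finRange, ← Algebra.commutes, ← Algebra.smul_def, map_smul,
    LinearMap.smul_apply, berezin_apply, smul_eq_mul, smul_eq_mul]
  have : Real.pi ^ n ≠ 0 := pow_ne_zero _ Real.pi_ne_zero
  field_simp

/-- Since y = ∂_i(θ_i y) + θ_i ∂_i y, an element annihilated by θ_i has ∂_i y ≠ 0 unless y = 0; and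
∂_i y is still annihilated by the other generators that annihilate y. Applied to the top power of
θ², it shows that its Berezin integral is nonzero. -/
theorem iterDeriv_ne_zero {x : Gr k} (hx : x ≠ 0) (h : ∀ i, gen i * x = 0) (l : List (Fin k))
    (hl : l.Nodup) : iterDeriv l x ≠ 0 ∧ ∀ i ∉ l, gen i * iterDeriv l x = 0 := by
  induction l using List.reverseRecOn with
  | nil => exact ⟨by simpa [iterDeriv] using hx, fun i _ => by simpa [iterDeriv] using h i⟩
  | append_singleton l i ih =>
    rw [List.nodup_append] at hl
    obtain ⟨hl1, -, hl2⟩ := hl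
    have hi : i ∉ l := fun h => hl2 i h i (by simp) rfl
    obtain ⟨h1, h2⟩ := ih hl1
    rw [iterDeriv_append]
    set y := iterDeriv l x
    constructor
    · intro h0
      have := grDeriv_gen_mul i i y
      rw [h2 i hi, map_zero, if_pos rfl, h0, mul_zero, sub_zero] at this
      exact h1 this.symm
    · intro j hj
      have hj' : j ∉ l ∧ ¬ j = i := by simpa using hj
      have := grDeriv_gen_mul i j y
      rw [h2 j hj'.1, map_zero, if_neg (fun h => hj'.2 h.symm), zero_sub] at this
      exact neg_eq_zero.1 this.symm

theorem berezin_thetaSq_pow_ne_zero (n : ℕ) : berezin n (thetaSq n ^ n) ≠ 0 := by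
  have h := (iterDeriv_ne_zero (thetaSq_pow_ne_zero (le_refl n))
    (fun i => gen_mul_thetaSq_pow_of_eq_zero i thetaSq_pow_succ) _
    (List.nodup_finRange (2 * n))).1
  rw [berezin_apply]
  refine mul_ne_zero (inv_ne_zero (pow_ne_zero _ Real.pi_ne_zero)) fun h0 => h ?_
  rw [iterDeriv_finRange, h0, map_zero]

theorem contr_map (f : (Fin k → ℝ) →ₗ[ℝ] (Fin k → ℝ)) (d : Module.Dual ℝ (Fin k → ℝ)) (x : Gr k) :
    contr d (ExteriorAlgebra.map f x) = ExteriorAlgebra.map f (contr (d ∘ₗ f) x) := by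
  induction x using CliffordAlgebra.left_induction with
  | algebraMap r => simp
  | add x₁ x₂ h₁ h₂ => simp only [map_add, h₁, h₂]
  | ι_mul y w h =>
    have e : CliffordAlgebra.ι (0 : QuadraticForm ℝ (Fin k → ℝ)) w = ExteriorAlgebra.ι ℝ w := rfl
    rw [e, map_mul, ExteriorAlgebra.map_apply_ι, contr_ι_mul, h, contr_ι_mul, map_sub, map_mul,
      map_smul, ExteriorAlgebra.map_apply_ι]
    rfl

/-- Naturality of contraction makes x ↦ ∫_B f(x) kill derivatives, so it is c ∫_B. The fixed element
(θ²)^n has nonzero integral, so c = 1; no determinant of f has to be computed. -/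
theorem berezin_map_of_thetaSq {n : ℕ} (f g : (Fin (2 * n) → ℝ) →ₗ[ℝ] (Fin (2 * n) → ℝ))
    (hgf : g ∘ₗ f = LinearMap.id) (hf : ExteriorAlgebra.map f (thetaSq n) = thetaSq n)
    (x : Gr (2 * n)) : berezin n (ExteriorAlgebra.map f x) = berezin n x := by
  obtain ⟨c, hc⟩ := exists_eq_smul_berezin (berezin n ∘ₗ (ExteriorAlgebra.map f).toLinearMap)
    (fun i x => by
      have := contr_map f (LinearMap.proj i ∘ₗ g) x
      rw [LinearMap.comp_assoc, hgf, LinearMap.comp_id] at this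
      change berezin n (ExteriorAlgebra.map f (contr (LinearMap.proj i) x)) = 0
      rw [← this, berezin_contr])
  have h1 := LinearMap.congr_fun hc (thetaSq n ^ n)
  simp only [LinearMap.comp_apply, AlgHom.toLinearMap_apply, map_pow, hf, LinearMap.smul_apply,
    smul_eq_mul] at h1
  have hc1 : c = 1 := by
    have h2 := berezin_thetaSq_pow_ne_zero n
    exact mul_right_cancel₀ h2 (by rw [← h1, one_mul])
  have h3 := LinearMap.congr_fun hc x
  rw [hc1, one_smul] at h3
  exact h3

end Berezin

/-! ### Derivations of graded tensor products -/

/-- The Leibniz rule for a linear endomorphism of a possibly noncommutative algebra. -/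
def IsLeibniz {R : Type*} [Ring R] [Algebra ℝ R] (δ : R →ₗ[ℝ] R) : Prop :=
  ∀ x y, δ (x * y) = δ x * y + x * δ y

section Leibniz

variable {R : Type*} [Ring R] [Algebra ℝ R]

theorem IsLeibniz.add {δ₁ δ₂ : R →ₗ[ℝ] R} (h₁ : IsLeibniz δ₁) (h₂ : IsLeibniz δ₂) :
    IsLeibniz (δ₁ + δ₂) := fun x y => by
  simp only [LinearMap.add_apply, h₁ x y, h₂ x y, add_mul, mul_add]; abel

theorem IsLeibniz.sub {δ₁ δ₂ : R →ₗ[ℝ] R} (h₁ : IsLeibniz δ₁) (h₂ : IsLeibniz δ₂) :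
    IsLeibniz (δ₁ - δ₂) := fun x y => by
  simp only [LinearMap.sub_apply, h₁ x y, h₂ x y, sub_mul, mul_sub]; abel

theorem IsLeibniz.smul (c : ℝ) {δ : R →ₗ[ℝ] R} (h : IsLeibniz δ) : IsLeibniz (c • δ) :=
  fun x y => by simp only [LinearMap.smul_apply, h x y, smul_add, smul_mul_assoc, mul_smul_comm]

theorem IsLeibniz.sum {ι : Type*} (s : Finset ι) {δ : ι → R →ₗ[ℝ] R}
    (h : ∀ i ∈ s, IsLeibniz (δ i)) : IsLeibniz (∑ i ∈ s, δ i) := fun x y => by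
  simp only [LinearMap.sum_apply, Finset.sum_mul, Finset.mul_sum, ← Finset.sum_add_distrib]
  exact Finset.sum_congr rfl fun i hi => h i hi x y

theorem IsLeibniz.map_one {δ : R →ₗ[ℝ] R} (h : IsLeibniz δ) : δ 1 = 0 := by
  have := h 1 1
  simp only [mul_one, one_mul] at this
  exact left_eq_add.1 this

variable {A : Type*} [CommRing A] [Algebra ℝ A]

theorem isLeibniz_mulLeft_tensor (a : A) {δ : R →ₗ[ℝ] R} (h : IsLeibniz δ) :
    IsLeibniz (TensorProduct.map (LinearMap.mulLeft ℝ a) δ) := by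
  intro x y
  induction x using TensorProduct.induction_on with
  | zero => simp
  | add x₁ x₂ h₁ h₂ => simp only [add_mul, map_add, h₁, h₂]; abel
  | tmul f b =>
    induction y using TensorProduct.induction_on with
    | zero => simp
    | add x₁ x₂ h₁ h₂ => simp only [mul_add, map_add, h₁, h₂]; abel
    | tmul g b' =>
      simp only [Algebra.TensorProduct.tmul_mul_tmul, TensorProduct.map_tmul,
        LinearMap.mulLeft_apply, h b b', TensorProduct.tmul_add]
      congr 2 <;> ring

theorem isLeibniz_tensor_mulLeft {δ : A →ₗ[ℝ] A} (h : IsLeibniz δ) (z : R)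
    (hz : ∀ x, z * x = x * z) : IsLeibniz (TensorProduct.map δ (LinearMap.mulLeft ℝ z)) := by
  intro x y
  induction x using TensorProduct.induction_on with
  | zero => simp
  | add x₁ x₂ h₁ h₂ => simp only [add_mul, map_add, h₁, h₂]; abel
  | tmul f b =>
    induction y using TensorProduct.induction_on with
    | zero => simp
    | add x₁ x₂ h₁ h₂ => simp only [mul_add, map_add, h₁, h₂]; abel
    | tmul g b' =>
      simp only [Algebra.TensorProduct.tmul_mul_tmul, TensorProduct.map_tmul,
        LinearMap.mulLeft_apply, h f g, TensorProduct.add_tmul]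
      rw [← mul_assoc b z b', ← hz b, mul_assoc]

/-- The unipotent automorphism `1 + δ` attached to a derivation `δ` with `δ² = 0`. -/
def oneAddHom {δ : R →ₗ[ℝ] R} (h : IsLeibniz δ) (h2 : ∀ x, δ (δ x) = 0) : R →ₐ[ℝ] R :=
  AlgHom.ofLinearMap (LinearMap.id + δ) (by simp [h.map_one]) (fun x y => by
    -- Expanding 0 = δ²(xy) leaves 2 δx δy.
    have h3 : δ x * δ y = 0 := by
      have := h2 (x * y)
      rw [h, map_add, h, h, h2, h2, zero_mul, mul_zero, zero_add, add_zero, ← two_smul ℝ] at this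
      exact (smul_eq_zero.1 this).resolve_left two_ne_zero
    simp only [LinearMap.add_apply, LinearMap.id_apply, h x y, add_mul, mul_add, h3]
    abel)

end Leibniz

/-! ### The sign rule in the graded tensor product of two Grassmann algebras -/

section Graded

variable {k l : ℕ}

/-- The graded tensor product of two Grassmann algebras. -/
abbrev GT (k l : ℕ) : Type := parity k ᵍ⊗[ℝ] parity l

/-- The tensor product of two linear maps, on the graded tensor product. -/
def gtMap (u : Gr k →ₗ[ℝ] Gr k) (v : Gr l →ₗ[ℝ] Gr l) : GT k l →ₗ[ℝ] GT k l :=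
  (GradedTensorProduct.of ℝ (parity k) (parity l)).toLinearMap ∘ₗ TensorProduct.map u v ∘ₗ
    (GradedTensorProduct.of ℝ (parity k) (parity l)).symm.toLinearMap

/-- Pure tensors in the graded tensor product. -/
abbrev gt (a : Gr k) (b : Gr l) : GT k l := GradedTensorProduct.tmul ℝ a b

theorem gtMap_gt (u : Gr k →ₗ[ℝ] Gr k) (v : Gr l →ₗ[ℝ] Gr l) (a : Gr k) (b : Gr l) :
    gtMap u v (gt a b) = gt (u a) (v b) := rfl

theorem gt_add_left (a a' : Gr k) (b : Gr l) : gt (a + a') b = gt a b + gt a' b := by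
  rw [gt, GradedTensorProduct.tmul, TensorProduct.add_tmul, map_add]

theorem gt_add_right (a : Gr k) (b b' : Gr l) : gt a (b + b') = gt a b + gt a b' := by
  rw [gt, GradedTensorProduct.tmul, TensorProduct.tmul_add, map_add]

theorem gt_smul_left (r : ℝ) (a : Gr k) (b : Gr l) : gt (r • a) b = r • gt a b := by
  rw [gt, GradedTensorProduct.tmul, ← TensorProduct.smul_tmul', map_smul]

theorem gt_smul_right (r : ℝ) (a : Gr k) (b : Gr l) : gt a (r • b) = r • gt a b := by
  rw [gt, GradedTensorProduct.tmul, TensorProduct.tmul_smul, map_smul]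

/-- The sign rule for a pair of parities. -/
def sgn (p q : ZMod 2) : ℝ := if p = 1 ∧ q = 1 then -1 else 1

theorem zmod_two_cases (p : ZMod 2) : p = 0 ∨ p = 1 := by revert p; decide

theorem gt_mul_gt {q r : ZMod 2} (a : Gr k) {b : Gr l} (hb : b ∈ parity l q) {a' : Gr k}
    (ha : a' ∈ parity k r) (b' : Gr l) :
    gt a b * gt a' b' = sgn q r • gt (a * a') (b * b') := by
  have := GradedTensorProduct.tmul_coe_mul_coe_tmul (R := ℝ) (parity k) (parity l) a ⟨b, hb⟩
    ⟨a', ha⟩ b'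
  refine this.trans ?_
  rcases zmod_two_cases q with rfl | rfl <;> rcases zmod_two_cases r with rfl | rfl <;>
    simp [sgn, Units.smul_def]

theorem mul_eq_sgn_smul_mul {q r : ZMod 2} {x y : Gr k} (hx : x ∈ parity k q)
    (hy : y ∈ parity k r) : x * y = sgn q r • (y * x) := by
  rcases zmod_two_cases q with rfl | rfl
  · rw [mul_comm_of_mem_even hx]; simp [sgn]
  · rcases zmod_two_cases r with rfl | rfl
    · rw [mul_comm_of_mem_even hy]; simp [sgn]
    · rw [mul_anticomm_of_mem_odd hx hy]; simp [sgn]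

theorem exists_add_parity (x : Gr k) : ∃ a ∈ parity k 0, ∃ b ∈ parity k 1, a + b = x := by
  have : x ∈ parity k 0 ⊔ parity k 1 := by
    rw [(CliffordAlgebra.evenOdd_isCompl _).sup_eq_top]; trivial
  exact Submodule.mem_sup.1 this

theorem gt_induction {P : GT k l → Prop} (hadd : ∀ x y, P x → P y → P (x + y))
    (hgt : ∀ (r q : ZMod 2) (a : Gr k) (b : Gr l), a ∈ parity k r → b ∈ parity l q → P (gt a b))
    (x : GT k l) : P x := by
  induction x using TensorProduct.induction_on with
  | zero =>
    have := hgt 0 0 0 0 (Submodule.zero_mem _) (Submodule.zero_mem _)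
    rwa [gt, GradedTensorProduct.tmul, TensorProduct.zero_tmul, map_zero] at this
  | add x y hx hy => exact hadd _ _ hx hy
  | tmul a b =>
    obtain ⟨a₀, ha₀, a₁, ha₁, rfl⟩ := exists_add_parity a
    obtain ⟨b₀, hb₀, b₁, hb₁, rfl⟩ := exists_add_parity b
    change P (gt _ _)
    rw [gt_add_left, gt_add_right, gt_add_right]
    exact hadd _ _ (hadd _ _ (hgt _ _ _ _ ha₀ hb₀) (hgt _ _ _ _ ha₀ hb₁))
      (hadd _ _ (hgt _ _ _ _ ha₁ hb₀) (hgt _ _ _ _ ha₁ hb₁))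

theorem isLeibniz_of_gt {δ : GT k l →ₗ[ℝ] GT k l}
    (h : ∀ (q r q' r' : ZMod 2) (a : Gr k) (b : Gr l) (a' : Gr k) (b' : Gr l),
      a ∈ parity k q' → b ∈ parity l q → a' ∈ parity k r → b' ∈ parity l r' →
      δ (gt a b * gt a' b') = δ (gt a b) * gt a' b' + gt a b * δ (gt a' b')) :
    IsLeibniz δ := by
  intro x y
  induction x using gt_induction with
  | hadd x₁ x₂ h₁ h₂ => simp only [add_mul, map_add, h₁, h₂]; abel
  | hgt q' q a b ha hb =>
    induction y using gt_induction with
    | hadd x₁ x₂ h₁ h₂ => simp only [mul_add, map_add, h₁, h₂]; abel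
    | hgt r r' a' b' ha' hb' => exact h q r q' r' a b a' b' ha hb ha' hb'

/-- A superderivation of parity `p` of a Grassmann algebra. -/
structure IsSuperDer (p : ZMod 2) (D : Gr l →ₗ[ℝ] Gr l) : Prop where
  mem : ∀ q x, x ∈ parity l q → D x ∈ parity l (q + p)
  leibniz : ∀ q x y, x ∈ parity l q → D (x * y) = D x * y + sgn q p • (x * D y)

/-- A coefficient of the same parity, multiplied from the right, turns a superderivation into an
ordinary derivation. The sign for moving c past a' cancels the one caused by the parity shift in D
b, and the sign for moving b past c is the one in the super Leibniz rule. -/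
theorem IsSuperDer.isLeibniz {p : ZMod 2} {D : Gr l →ₗ[ℝ] Gr l} (hD : IsSuperDer p D) {c : Gr k}
    (hc : c ∈ parity k p) : IsLeibniz (gtMap (LinearMap.mulRight ℝ c) D) := by
  refine isLeibniz_of_gt fun q r q' r' a b a' b' ha hb ha' hb' => ?_
  have e1 : a * c * a' = sgn p r • (a * a' * c) := by
    rw [mul_assoc, mul_eq_sgn_smul_mul hc ha', mul_smul_comm, mul_assoc]
  rw [gt_mul_gt a hb ha', map_smul, gtMap_gt, gtMap_gt, gtMap_gt]
  simp only [LinearMap.mulRight_apply]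
  rw [gt_mul_gt _ (hD.mem q b hb) ha', gt_mul_gt _ hb (mul_mem_parity ha' hc),
    hD.leibniz q b b' hb, e1, gt_add_right, gt_smul_left, gt_smul_right, mul_assoc, smul_add,
    smul_smul, smul_smul]
  congr 2
  · rcases zmod_two_cases q with rfl | rfl <;> rcases zmod_two_cases r with rfl | rfl <;>
      rcases zmod_two_cases p with rfl | rfl <;> simp [sgn, show (1 + 1 : ZMod 2) = 0 by decide]
  · rcases zmod_two_cases q with rfl | rfl <;> rcases zmod_two_cases r with rfl | rfl <;>
      rcases zmod_two_cases p with rfl | rfl <;> simp [sgn, show (1 + 1 : ZMod 2) = 0 by decide]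

theorem isLeibniz_gtMap_euler : IsLeibniz (gtMap (euler k) (LinearMap.id : Gr l →ₗ[ℝ] Gr l)) := by
  refine isLeibniz_of_gt fun q r q' r' a b a' b' ha hb ha' hb' => ?_
  rw [gt_mul_gt a hb ha', map_smul, gtMap_gt, gtMap_gt, gtMap_gt]
  simp only [LinearMap.id_apply]
  rw [gt_mul_gt _ hb ha', gt_mul_gt _ hb (euler_mem ha'), euler_mul, gt_add_left, smul_add]

theorem gtMap_mulRight_mulLeft {p : ZMod 2} {c : Gr k} (hc : c ∈ parity k p) {z : Gr l}
    (hz : z ∈ parity l p) :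
    gtMap (LinearMap.mulRight ℝ c) (LinearMap.mulLeft ℝ z) = LinearMap.mulLeft ℝ (gt c z) := by
  refine LinearMap.ext fun x => ?_
  induction x using gt_induction with
  | hadd x₁ x₂ h₁ h₂ => simp only [map_add, h₁, h₂]
  | hgt r q a b ha hb =>
    rw [gtMap_gt, LinearMap.mulLeft_apply, LinearMap.mulLeft_apply, gt_mul_gt _ hz ha, mul_eq_sgn_smul_mul hc ha,
      gt_smul_left, smul_smul]
    have : sgn p r * sgn p r = 1 := by unfold sgn; split_ifs <;> norm_num
    rw [this, one_smul]; rfl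

/-- Factors of equal parity make c ⊗ z even in total, and even elements are central in a
supercommutative algebra. -/
theorem gt_central {p : ZMod 2} {c : Gr k} (hc : c ∈ parity k p) {z : Gr l}
    (hz : z ∈ parity l p) (x : GT k l) : gt c z * x = x * gt c z := by
  induction x using gt_induction with
  | hadd x₁ x₂ h₁ h₂ => simp only [mul_add, h₁, h₂, add_mul]
  | hgt r q a b ha hb =>
    rw [gt_mul_gt _ hz ha, gt_mul_gt _ hb hc, mul_eq_sgn_smul_mul hc ha,
      mul_eq_sgn_smul_mul hz hb, gt_smul_left, gt_smul_right, smul_smul, smul_smul]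
    congr 1
    unfold sgn
    rcases zmod_two_cases q with rfl | rfl <;> rcases zmod_two_cases r with rfl | rfl <;>
      rcases zmod_two_cases p with rfl | rfl <;> simp

/-- The graded tensor product is the exterior algebra of the direct sum of the two spaces of
generators, so the nilpotency criterion carries over. -/
theorem exists_algHom_nilpotent_ker (k l : ℕ) :
    ∃ β : GT k l →ₐ[ℝ] ℝ, ∀ x, β x = 0 → IsNilpotent x := by
  let e : GT k l ≃ₐ[ℝ] ExteriorAlgebra ℝ ((Fin k → ℝ) × (Fin l → ℝ)) :=
    (CliffordAlgebra.prodEquiv (0 : QuadraticForm ℝ (Fin k → ℝ))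
      (0 : QuadraticForm ℝ (Fin l → ℝ))).symm.trans
      (CliffordAlgebra.equivOfIsometry
        { toLinearEquiv := LinearEquiv.refl ℝ _, map_app' := fun x => by simp })
  refine ⟨ExteriorAlgebra.algebraMapInv.comp e.toAlgHom, fun x hx => ?_⟩
  have := exteriorAlgebra_isNilpotent (x := e x) hx
  exact (IsNilpotent.map_iff e.injective).1 this

theorem exists_algHom_gr_nilpotent_ker (k : ℕ) :
    ∃ β : Gr k →ₐ[ℝ] ℝ, ∀ x, β x = 0 → IsNilpotent x :=
  ⟨body, fun _ hx => exteriorAlgebra_isNilpotent hx⟩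

end Graded

/-! ### Superfunctions with parameters -/

section Over

variable {m n : ℕ} [NeZero m] {N : ℕ}

/-- `Λ_N ⊗ O(S^{m-1|2n})` as a plain tensor product of vector spaces. -/
def overEquiv (m n N : ℕ) [NeZero m] : SFunOver m n N ≃ₗ[ℝ] Gr N ⊗[ℝ] SFun m n :=
  (TensorProduct.congr (LinearEquiv.refl ℝ (SphFun m))
    (GradedTensorProduct.of ℝ (parity N) (parity (2 * n))).symm).trans
    (TensorProduct.leftComm ℝ (SphFun m) (Gr N) (Gr (2 * n)))

/-- The element `a ⊗ f` of `Λ_N ⊗ O(S^{m-1|2n})`. -/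
def ov (a : Gr N) (f : SFun m n) : SFunOver m n N := (overEquiv m n N).symm (a ⊗ₜ f)

theorem ov_tmul (a : Gr N) (h : SphFun m) (w : Gr (2 * n)) :
    ov a (h ⊗ₜ[ℝ] w) = h ⊗ₜ[ℝ] gt a w := by
  rw [ov, LinearEquiv.symm_apply_eq]
  rfl

theorem ov_add_right (a : Gr N) (f g : SFun m n) : ov a (f + g) = ov a f + ov a g := by
  simp [ov, TensorProduct.tmul_add]

theorem ov_add_left (a b : Gr N) (f : SFun m n) : ov (a + b) f = ov a f + ov b f := by
  simp [ov, TensorProduct.add_tmul]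

theorem ov_smul_right (r : ℝ) (a : Gr N) (f : SFun m n) : ov a (r • f) = r • ov a f := by
  simp [ov, TensorProduct.tmul_smul]

theorem ov_smul_left (r : ℝ) (a : Gr N) (f : SFun m n) : ov (r • a) f = r • ov a f := by
  rw [ov, ← TensorProduct.smul_tmul', map_smul]; rfl

theorem ov_zero_right (a : Gr N) : ov a (0 : SFun m n) = 0 := by
  rw [ov, TensorProduct.tmul_zero]; exact LinearEquiv.map_zero _

theorem ov_zero_left (f : SFun m n) : ov (0 : Gr N) f = 0 := by
  rw [ov, TensorProduct.zero_tmul]; exact LinearEquiv.map_zero _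

theorem ov_sum_right {ι : Type*} (s : Finset ι) (a : Gr N) (f : ι → SFun m n) :
    ov a (∑ i ∈ s, f i) = ∑ i ∈ s, ov a (f i) := by
  simp [ov, TensorProduct.tmul_sum]

theorem ov_sum_left {ι : Type*} (s : Finset ι) (a : ι → Gr N) (f : SFun m n) :
    ov (∑ i ∈ s, a i) f = ∑ i ∈ s, ov (a i) f := by
  simp [ov, TensorProduct.sum_tmul]

theorem ov_induction {P : SFunOver m n N → Prop} (hadd : ∀ x y, P x → P y → P (x + y))
    (hov : ∀ a f, P (ov a f)) (x : SFunOver m n N) : P x := by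
  obtain ⟨y, rfl⟩ := (overEquiv m n N).symm.surjective x
  induction y using TensorProduct.induction_on with
  | zero =>
    have := hov 0 0
    rw [ov, TensorProduct.zero_tmul] at this; exact this
  | add x y hx hy => rw [map_add]; exact hadd _ _ hx hy
  | tmul a f => exact hov a f

theorem inclFun_eq (f : SFun m n) : inclFun m n N f = ov 1 f := by
  induction f using TensorProduct.induction_on with
  | zero => simp [ov_zero_right]
  | add x y hx hy => rw [map_add, hx, hy, ov_add_right]
  | tmul h w => rw [ov_tmul]; rfl

theorem inclParam_eq (a : Gr N) : inclParam m n N a = ov a 1 := by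
  rw [Algebra.TensorProduct.one_def, ov_tmul]; rfl

theorem inclParam_mul_ov (a b : Gr N) (f : SFun m n) :
    inclParam m n N a * ov b f = ov (a * b) f := by
  induction f using TensorProduct.induction_on with
  | zero => simp [ov_zero_right]
  | add x y hx hy => simp only [ov_add_right, mul_add, hx, hy]
  | tmul h w =>
    rw [inclParam_eq, Algebra.TensorProduct.one_def, ov_tmul, ov_tmul, ov_tmul,
      Algebra.TensorProduct.tmul_mul_tmul, one_mul]
    congr 1
    obtain ⟨b₀, hb₀, b₁, hb₁, rfl⟩ := exists_add_parity b
    rw [gt_add_left, mul_add, mul_add, gt_add_left, gt_mul_gt _ one_mem_even hb₀,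
      gt_mul_gt _ one_mem_even hb₁]
    simp [sgn]

theorem inclParam_mul_inclFun (a : Gr N) (f : SFun m n) :
    inclParam m n N a * inclFun m n N f = ov a f := by
  rw [inclFun_eq, inclParam_mul_ov, mul_one]

theorem idTensor_ov (T : SFun m n →ₗ[ℝ] ℝ) (a : Gr N) (f : SFun m n) :
    idTensor N T (ov a f) = T f • a := by
  have h : ∀ x, idTensor N T x = (TensorProduct.rid ℝ (Gr N))
      (TensorProduct.map LinearMap.id T (overEquiv m n N x)) := fun _ => rfl
  rw [h, ov, LinearEquiv.apply_symm_apply, TensorProduct.map_tmul, TensorProduct.rid_tmul]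
  rfl

/-- The linear operator `a ⊗ f ↦ u a ⊗ D f`. -/
def ovMap (u : Gr N →ₗ[ℝ] Gr N) (D : SFun m n →ₗ[ℝ] SFun m n) :
    SFunOver m n N →ₗ[ℝ] SFunOver m n N :=
  (overEquiv m n N).symm.toLinearMap ∘ₗ TensorProduct.map u D ∘ₗ (overEquiv m n N).toLinearMap

theorem ovMap_ov (u : Gr N →ₗ[ℝ] Gr N) (D : SFun m n →ₗ[ℝ] SFun m n) (a : Gr N) (f : SFun m n) :
    ovMap u D (ov a f) = ov (u a) (D f) := by
  simp [ovMap, ov]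

theorem ovMap_add_right (u : Gr N →ₗ[ℝ] Gr N) (D D' : SFun m n →ₗ[ℝ] SFun m n) :
    ovMap u (D + D') = ovMap u D + ovMap u D' := by
  simp [ovMap, TensorProduct.map_add_right, LinearMap.comp_add, LinearMap.add_comp]

theorem ovMap_tensor (u : Gr N →ₗ[ℝ] Gr N) (f : SphFun m →ₗ[ℝ] SphFun m)
    (v : Gr (2 * n) →ₗ[ℝ] Gr (2 * n)) :
    ovMap u (TensorProduct.map f v) = TensorProduct.map f (gtMap u v) := by
  refine LinearMap.ext fun x => ?_
  induction x using ov_induction with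
  | hadd x y hx hy => rw [map_add, map_add, hx, hy]
  | hov a g =>
    rw [ovMap_ov]
    induction g using TensorProduct.induction_on with
    | zero => simp [ov_zero_right]
    | add x y hx hy => simp only [map_add, ov_add_right, hx, hy]
    | tmul h w => rw [TensorProduct.map_tmul, ov_tmul, ov_tmul, TensorProduct.map_tmul, gtMap_gt]

theorem idTensor_ovMap_mulRight (T : SFun m n →ₗ[ℝ] ℝ) (c : Gr N) (D : SFun m n →ₗ[ℝ] SFun m n)
    (x : SFunOver m n N) :
    idTensor N T (ovMap (LinearMap.mulRight ℝ c) D x) = idTensor N (T ∘ₗ D) x * c := by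
  induction x using ov_induction with
  | hadd x y hx hy => simp only [map_add, hx, hy, add_mul]
  | hov a g => rw [ovMap_ov, idTensor_ov, idTensor_ov, smul_mul_assoc]; rfl

theorem idTensor_ovMap_euler (T : SFun m n →ₗ[ℝ] ℝ) (x : SFunOver m n N) :
    idTensor N T (ovMap (euler N) LinearMap.id x) = euler N (idTensor N T x) := by
  induction x using ov_induction with
  | hadd x y hx hy => simp only [map_add, hx, hy]
  | hov a g => rw [ovMap_ov, idTensor_ov, idTensor_ov, map_smul]; rfl

/-- With coefficients on the right, the operator is linear over parameters on the left without any
sign. -/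
theorem ovMap_mulRight_inclParam_mul (c : Gr N) (D : SFun m n →ₗ[ℝ] SFun m n) (a : Gr N)
    (x : SFunOver m n N) :
    ovMap (LinearMap.mulRight ℝ c) D (inclParam m n N a * x)
      = inclParam m n N a * ovMap (LinearMap.mulRight ℝ c) D x := by
  induction x using ov_induction with
  | hadd x y hx hy => simp only [mul_add, map_add, hx, hy]
  | hov b g => rw [inclParam_mul_ov, ovMap_ov, ovMap_ov, inclParam_mul_ov]; simp [mul_assoc]

theorem isLeibniz_ovMap_euler :
    IsLeibniz (ovMap (euler N) (LinearMap.id : SFun m n →ₗ[ℝ] SFun m n)) := by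
  have : ovMap (euler N) (LinearMap.id : SFun m n →ₗ[ℝ] SFun m n)
      = TensorProduct.map (LinearMap.mulLeft ℝ (1 : SphFun m))
        (gtMap (euler N) (LinearMap.id : Gr (2 * n) →ₗ[ℝ] Gr (2 * n))) := by
    rw [← ovMap_tensor]; congr 1
    refine TensorProduct.ext' fun h w => by simp
  rw [this]
  exact isLeibniz_mulLeft_tensor _ isLeibniz_gtMap_euler

/-- The product of a function with a superderivation in the odd coordinates gives a derivation with
parameters. -/
theorem isLeibniz_ovMap_mulLeft {p : ZMod 2} {c : Gr N} (hc : c ∈ parity N p) (h : SphFun m)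
    {D : Gr (2 * n) →ₗ[ℝ] Gr (2 * n)} (hD : IsSuperDer p D) :
    IsLeibniz (ovMap (LinearMap.mulRight ℝ c)
      (TensorProduct.map (LinearMap.mulLeft ℝ h) D) : SFunOver m n N →ₗ[ℝ] SFunOver m n N) := by
  rw [ovMap_tensor]
  exact isLeibniz_mulLeft_tensor _ (hD.isLeibniz hc)

/-- The product of an element of the Grassmann algebra with a derivation in the even coordinates
gives a derivation with parameters. -/
theorem isLeibniz_ovMap_tensor {p : ZMod 2} {c : Gr N} (hc : c ∈ parity N p)
    {D : SphFun m →ₗ[ℝ] SphFun m} (hD : IsLeibniz D) {z : Gr (2 * n)}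
    (hz : z ∈ parity (2 * n) p) :
    IsLeibniz (ovMap (LinearMap.mulRight ℝ c)
      (TensorProduct.map D (LinearMap.mulLeft ℝ z)) : SFunOver m n N →ₗ[ℝ] SFunOver m n N) := by
  rw [ovMap_tensor, gtMap_mulRight_mulLeft hc hz]
  exact isLeibniz_tensor_mulLeft hD _ (gt_central hc hz)

/-- The body is unchanged by the grade involution, which negates odd elements. -/
theorem body_of_mem_odd {k : ℕ} {x : Gr k} (hx : x ∈ parity k 1) : body x = 0 := by
  have h1 : (body.comp (invol k) : Gr k →ₐ[ℝ] ℝ) = body := by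
    refine ExteriorAlgebra.hom_ext (LinearMap.ext fun v => ?_)
    change body (invol k (ExteriorAlgebra.ι ℝ v)) = body (ExteriorAlgebra.ι ℝ v)
    rw [invol_ι]; simp [body, ExteriorAlgebra.algebraMapInv]
  have h2 : body (invol k x) = body x := AlgHom.congr_fun h1 x
  rw [invol_of_mem_odd hx, map_neg] at h2
  linarith

/-- Setting the odd parameters equal to zero, on the Grassmann algebras. -/
def gtBody (k l : ℕ) : GT k l →ₐ[ℝ] Gr l :=
  GradedTensorProduct.lift (parity k) (parity l) ((Algebra.ofId ℝ (Gr l)).comp body)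
    (AlgHom.id ℝ (Gr l)) (fun i j a b => by
      rcases zmod_two_cases i with rfl | rfl
      · simp [Algebra.ofId_apply, Algebra.commutes]
      · rw [AlgHom.comp_apply, body_of_mem_odd a.2, map_zero, zero_mul, mul_zero, smul_zero])

/-- Setting the odd parameters equal to zero. -/
def bodyOver (m n N : ℕ) [NeZero m] : SFunOver m n N →ₐ[ℝ] SFun m n :=
  Algebra.TensorProduct.map (AlgHom.id ℝ (SphFun m)) (gtBody N (2 * n))

theorem bodyOver_ov (a : Gr N) (f : SFun m n) : bodyOver m n N (ov a f) = body a • f := by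
  induction f using TensorProduct.induction_on with
  | zero => simp [ov_zero_right]
  | add x y hx hy => simp only [ov_add_right, map_add, hx, hy, smul_add]
  | tmul h w =>
    rw [ov_tmul, bodyOver, Algebra.TensorProduct.map_tmul]
    have : gtBody N (2 * n) (gt a w) = body a • w := by
      change GradedTensorProduct.lift _ _ _ _ _ (GradedTensorProduct.tmul ℝ a w) = _
      rw [GradedTensorProduct.lift_tmul, AlgHom.comp_apply, Algebra.ofId_apply, Algebra.smul_def]
      rfl
    rw [this, TensorProduct.tmul_smul]; rfl

theorem body_idTensor (T : SFun m n →ₗ[ℝ] ℝ) (x : SFunOver m n N) :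
    body (idTensor N T x) = T (bodyOver m n N x) := by
  induction x using ov_induction with
  | hadd x y hx hy => simp only [map_add, hx, hy]
  | hov a g =>
    rw [idTensor_ov, bodyOver_ov, map_smul, map_smul, smul_eq_mul, smul_eq_mul, mul_comm]

end Over

/-! ### Smoothness of integrals depending on a parameter -/

section Parametric

variable {V P : Type} [NormedAddCommGroup V] [NormedSpace ℝ V] [FiniteDimensional ℝ V]
  [NormedAddCommGroup P] [NormedSpace ℝ P] [FiniteDimensional ℝ P] [MeasurableSpace P]
  [BorelSpace P]

/-- Differentiation under the integral sign; the dominating constant is the maximum of the partial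
derivative over the compact set (unit ball around x₀) × K. -/
theorem hasFDerivAt_setIntegral_param (μ : Measure P) [IsFiniteMeasureOnCompacts μ]
    {K : Set P} (hK : IsCompact K) {G : Type} [NormedAddCommGroup G] [NormedSpace ℝ G]
    {f : V × P → G} (hf : ContDiff ℝ 1 f) (x₀ : V) :
    HasFDerivAt (fun x => ∫ y in K, f (x, y) ∂μ)
      (∫ y in K, (fderiv ℝ f (x₀, y)).comp (ContinuousLinearMap.inl ℝ V P) ∂μ) x₀ := by
  have : ProperSpace V := FiniteDimensional.proper ℝ V
  have : ProperSpace P := FiniteDimensional.proper ℝ P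
  have hcont : Continuous fun z : V × P =>
      (fderiv ℝ f z).comp (ContinuousLinearMap.inl ℝ V P) :=
    (hf.continuous_fderiv one_ne_zero).clm_comp continuous_const
  obtain ⟨C, hC⟩ := ((isCompact_closedBall x₀ 1).prod hK).exists_bound_of_continuousOn
    hcont.continuousOn
  refine hasFDerivAt_integral_of_dominated_of_fderiv_le (μ := μ.restrict K)
    (F := fun x y => f (x, y)) (bound := fun _ => C)
    (F' := fun x y => (fderiv ℝ f (x, y)).comp (ContinuousLinearMap.inl ℝ V P))
    (Metric.ball_mem_nhds x₀ one_pos) ?_ ?_ ?_ ?_ ?_ ?_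
  · exact Filter.Eventually.of_forall fun x =>
      (hf.continuous.comp (by fun_prop : Continuous fun y : P => (x, y))).aestronglyMeasurable
  · exact (hf.continuous.comp (by fun_prop : Continuous fun y : P => (x₀, y))).continuousOn
      |>.integrableOn_compact hK
  · exact (hcont.comp (by fun_prop : Continuous fun y : P => (x₀, y))).aestronglyMeasurable
  · refine (ae_restrict_iff' hK.measurableSet).2 (Filter.Eventually.of_forall fun y hy x hx => ?_)
    exact hC (x, y) ⟨Metric.ball_subset_closedBall hx, hy⟩
  · exact (integrableOn_const (hs := hK.measure_lt_top.ne))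
  · refine Filter.Eventually.of_forall fun y x _ => ?_
    have h1 : HasFDerivAt f (fderiv ℝ f (x, y)) (x, y) :=
      (hf.differentiable one_ne_zero _).hasFDerivAt
    exact h1.comp x (hasFDerivAt_prodMk_left x y)

/-- Induction on the order of differentiability. The target G varies in the induction because the
derivative of the integrand takes values in a space of linear maps. -/
theorem contDiff_setIntegral_param (μ : Measure P) [IsFiniteMeasureOnCompacts μ]
    {K : Set P} (hK : IsCompact K) {G : Type} [NormedAddCommGroup G] [NormedSpace ℝ G]
    {f : V × P → G} (hf : ContDiff ℝ ∞ f) : ContDiff ℝ ∞ fun x => ∫ y in K, f (x, y) ∂μ := by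
  rw [contDiff_infty]
  intro n
  induction n generalizing G with
  | zero =>
    rw [CharP.cast_eq_zero, contDiff_zero]
    have hd : Differentiable ℝ fun x => ∫ y in K, f (x, y) ∂μ := fun x =>
      (hasFDerivAt_setIntegral_param μ hK (hf.of_le (by norm_cast)) x).differentiableAt
    exact hd.continuous
  | succ n ih =>
    have h1 : ContDiff ℝ 1 f := hf.of_le (by norm_cast)
    refine contDiff_succ_iff_hasFDerivAt.2 ⟨fun x => _, ?_,
      fun x => hasFDerivAt_setIntegral_param μ hK h1 x⟩
    exact ih (f := fun z : V × P => (fderiv ℝ f z).comp (ContinuousLinearMap.inl ℝ V P))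
      ((hf.fderiv_right (m := ∞) (by norm_cast)).clm_comp contDiff_const)

end Parametric

/-! ### Smooth functions on the sphere -/

section Sphere

set_option linter.unusedSectionVars false

variable {m : ℕ} [NeZero m]

/-- The restriction of a smooth function to the unit sphere. -/
def restr (F : EuclideanSpace ℝ (Fin m) → ℝ) (hF : ContDiff ℝ ∞ F) : SphFun m :=
  ⟨fun p => F p, hF.contMDiff.comp contMDiff_coe_sphere⟩

theorem restr_apply {F : EuclideanSpace ℝ (Fin m) → ℝ} (hF : ContDiff ℝ ∞ F) (p : Sph m) :
    restr F hF p = F p := rfl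

/-- A radial cutoff function. -/
def radialBump : ContDiffBump (1 : ℝ) := ⟨1 / 4, 1 / 2, by norm_num, by norm_num⟩

/-- The radial projection to the unit sphere. -/
def toSph (x : EuclideanSpace ℝ (Fin m)) (hx : x ≠ 0) : Sph m :=
  ⟨‖x‖⁻¹ • x, by simp [norm_smul, hx]⟩

/-- An extension of a smooth function on the sphere to a smooth function with compact support. -/
def ext (h : SphFun m) (x : EuclideanSpace ℝ (Fin m)) : ℝ :=
  if hx : x = 0 then 0 else radialBump ‖x‖ * h (toSph x hx)

theorem radialBump_eq_zero {r : ℝ} (hr : r < 1 / 2 ∨ 2 ≤ r) : radialBump r = 0 := by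
  refine radialBump.zero_of_le_dist ?_
  change 1 / 2 ≤ |r - 1|
  rcases hr with hr | hr
  · rw [abs_of_neg (by linarith)]; linarith
  · rw [abs_of_nonneg (by linarith)]; linarith

theorem radialBump_one : radialBump 1 = 1 :=
  radialBump.one_of_mem_closedBall (by simp [radialBump])

theorem ext_of_ne_zero (h : SphFun m) {x : EuclideanSpace ℝ (Fin m)} (hx : x ≠ 0) :
    ext h x = radialBump ‖x‖ * h (toSph x hx) := dif_neg hx

theorem norm_sph (p : Sph m) : ‖(p : EuclideanSpace ℝ (Fin m))‖ = 1 := by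
  simp

theorem sph_ne_zero (p : Sph m) : (p : EuclideanSpace ℝ (Fin m)) ≠ 0 := by
  rw [← norm_ne_zero_iff, norm_sph]; exact one_ne_zero

theorem toSph_smul (p : Sph m) {r : ℝ} (hr : 0 < r) (h : r • (p : EuclideanSpace ℝ (Fin m)) ≠ 0) :
    toSph (r • (p : EuclideanSpace ℝ (Fin m))) h = p := by
  refine Subtype.ext ?_
  simp only [toSph, norm_smul, norm_sph, mul_one, Real.norm_eq_abs, abs_of_pos hr, smul_smul]
  rw [inv_mul_cancel₀ hr.ne', one_smul]

theorem ext_smul_sph (h : SphFun m) (p : Sph m) {r : ℝ} (hr : 0 ≤ r) :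
    ext h (r • (p : EuclideanSpace ℝ (Fin m))) = radialBump r * h p := by
  rcases hr.eq_or_lt with rfl | hr
  · rw [zero_smul, ext, dif_pos rfl, radialBump_eq_zero (by norm_num), zero_mul]
  · have hne : r • (p : EuclideanSpace ℝ (Fin m)) ≠ 0 := smul_ne_zero hr.ne' (sph_ne_zero p)
    rw [ext_of_ne_zero h hne, toSph_smul p hr, norm_smul, norm_sph, mul_one, Real.norm_eq_abs,
      abs_of_pos hr]

theorem ext_sph (h : SphFun m) (p : Sph m) : ext h (p : EuclideanSpace ℝ (Fin m)) = h p := by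
  have := ext_smul_sph h p zero_le_one
  rwa [one_smul, radialBump_one, one_mul] at this

theorem ext_eq_zero (h : SphFun m) {x : EuclideanSpace ℝ (Fin m)} (hx : ‖x‖ < 1 / 2 ∨ 2 ≤ ‖x‖) :
    ext h x = 0 := by
  by_cases h0 : x = 0
  · exact dif_pos h0
  · rw [ext_of_ne_zero h h0, radialBump_eq_zero hx, zero_mul]

/-- Near the origin the cutoff makes `ext h` zero. Elsewhere it is a smooth radial factor times h
composed with the radial projection, which is smooth into the sphere on the open submanifold of
nonzero vectors. -/
theorem contDiff_ext (h : SphFun m) : ContDiff ℝ ∞ (ext h) := by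
  rw [contDiff_iff_contDiffAt]
  intro x
  by_cases hx : x = 0
  · subst hx
    have : ext h =ᶠ[nhds 0] fun _ => 0 := by
      filter_upwards [Metric.ball_mem_nhds (0 : EuclideanSpace ℝ (Fin m)) one_half_pos] with y hy
      exact ext_eq_zero h (Or.inl (by simpa using hy))
    exact contDiffAt_const.congr_of_eventuallyEq this
  · let U : TopologicalSpace.Opens (EuclideanSpace ℝ (Fin m)) := ⟨{0}ᶜ, isOpen_compl_singleton⟩
    have hUne : ∀ y : U, (y : EuclideanSpace ℝ (Fin m)) ≠ 0 := fun y => y.2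
    have h1 : ContMDiff 𝓘(ℝ, EuclideanSpace ℝ (Fin m)) 𝓘(ℝ, EuclideanSpace ℝ (Fin m)) ∞
        (fun y : U => ‖(y : EuclideanSpace ℝ (Fin m))‖⁻¹ • (y : EuclideanSpace ℝ (Fin m))) := by
      intro y
      refine (contMDiffAt_subtype_iff (U := U) (f := fun z : EuclideanSpace ℝ (Fin m) =>
        ‖z‖⁻¹ • z)).2 (ContDiffAt.contMDiffAt ?_)
      exact ((contDiffAt_norm ℝ (hUne y)).inv (norm_ne_zero_iff.2 (hUne y))).smul contDiffAt_id
    have h2 := h1.codRestrict_sphere (n := m - 1) (fun y => (toSph _ (hUne y)).2)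
    have h3 := h.contMDiff.comp h2
    have h4 : ContMDiffAt 𝓘(ℝ, EuclideanSpace ℝ (Fin m)) 𝓘(ℝ, ℝ) ∞
        (fun z : EuclideanSpace ℝ (Fin m) => if hz : z = 0 then 0 else h (toSph z hz)) x := by
      refine (contMDiffAt_subtype_iff (U := U) (x := ⟨x, hx⟩)).1 ?_
      refine (h3 ⟨x, hx⟩).congr_of_eventuallyEq (Filter.Eventually.of_forall fun y => ?_)
      simp only [dif_neg (hUne y)]
      rfl
    have h5 := contMDiffAt_iff_contDiffAt.1 h4
    have h6 : ContDiffAt ℝ ∞ (fun z : EuclideanSpace ℝ (Fin m) => radialBump ‖z‖) x :=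
      radialBump.contDiff.contDiffAt.comp x (contDiffAt_norm ℝ hx)
    refine (h6.mul h5).congr_of_eventuallyEq (Filter.Eventually.of_forall fun y => ?_)
    by_cases hy : y = 0
    · simp [ext, hy]
    · simp [ext, hy]

theorem sphFun_ext {f g : SphFun m} (h : ∀ p, f p = g p) : f = g := ContMDiffMap.ext h

theorem sphFun_sum_apply {ι : Type*} (s : Finset ι) (f : ι → SphFun m) (p : Sph m) :
    (∑ i ∈ s, f i) p = ∑ i ∈ s, f i p := by
  have := congrFun (map_sum (ContMDiffMap.coeFnAddMonoidHom (I := 𝓡 (m - 1)) (I' := 𝓘(ℝ, ℝ))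
    (N := Sph m) (n := ∞) (G := ℝ)) f s) p
  simpa using this

theorem sphFun_add_apply (f g : SphFun m) (p : Sph m) : (f + g) p = f p + g p := rfl
theorem sphFun_sub_apply (f g : SphFun m) (p : Sph m) : (f - g) p = f p - g p := rfl
theorem sphFun_mul_apply (f g : SphFun m) (p : Sph m) : (f * g) p = f p * g p := rfl
theorem sphFun_smul_apply (c : ℝ) (f : SphFun m) (p : Sph m) : (c • f) p = c * f p := rfl
theorem sphFun_algebraMap_apply (c : ℝ) (p : Sph m) : algebraMap ℝ (SphFun m) c p = c := rfl
theorem xi_apply (i : Fin m) (p : Sph m) : xi i p = (p : EuclideanSpace ℝ (Fin m)) i := rfl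

theorem euclidean_eq_sum (x : EuclideanSpace ℝ (Fin m)) :
    x = ∑ i, x i • EuclideanSpace.single i (1 : ℝ) := by
  ext j
  simp [Pi.single_apply]

theorem clm_eq_sum (L : EuclideanSpace ℝ (Fin m) →L[ℝ] ℝ) (x : EuclideanSpace ℝ (Fin m)) :
    L x = ∑ i, x i * L (EuclideanSpace.single i 1) := by
  conv_lhs => rw [euclidean_eq_sum x]
  simp

theorem sum_sq_sph (p : Sph m) : ∑ i, (p : EuclideanSpace ℝ (Fin m)) i ^ 2 = 1 := by
  have := EuclideanSpace.norm_sq_eq (p : EuclideanSpace ℝ (Fin m))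
  rw [norm_sph] at this
  simpa using this.symm

theorem sum_xi_mul_xi : ∑ i, xi i * xi i = (1 : SphFun m) :=
  sphFun_ext fun p => by
    rw [sphFun_sum_apply]
    refine (Finset.sum_congr rfl fun i _ => ?_).trans (sum_sq_sph p)
    rw [sphFun_mul_apply, xi_apply, pow_two]

/-- Hadamard's lemma on the sphere. -/
theorem exists_hadamard (h : SphFun m) (q : Sph m) : ∃ g : Fin m → SphFun m,
    h - algebraMap ℝ (SphFun m) (h q)
      = ∑ i, (xi i - algebraMap ℝ (SphFun m) ((q : EuclideanSpace ℝ (Fin m)) i)) * g i := by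
  -- The factors are g_i(x) = ∫₀¹ ∂_i(ext h)(q + t(x - q)) dt. The segment from q to x leaves the
  -- sphere and may cross the origin, so a smooth extension to the whole space is required.
  have hs : ∀ i : Fin m, ContDiff ℝ ∞ fun x : EuclideanSpace ℝ (Fin m) =>
      ∫ t in Set.Icc (0 : ℝ) 1, fderiv ℝ (ext h)
        ((q : EuclideanSpace ℝ (Fin m)) + t • (x - q)) (EuclideanSpace.single i 1) := fun i => by
    refine contDiff_setIntegral_param (f := fun z : EuclideanSpace ℝ (Fin m) × ℝ =>
      fderiv ℝ (ext h) ((q : EuclideanSpace ℝ (Fin m)) + z.2 • (z.1 - q))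
        (EuclideanSpace.single i 1)) volume isCompact_Icc ?_
    refine ContDiff.clm_apply ?_ contDiff_const
    refine ((contDiff_ext h).fderiv_right (m := ∞) (by norm_cast)).comp ?_
    fun_prop
  refine ⟨fun i => restr _ (hs i), sphFun_ext fun p => ?_⟩
  rw [sphFun_sum_apply]
  simp only [sphFun_sub_apply, sphFun_mul_apply, sphFun_algebraMap_apply, restr_apply, xi_apply]
  set v : EuclideanSpace ℝ (Fin m) := (p : EuclideanSpace ℝ (Fin m)) - q with hv
  have hd : ∀ t : ℝ, HasDerivAt (fun t : ℝ => ext h ((q : EuclideanSpace ℝ (Fin m)) + t • v))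
      (fderiv ℝ (ext h) ((q : EuclideanSpace ℝ (Fin m)) + t • v) v) t := by
    intro t
    have h1 : HasDerivAt (fun t : ℝ => (q : EuclideanSpace ℝ (Fin m)) + t • v) v t := by
      simpa using ((hasDerivAt_id t).smul_const v).const_add (q : EuclideanSpace ℝ (Fin m))
    exact (((contDiff_ext h).differentiable (by simp)) _).hasFDerivAt.comp_hasDerivAt t h1
  have hc : Continuous fun t : ℝ =>
      fderiv ℝ (ext h) ((q : EuclideanSpace ℝ (Fin m)) + t • v) := by
    refine ((contDiff_ext h).continuous_fderiv (by simp)).comp ?_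
    fun_prop
  have h2 := intervalIntegral.integral_eq_sub_of_hasDerivAt (a := 0) (b := 1) (fun t _ => hd t)
    ((hc.clm_apply continuous_const).intervalIntegrable _ _)
  have h3 : (q : EuclideanSpace ℝ (Fin m)) + v = p := by rw [hv]; abel
  rw [one_smul, zero_smul, add_zero, h3, ext_sph, ext_sph] at h2
  rw [← h2, intervalIntegral.integral_of_le zero_le_one, ← integral_Icc_eq_integral_Ioc]
  simp_rw [clm_eq_sum (fderiv ℝ (ext h) _) v]
  rw [integral_finsetSum]
  · refine Finset.sum_congr rfl fun i _ => ?_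
    rw [integral_const_mul]
    rfl
  · intro i _
    exact (continuous_const.mul (hc.clm_apply continuous_const)).continuousOn.integrableOn_compact
      isCompact_Icc

/-- Derivatives of a function vanishing on the sphere vanish in tangential directions. -/
theorem fderiv_eq_zero_of_tangent {F : EuclideanSpace ℝ (Fin m) → ℝ} (p : Sph m)
    (hF : DifferentiableAt ℝ F p) (h0 : ∀ q : Sph m, F q = 0) {v : EuclideanSpace ℝ (Fin m)}
    (hv : inner ℝ (p : EuclideanSpace ℝ (Fin m)) v = 0) : fderiv ℝ F p v = 0 := by
  -- The normalised line p + t v is a curve on the sphere with velocity v at t = 0; by orthogonality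
  -- the norm of p + t v has no term linear in t.
  set c : ℝ → EuclideanSpace ℝ (Fin m) := fun t =>
    (Real.sqrt (1 + t ^ 2 * ‖v‖ ^ 2))⁻¹ • ((p : EuclideanSpace ℝ (Fin m)) + t • v) with hc
  have hn : ∀ t, ‖(p : EuclideanSpace ℝ (Fin m)) + t • v‖ ^ 2 = 1 + t ^ 2 * ‖v‖ ^ 2 := by
    intro t
    rw [norm_add_sq_real, norm_sph, inner_smul_right, hv, norm_smul, mul_pow]
    simp
  have hpos : ∀ t : ℝ, 0 < 1 + t ^ 2 * ‖v‖ ^ 2 := fun t => by positivity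
  have hcS : ∀ t, c t ∈ Metric.sphere (0 : EuclideanSpace ℝ (Fin m)) 1 := by
    intro t
    have h1 : ‖(p : EuclideanSpace ℝ (Fin m)) + t • v‖ = Real.sqrt (1 + t ^ 2 * ‖v‖ ^ 2) := by
      rw [← hn t, Real.sqrt_sq (norm_nonneg _)]
    have h2 : Real.sqrt (1 + t ^ 2 * ‖v‖ ^ 2) ≠ 0 := (Real.sqrt_pos.2 (hpos t)).ne'
    simp only [hc, mem_sphere_iff_norm, sub_zero, norm_smul, norm_inv, Real.norm_eq_abs,
      abs_of_nonneg (Real.sqrt_nonneg _), h1]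
    exact inv_mul_cancel₀ h2
  have hc0 : c 0 = p := by simp [hc]
  have hd : HasDerivAt c v 0 := by
    have h1 : HasDerivAt (fun t : ℝ => 1 + t ^ 2 * ‖v‖ ^ 2) 0 0 := by
      simpa using ((hasDerivAt_pow 2 (0 : ℝ)).mul_const (‖v‖ ^ 2)).const_add 1
    have h2 : HasDerivAt (fun t : ℝ => (Real.sqrt (1 + t ^ 2 * ‖v‖ ^ 2))⁻¹) 0 0 := by
      have := (h1.sqrt (hpos 0).ne').inv (Real.sqrt_pos.2 (hpos 0)).ne'
      simp only [zero_div, neg_zero] at this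
      exact this
    have h3 : HasDerivAt (fun t : ℝ => (p : EuclideanSpace ℝ (Fin m)) + t • v) v 0 := by
      simpa using ((hasDerivAt_id (0 : ℝ)).smul_const v).const_add
        (p : EuclideanSpace ℝ (Fin m))
    have := h2.smul h3
    simp at this
    exact this
  have hF' : HasFDerivAt F (fderiv ℝ F p) (c 0) := by rw [hc0]; exact hF.hasFDerivAt
  have h1 := hF'.comp_hasDerivAt (0 : ℝ) hd
  have h2 : F ∘ c = fun _ => 0 := funext fun t => h0 ⟨c t, hcS t⟩
  rw [h2] at h1
  exact h1.unique (hasDerivAt_const _ _)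

/-- The tangential projection of the `i`-th basis vector. -/
def tang (i : Fin m) (x : EuclideanSpace ℝ (Fin m)) : EuclideanSpace ℝ (Fin m) :=
  EuclideanSpace.single i 1 - x i • x

theorem inner_tang (i : Fin m) (p : Sph m) :
    inner ℝ (p : EuclideanSpace ℝ (Fin m)) (tang i p) = 0 := by
  rw [tang, inner_sub_right, inner_smul_right, real_inner_self_eq_norm_sq, norm_sph,
    EuclideanSpace.inner_single_right]
  simp

theorem contDiff_tang (i : Fin m) : ContDiff ℝ ∞ (tang i : EuclideanSpace ℝ (Fin m) → _) := by
  unfold tang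
  have : ContDiff ℝ ∞ fun x : EuclideanSpace ℝ (Fin m) => x i :=
    (EuclideanSpace.proj (𝕜 := ℝ) i).contDiff
  exact contDiff_const.sub (this.smul contDiff_id)

/-- The `i`-th component of the tangential gradient on the sphere. -/
def nabla (i : Fin m) : SphFun m →ₗ[ℝ] SphFun m where
  toFun h := restr (fun x => fderiv ℝ (ext h) x (tang i x))
    (((contDiff_ext h).fderiv_right (m := ∞) (by norm_cast)).clm_apply (contDiff_tang i))
  map_add' f g := sphFun_ext fun p => by
    have e : ext (f + g) = ext f + ext g := by
      funext x
      by_cases hx : x = 0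
      · simp [ext, hx]
      · simp [ext, hx, mul_add]
    rw [restr_apply, e, fderiv_add ((contDiff_ext f).differentiable (by simp) _)
      ((contDiff_ext g).differentiable (by simp) _)]
    rfl
  map_smul' c f := sphFun_ext fun p => by
    have e : ext (c • f) = c • ext f := by
      funext x
      by_cases hx : x = 0
      · simp [ext, hx]
      · simp [ext, hx, sphFun_smul_apply]; ring
    rw [restr_apply, e, fderiv_const_smul ((contDiff_ext f).differentiable (by simp) _)]
    rfl

/-- The gradient does not depend on the extension: two extensions differ by a function vanishing on
the sphere, whose tangential derivatives are zero. -/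
theorem nabla_apply (i : Fin m) {h : SphFun m} (p : Sph m) {F : EuclideanSpace ℝ (Fin m) → ℝ}
    (hF : DifferentiableAt ℝ F p) (hFh : ∀ q : Sph m, F q = h q) :
    nabla i h p = fderiv ℝ F p (tang i p) := by
  have hd := (contDiff_ext h).differentiable (by simp) (p : EuclideanSpace ℝ (Fin m))
  have := fderiv_eq_zero_of_tangent (F := ext h - F) p (hd.sub hF)
    (fun q => by simp [ext_sph, hFh]) (inner_tang i p)
  rw [fderiv_sub hd hF] at this
  exact sub_eq_zero.1 this

theorem nabla_mul (i : Fin m) (f g : SphFun m) :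
    nabla i (f * g) = nabla i f * g + f * nabla i g := by
  refine sphFun_ext fun p => ?_
  have hf := (contDiff_ext f).differentiable (by simp) (p : EuclideanSpace ℝ (Fin m))
  have hg := (contDiff_ext g).differentiable (by simp) (p : EuclideanSpace ℝ (Fin m))
  rw [nabla_apply i p (hf.mul hg) (fun q => by simp [ext_sph]), fderiv_mul hf hg,
    sphFun_add_apply, sphFun_mul_apply, sphFun_mul_apply, nabla_apply i p hf (ext_sph f),
    nabla_apply i p hg (ext_sph g)]
  simp [ext_sph]; ring

theorem nabla_xi (i j : Fin m) :
    nabla i (xi j) = algebraMap ℝ (SphFun m) (if i = j then 1 else 0) - xi i * xi j := by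
  refine sphFun_ext fun p => ?_
  rw [nabla_apply i p (F := fun x => x j) ((EuclideanSpace.proj (𝕜 := ℝ) j).differentiableAt)
    (fun q => rfl)]
  have : fderiv ℝ (fun x : EuclideanSpace ℝ (Fin m) => x j) p = EuclideanSpace.proj (𝕜 := ℝ) j :=
    (EuclideanSpace.proj (𝕜 := ℝ) j).fderiv
  rw [this, sphFun_sub_apply, sphFun_mul_apply, sphFun_algebraMap_apply]
  simp [tang, xi_apply, eq_comm]

theorem sum_xi_mul_nabla (h : SphFun m) : ∑ i, xi i * nabla i h = 0 := by
  refine sphFun_ext fun p => ?_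
  have hd := (contDiff_ext h).differentiable (by simp) (p : EuclideanSpace ℝ (Fin m))
  rw [sphFun_sum_apply]
  simp only [sphFun_mul_apply, nabla_apply _ p hd (ext_sph h), xi_apply]
  have : ∑ i, (p : EuclideanSpace ℝ (Fin m)) i • tang i (p : EuclideanSpace ℝ (Fin m)) = 0 := by
    simp only [tang, smul_sub, Finset.sum_sub_distrib, ← euclidean_eq_sum, smul_smul, ← pow_two,
      ← Finset.sum_smul, sum_sq_sph, one_smul, sub_self]
  simp only [← smul_eq_mul, ← map_smul, ← map_sum, this, map_zero]
  rfl

end Sphere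

/-! ### Integration over the sphere -/

section SphereIntegral

variable {m : ℕ} [NeZero m]

set_option linter.unusedSectionVars false

theorem hasCompactSupport_ext (h : SphFun m) : HasCompactSupport (ext h) := by
  refine HasCompactSupport.intro (isCompact_closedBall (0 : EuclideanSpace ℝ (Fin m)) 2) ?_
  intro x hx
  refine ext_eq_zero h (Or.inr ?_)
  have : ¬ ‖x‖ ≤ 2 := by simpa using hx
  linarith

/-- The radial factor in the integral of `ext h`. -/
def radC (m : ℕ) : ℝ := ∫ r in Set.Icc (0 : ℝ) 8, r ^ (m - 1) * radialBump r

theorem radC_eq (m : ℕ) : radC m = ∫ r in Set.Ioi (0 : ℝ), r ^ (m - 1) * radialBump r := by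
  rw [radC, integral_Icc_eq_integral_Ioc]
  symm
  refine setIntegral_eq_of_subset_of_forall_sdiff_eq_zero measurableSet_Ioi
    Set.Ioc_subset_Ioi_self fun r hr => ?_
  have h1 : 0 < r := hr.1
  have h2 : 8 < r := by
    by_contra h
    exact hr.2 ⟨h1, not_lt.1 h⟩
  rw [radialBump_eq_zero (Or.inr (by linarith)), mul_zero]

/-- Polar coordinates, in which `ext h` is a product. Facts about the surface measure are deduced
from Lebesgue measure through this identity. -/
theorem integral_ext (h : SphFun m) : ∫ x, ext h x = radC m * sphIntegral m h := by
  have hdim : Module.finrank ℝ (EuclideanSpace ℝ (Fin m)) = m := finrank_euclideanSpace_fin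
  calc
    ∫ x, ext h x = ∫ x : ({(0)}ᶜ : Set (EuclideanSpace ℝ (Fin m))), ext h x.1
        ∂((volume : Measure (EuclideanSpace ℝ (Fin m))).comap (↑)) := by
      rw [integral_subtype_comap (measurableSet_singleton _).compl fun x ↦ ext h x,
        restrict_compl_singleton]
    _ = ∫ x, h x.1 * radialBump x.2.1 ∂(volume : Measure (EuclideanSpace ℝ (Fin m))).toSphere.prod
        (.volumeIoiPow (Module.finrank ℝ (EuclideanSpace ℝ (Fin m)) - 1)) := by
      have := (volume : Measure
        (EuclideanSpace ℝ (Fin m))).measurePreserving_homeomorphUnitSphereProd.integral_comp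
        (Homeomorph.measurableEmbedding _)
        (fun z : Sph m × Set.Ioi (0 : ℝ) => h z.1 * radialBump z.2.1)
      rw [← this]
      refine integral_congr_ae (Filter.Eventually.of_forall fun x => ?_)
      simp only
      rw [ext_of_ne_zero h x.2, mul_comm]
      congr 2
      · exact Subtype.ext (by simp [toSph])
      · simp
    _ = sphIntegral m h * ∫ r : Set.Ioi (0 : ℝ), radialBump r.1 ∂.volumeIoiPow
        (Module.finrank ℝ (EuclideanSpace ℝ (Fin m)) - 1) :=
      integral_prod_mul (fun p : Sph m => h p) (fun r : Set.Ioi (0 : ℝ) => radialBump r.1)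
    _ = _ := by
      rw [mul_comm, radC_eq, hdim]
      congr 1
      simp only [Measure.volumeIoiPow, ENNReal.ofReal]
      rw [integral_withDensity_eq_integral_smul,
        integral_subtype_comap measurableSet_Ioi
          fun a ↦ Real.toNNReal (a ^ (m - 1)) • radialBump a,
        setIntegral_congr_fun measurableSet_Ioi fun x hx ↦ ?_]
      · simp only [NNReal.smul_def]
        rw [Real.coe_toNNReal _ (pow_nonneg hx.out.le _), smul_eq_mul]
      · exact (measurable_subtype_coe.pow_const _).real_toNNReal

theorem sph_nonempty : Nonempty (Sph m) :=
  ⟨⟨EuclideanSpace.single 0 1, by simp⟩⟩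

theorem radC_mul_sphIntegral_one_pos : 0 < radC m * sphIntegral m 1 := by
  rw [← integral_ext]
  obtain ⟨p⟩ := sph_nonempty (m := m)
  refine (contDiff_ext (1 : SphFun m)).continuous.integral_pos_of_hasCompactSupport_nonneg_nonzero
    (hasCompactSupport_ext _) (fun x => ?_) (x := p) ?_
  · by_cases hx : x = 0
    · simp [ext, hx]
    · rw [ext_of_ne_zero _ hx]
      exact mul_nonneg radialBump.nonneg zero_le_one
  · rw [ext_sph]; exact one_ne_zero

theorem radC_ne_zero (m : ℕ) [NeZero m] : radC m ≠ 0 :=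
  left_ne_zero_of_mul (radC_mul_sphIntegral_one_pos (m := m)).ne'

theorem sphIntegral_one_ne_zero (m : ℕ) [NeZero m] : sphIntegral m 1 ≠ 0 :=
  right_ne_zero_of_mul (radC_mul_sphIntegral_one_pos (m := m)).ne'

/-- Rotation invariance of the surface measure. -/
theorem sphIntegral_comp_isometry
    (e : EuclideanSpace ℝ (Fin m) ≃ₗᵢ[ℝ] EuclideanSpace ℝ (Fin m)) {f g : SphFun m}
    (hfg : ∀ p q : Sph m, (q : EuclideanSpace ℝ (Fin m)) = e p → g p = f q) :
    sphIntegral m g = sphIntegral m f := by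
  have h1 : ∫ x, ext g x = ∫ x, ext f x := by
    rw [← e.measurePreserving.integral_comp e.toHomeomorph.measurableEmbedding (ext f)]
    refine integral_congr_ae (Filter.Eventually.of_forall fun x => ?_)
    by_cases hx : x = 0
    · simp [ext, hx]
    · have hx' : e x ≠ 0 := by simpa using hx
      simp only
      rw [ext_of_ne_zero g hx, ext_of_ne_zero f hx', e.norm_map]
      congr 1
      refine hfg _ _ ?_
      simp [toSph]
  rw [integral_ext, integral_ext] at h1
  exact mul_left_cancel₀ (radC_ne_zero m) h1

/-- The infinitesimal rotations. -/
def xop (i j : Fin m) : SphFun m →ₗ[ℝ] SphFun m :=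
  LinearMap.mulLeft ℝ (xi j) ∘ₗ nabla i - LinearMap.mulLeft ℝ (xi i) ∘ₗ nabla j

theorem xop_apply (i j : Fin m) (h : SphFun m) :
    xop i j h = xi j * nabla i h - xi i * nabla j h := rfl

theorem xop_mul (i j : Fin m) (f g : SphFun m) :
    xop i j (f * g) = xop i j f * g + f * xop i j g := by
  simp only [xop_apply, nabla_mul]; ring

theorem xop_xi (i j l : Fin m) : xop i j (xi l) =
    algebraMap ℝ (SphFun m) (if i = l then 1 else 0) * xi j
      - algebraMap ℝ (SphFun m) (if j = l then 1 else 0) * xi i := by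
  simp only [xop_apply, nabla_xi]; ring

/-- Expand with ∑ ξ_j² = 1 and ∑ ξ_j ∇_j = 0; the terms in which the rotation hits ξ_j add up to -(m
- 1) ξ_i h. A functional killed by rotations can therefore be integrated by parts against the
gradient. -/
theorem nabla_eq_sum_xop (i : Fin m) (h : SphFun m) :
    nabla i h = ∑ j, xop i j (xi j * h) + ((m : ℝ) - 1) • (xi i * h) := by
  have h1 : ∀ j, xop i j (xi j * h) = (xi j * xi j) * nabla i h - xi i * (xi j * nabla j h)
      + ((if i = j then xi i * h else 0) - xi i * h) := by
    intro j
    rw [xop_mul, xop_xi, if_pos rfl, map_one, one_mul]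
    by_cases hij : i = j
    · subst hij; simp [xop_apply, mul_assoc]
    · rw [if_neg hij, if_neg hij, map_zero, xop_apply]; ring
  simp only [h1, Finset.sum_add_distrib, Finset.sum_sub_distrib, ← Finset.sum_mul,
    ← Finset.mul_sum, sum_xi_mul_xi, sum_xi_mul_nabla]
  simp only [Finset.sum_ite_eq, Finset.mem_univ, if_true, Finset.sum_const, Finset.card_univ,
    Fintype.card_fin, ← Nat.cast_smul_eq_nsmul ℝ, sub_smul, one_smul, one_mul, mul_zero, smul_mul_assoc]
  abel

theorem map_nabla_of_xop {W : Type*} [AddCommGroup W] [Module ℝ W] {T : SphFun m →ₗ[ℝ] W}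
    (hT : ∀ i j h, T (xop i j h) = 0) (i : Fin m) (h : SphFun m) :
    T (nabla i h) = ((m : ℝ) - 1) • T (xi i * h) := by
  rw [nabla_eq_sum_xop, map_add, map_sum, map_smul]
  simp [hT]

/-- Rotation fields are tangent to all spheres around the origin, so they do not see the radial
cutoff. -/
theorem ext_xop (i j : Fin m) (h : SphFun m) (x : EuclideanSpace ℝ (Fin m)) :
    ext (xop i j h) x = x j * fderiv ℝ (ext h) x (EuclideanSpace.single i 1)
      - x i * fderiv ℝ (ext h) x (EuclideanSpace.single j 1) := by
  by_cases hx : x = 0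
  · simp [ext, hx]
  · set p := toSph x hx with hp
    set r := ‖x‖ with hr
    have hr0 : 0 < r := norm_pos_iff.2 hx
    have hxp : x = r • (p : EuclideanSpace ℝ (Fin m)) := by
      simp only [hp, toSph, smul_smul, ← hr]
      rw [mul_inv_cancel₀ hr0.ne', one_smul]
    have hG : ∀ y : EuclideanSpace ℝ (Fin m), HasFDerivAt (fun y => ext h (r • y))
        ((fderiv ℝ (ext h) (r • y)).comp (r • ContinuousLinearMap.id ℝ _)) y := fun y =>
      HasFDerivAt.comp y (((contDiff_ext h).differentiable (by simp) _).hasFDerivAt)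
        ((hasFDerivAt_id y).const_smul r)
    -- The function y ↦ ext h (r y) is an extension of `radialBump r • h`, so it computes the
    -- gradient on the sphere of radius r.
    have hn : ∀ l, radialBump r * nabla l h p = r * fderiv ℝ (ext h) x (tang l p) := by
      intro l
      have h1 := nabla_apply l (h := radialBump r • h) p (hG p).differentiableAt
        (fun q => by rw [ext_smul_sph h q hr0.le, sphFun_smul_apply])
      rw [(hG p).fderiv, ← hxp] at h1
      rw [map_smul, sphFun_smul_apply] at h1
      rw [h1]
      simp
    rw [ext_of_ne_zero _ hx, ← hp, ← hr, xop_apply, sphFun_sub_apply, sphFun_mul_apply,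
      sphFun_mul_apply, mul_sub, mul_left_comm _ (xi j p), hn i,
      mul_left_comm _ (xi i p), hn j, xi_apply, xi_apply]
    have hxl : ∀ l, x l = r * (p : EuclideanSpace ℝ (Fin m)) l := by
      intro l
      conv_lhs => rw [hxp]
      simp
    rw [hxl i, hxl j]
    simp only [tang, map_sub, map_smul, smul_eq_mul]
    ring

theorem integral_coord_mul_fderiv (i j : Fin m) {F : EuclideanSpace ℝ (Fin m) → ℝ}
    (hF : ContDiff ℝ ∞ F) (hc : HasCompactSupport F) :
    ∫ x, x j * fderiv ℝ F x (EuclideanSpace.single i 1) = -∫ x, (if i = j then 1 else 0) * F x := by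
  have hd : ∀ x : EuclideanSpace ℝ (Fin m),
      fderiv ℝ (fun x : EuclideanSpace ℝ (Fin m) => x j) x (EuclideanSpace.single i 1)
        = if i = j then 1 else 0 := by
    intro x
    have : fderiv ℝ (fun x : EuclideanSpace ℝ (Fin m) => x j) x
      = EuclideanSpace.proj (𝕜 := ℝ) j := (EuclideanSpace.proj (𝕜 := ℝ) j).fderiv
    rw [this]; simp [eq_comm]
  have hcoord : Continuous fun x : EuclideanSpace ℝ (Fin m) => x j :=
    (EuclideanSpace.proj (𝕜 := ℝ) j).continuous
  have hF' : Continuous fun x => fderiv ℝ F x (EuclideanSpace.single i 1) :=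
    (hF.continuous_fderiv (by simp)).clm_apply continuous_const
  have hc' : HasCompactSupport fun x => fderiv ℝ F x (EuclideanSpace.single i 1) :=
    hc.fderiv_apply (𝕜 := ℝ) _
  have := integral_mul_fderiv_eq_neg_fderiv_mul_of_integrable (𝕜 := ℝ) (μ := volume)
    (f := fun x : EuclideanSpace ℝ (Fin m) => x j) (g := F) (v := EuclideanSpace.single i 1)
    (by
      simp only [hd]
      exact (continuous_const.mul hF.continuous).integrable_of_hasCompactSupport hc.mul_left)
    ((hcoord.mul hF').integrable_of_hasCompactSupport hc'.mul_left)
    ((hcoord.mul hF.continuous).integrable_of_hasCompactSupport hc.mul_left)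
    (fun x _ => (EuclideanSpace.proj (𝕜 := ℝ) j).differentiable x)
    (fun x _ => hF.differentiable (by simp) x)
  rw [this]
  simp only [hd]

/-- After extension this is integration by parts for x_j ∂_i - x_i ∂_j, a field of divergence zero.
-/
theorem sphIntegral_xop (i j : Fin m) (h : SphFun m) : sphIntegral m (xop i j h) = 0 := by
  have hF := contDiff_ext h
  have hc := hasCompactSupport_ext h
  have hint : ∀ i j : Fin m, Integrable fun x : EuclideanSpace ℝ (Fin m) =>
      x j * fderiv ℝ (ext h) x (EuclideanSpace.single i 1) := fun i j => by
    refine Continuous.integrable_of_hasCompactSupport ?_ (hc.fderiv_apply (𝕜 := ℝ) _).mul_left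
    exact (EuclideanSpace.proj (𝕜 := ℝ) j).continuous.mul
      ((hF.continuous_fderiv (by simp)).clm_apply continuous_const)
  have h1 : ∫ x, ext (xop i j h) x = 0 := by
    simp only [ext_xop]
    rw [integral_sub (hint i j) (hint j i), integral_coord_mul_fderiv i j hF hc,
      integral_coord_mul_fderiv j i hF hc]
    simp only [eq_comm, sub_self]
  rw [integral_ext] at h1
  exact (mul_eq_zero.1 h1).resolve_left (radC_ne_zero m)

end SphereIntegral

/-! ### Functionals killed by the infinitesimal rotations -/

section SphereUniqueness

variable {m : ℕ} [NeZero m]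

set_option linter.unusedSectionVars false

/-- Radial integration with weight `r^k`. -/
def radInt (k : ℕ) (G : EuclideanSpace ℝ (Fin m) → ℝ) (x : EuclideanSpace ℝ (Fin m)) : ℝ :=
  ∫ r in Set.Icc (0 : ℝ) 8, r ^ k * G (r • x)

theorem contDiff_radInt_integrand (k : ℕ) {G : EuclideanSpace ℝ (Fin m) → ℝ}
    (hG : ContDiff ℝ ∞ G) :
    ContDiff ℝ ∞ fun z : EuclideanSpace ℝ (Fin m) × ℝ => z.2 ^ k * G (z.2 • z.1) := by
  refine ContDiff.mul (by fun_prop) (hG.comp (by fun_prop))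

theorem contDiff_radInt (k : ℕ) {G : EuclideanSpace ℝ (Fin m) → ℝ} (hG : ContDiff ℝ ∞ G) :
    ContDiff ℝ ∞ (radInt k G) :=
  contDiff_setIntegral_param (f := fun z : EuclideanSpace ℝ (Fin m) × ℝ =>
    z.2 ^ k * G (z.2 • z.1)) volume isCompact_Icc (contDiff_radInt_integrand k hG)

/-- Radial integration as a map from smooth functions to functions on the sphere. -/
def sphRadInt (k : ℕ) (G : EuclideanSpace ℝ (Fin m) → ℝ) (hG : ContDiff ℝ ∞ G) : SphFun m :=
  restr (radInt k G) (contDiff_radInt k hG)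

theorem fderiv_radInt (k : ℕ) {G : EuclideanSpace ℝ (Fin m) → ℝ} (hG : ContDiff ℝ ∞ G)
    (x v : EuclideanSpace ℝ (Fin m)) : fderiv ℝ (radInt k G) x v
      = ∫ r in Set.Icc (0 : ℝ) 8, r ^ (k + 1) * fderiv ℝ G (r • x) v := by
  have hf := contDiff_radInt_integrand k hG
  have h1 := hasFDerivAt_setIntegral_param volume isCompact_Icc (K := Set.Icc (0 : ℝ) 8)
    (hf.of_le (by norm_cast)) x
  have h2 : HasFDerivAt (radInt k G) _ x := h1
  have hcont : Continuous fun r : ℝ => (fderiv ℝ (fun z : EuclideanSpace ℝ (Fin m) × ℝ =>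
      z.2 ^ k * G (z.2 • z.1)) (x, r)).comp
        (ContinuousLinearMap.inl ℝ (EuclideanSpace ℝ (Fin m)) ℝ) :=
    ((hf.continuous_fderiv (by simp)).comp (by fun_prop)).clm_comp continuous_const
  rw [h2.fderiv, ContinuousLinearMap.integral_apply
    (hcont.continuousOn.integrableOn_compact isCompact_Icc)]
  refine integral_congr_ae (Filter.Eventually.of_forall fun r => ?_)
  have h3 : HasFDerivAt (fun z : EuclideanSpace ℝ (Fin m) × ℝ => z.2 ^ k * G (z.2 • z.1))
      (fderiv ℝ (fun z : EuclideanSpace ℝ (Fin m) × ℝ => z.2 ^ k * G (z.2 • z.1)) (x, r)) (x, r) :=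
    (hf.differentiable (by simp) _).hasFDerivAt
  have h4 := h3.comp x (hasFDerivAt_prodMk_left (𝕜 := ℝ) x r)
  have h5 : HasFDerivAt (fun y : EuclideanSpace ℝ (Fin m) => r ^ k * G (r • y))
      (r ^ k • (fderiv ℝ G (r • x)).comp (r • ContinuousLinearMap.id ℝ _)) x :=
    (HasFDerivAt.comp x ((hG.differentiable (by simp) _).hasFDerivAt)
      ((hasFDerivAt_id x).const_smul r)).const_mul (r ^ k)
  have h6 := congrArg (fun L => L v) (h4.unique h5)
  simp only at h6 ⊢
  rw [h6]
  simp [pow_succ]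
  ring

/-- The tangential derivative is ∂_i minus ξ_i times the derivative along p. The latter is the
radial derivative and is integrated by parts in r; boundary terms vanish at 0 because of r^{k+1} and
at 8 because of `hG0`. -/
theorem nabla_sphRadInt (k : ℕ) (i : Fin m) {G : EuclideanSpace ℝ (Fin m) → ℝ}
    (hG : ContDiff ℝ ∞ G) (hG0 : ∀ x, 8 ≤ ‖x‖ → G x = 0)
    (hG' : ContDiff ℝ ∞ fun x => fderiv ℝ G x (EuclideanSpace.single i 1)) :
    nabla i (sphRadInt k G hG) = sphRadInt (k + 1) (fun x => fderiv ℝ G x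
      (EuclideanSpace.single i 1)) hG' + ((k : ℝ) + 1) • (xi i * sphRadInt k G hG) := by
  refine sphFun_ext fun p => ?_
  rw [nabla_apply i p ((contDiff_radInt k hG).differentiable (by simp) _) (fun q => rfl),
    fderiv_radInt k hG]
  rw [sphFun_add_apply, sphFun_smul_apply, sphFun_mul_apply]
  have hc : Continuous fun r : ℝ => fderiv ℝ G (r • (p : EuclideanSpace ℝ (Fin m))) :=
    (hG.continuous_fderiv (by simp)).comp (by fun_prop)
  have hi : ∀ v, IntegrableOn (fun r : ℝ => r ^ (k + 1) *
      fderiv ℝ G (r • (p : EuclideanSpace ℝ (Fin m))) v) (Set.Icc (0 : ℝ) 8) := fun v =>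
    ((by fun_prop : Continuous fun r : ℝ => r ^ (k + 1)).mul
      (hc.clm_apply continuous_const)).continuousOn.integrableOn_compact isCompact_Icc
  have hi' : IntegrableOn (fun r : ℝ => ((k : ℝ) + 1) * r ^ k *
      G (r • (p : EuclideanSpace ℝ (Fin m)))) (Set.Icc (0 : ℝ) 8) :=
    ((by fun_prop : Continuous fun r : ℝ => ((k : ℝ) + 1) * r ^ k).mul
      (hG.continuous.comp (by fun_prop))).continuousOn.integrableOn_compact isCompact_Icc
  have hd : ∀ r : ℝ, HasDerivAt (fun r : ℝ => r ^ (k + 1) * G (r • (p : EuclideanSpace ℝ (Fin m))))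
      (((k : ℝ) + 1) * r ^ k * G (r • (p : EuclideanSpace ℝ (Fin m))) + r ^ (k + 1) *
        fderiv ℝ G (r • (p : EuclideanSpace ℝ (Fin m))) p) r := by
    intro r
    have h1 : HasDerivAt (fun r : ℝ => r • (p : EuclideanSpace ℝ (Fin m))) p r := by
      simpa using (hasDerivAt_id r).smul_const (p : EuclideanSpace ℝ (Fin m))
    have h2 := (hG.differentiable (by simp) (r • (p : EuclideanSpace ℝ (Fin m)))).hasFDerivAt
      |>.comp_hasDerivAt r h1
    have h3 := (hasDerivAt_pow (k + 1) r).mul h2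
    simp at h3
    exact h3
  have h1 : ∫ r in Set.Icc (0 : ℝ) 8, (((k : ℝ) + 1) * r ^ k *
      G (r • (p : EuclideanSpace ℝ (Fin m))) + r ^ (k + 1) *
        fderiv ℝ G (r • (p : EuclideanSpace ℝ (Fin m))) p) = 0 := by
    rw [integral_Icc_eq_integral_Ioc, ← intervalIntegral.integral_of_le (by norm_num),
      intervalIntegral.integral_eq_sub_of_hasDerivAt (fun r _ => hd r)
      (Continuous.intervalIntegrable ?_ _ _)]
    · rw [hG0 _ (by rw [norm_smul, norm_sph]; norm_num)]; simp
    · refine Continuous.add ?_ ?_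
      · exact (by fun_prop : Continuous fun r : ℝ => ((k : ℝ) + 1) * r ^ k).mul
          (hG.continuous.comp (by fun_prop))
      · exact (by fun_prop : Continuous fun r : ℝ => r ^ (k + 1)).mul
          (hc.clm_apply continuous_const)
  rw [integral_add hi' (hi _)] at h1
  have h2 : ∫ r in Set.Icc (0 : ℝ) 8, ((k : ℝ) + 1) * r ^ k *
      G (r • (p : EuclideanSpace ℝ (Fin m))) = ((k : ℝ) + 1) * sphRadInt k G hG p := by
    simp only [mul_assoc]
    rw [integral_const_mul]; rfl
  have h3 : ∀ r : ℝ, r ^ (k + 1) * fderiv ℝ G (r • (p : EuclideanSpace ℝ (Fin m)))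
      (tang i (p : EuclideanSpace ℝ (Fin m)))
      = r ^ (k + 1) * fderiv ℝ G (r • (p : EuclideanSpace ℝ (Fin m))) (EuclideanSpace.single i 1)
      - (p : EuclideanSpace ℝ (Fin m)) i *
        (r ^ (k + 1) * fderiv ℝ G (r • (p : EuclideanSpace ℝ (Fin m))) p) := by
    intro r
    simp only [tang, map_sub, map_smul, smul_eq_mul]; ring
  simp only [h3]
  rw [integral_sub (hi _) ((hi _).const_mul _), integral_const_mul, xi_apply]
  rw [h2] at h1
  have h4 : sphRadInt (k + 1) (fun x => fderiv ℝ G x (EuclideanSpace.single i 1)) hG' p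
      = ∫ r in Set.Icc (0 : ℝ) 8, r ^ (k + 1) *
        fderiv ℝ G (r • (p : EuclideanSpace ℝ (Fin m))) (EuclideanSpace.single i 1) := rfl
  rw [h4]
  linear_combination (-(p : EuclideanSpace ℝ (Fin m)) i) * h1

/-- Convolution of functions supported in a fixed ball. -/
def conv (F φ : EuclideanSpace ℝ (Fin m) → ℝ) (x : EuclideanSpace ℝ (Fin m)) : ℝ :=
  ∫ y in Metric.closedBall (0 : EuclideanSpace ℝ (Fin m)) 2, F y * φ (x - y)

theorem contDiff_conv {F φ : EuclideanSpace ℝ (Fin m) → ℝ} (hF : ContDiff ℝ ∞ F)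
    (hφ : ContDiff ℝ ∞ φ) : ContDiff ℝ ∞ (conv F φ) := by
  refine contDiff_setIntegral_param (f := fun z : EuclideanSpace ℝ (Fin m) ×
    EuclideanSpace ℝ (Fin m) => F z.2 * φ (z.1 - z.2)) volume (isCompact_closedBall _ _) ?_
  exact (hF.comp contDiff_snd).mul (hφ.comp (by fun_prop))

theorem conv_eq_integral {F : EuclideanSpace ℝ (Fin m) → ℝ} (φ : EuclideanSpace ℝ (Fin m) → ℝ)
    (hF0 : ∀ x, 2 ≤ ‖x‖ → F x = 0) (x : EuclideanSpace ℝ (Fin m)) :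
    conv F φ x = ∫ y, F y * φ (x - y) := by
  refine setIntegral_eq_integral_of_forall_compl_eq_zero fun y hy => ?_
  have : ¬ ‖y‖ ≤ 2 := by simpa using hy
  rw [hF0 y (by linarith), zero_mul]

theorem conv_comm {F φ : EuclideanSpace ℝ (Fin m) → ℝ} (hF0 : ∀ x, 2 ≤ ‖x‖ → F x = 0)
    (hφ0 : ∀ x, 2 ≤ ‖x‖ → φ x = 0) : conv F φ = conv φ F := by
  funext x
  rw [conv_eq_integral φ hF0, conv_eq_integral F hφ0,
    ← integral_sub_left_eq_self (fun y => F y * φ (x - y)) volume x]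
  refine integral_congr_ae (Filter.Eventually.of_forall fun y => ?_)
  simp only [sub_sub_cancel]
  ring

/-- The vector field whose divergence is the difference of a function and its average over
translations. -/
def transField (F φ : EuclideanSpace ℝ (Fin m) → ℝ) (i : Fin m) (x : EuclideanSpace ℝ (Fin m)) :
    ℝ :=
  ∫ z in Metric.closedBall (0 : EuclideanSpace ℝ (Fin m)) 2 ×ˢ Set.Icc (0 : ℝ) 1,
    F z.1 * z.1 i * φ (x - z.2 • z.1)

theorem contDiff_transField_integrand {F φ : EuclideanSpace ℝ (Fin m) → ℝ} (hF : ContDiff ℝ ∞ F)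
    (hφ : ContDiff ℝ ∞ φ) (i : Fin m) :
    ContDiff ℝ ∞ fun w : EuclideanSpace ℝ (Fin m) × EuclideanSpace ℝ (Fin m) × ℝ =>
      F w.2.1 * w.2.1 i * φ (w.1 - w.2.2 • w.2.1) := by
  refine ContDiff.mul (ContDiff.mul (hF.comp (by fun_prop)) ?_) (hφ.comp (by fun_prop))
  exact (EuclideanSpace.proj (𝕜 := ℝ) i).contDiff.comp (contDiff_fst.comp contDiff_snd)

theorem isCompact_ball_prod_Icc :
    IsCompact (Metric.closedBall (0 : EuclideanSpace ℝ (Fin m)) 2 ×ˢ Set.Icc (0 : ℝ) 1) :=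
  (isCompact_closedBall _ _).prod isCompact_Icc

theorem contDiff_transField {F φ : EuclideanSpace ℝ (Fin m) → ℝ} (hF : ContDiff ℝ ∞ F)
    (hφ : ContDiff ℝ ∞ φ) (i : Fin m) : ContDiff ℝ ∞ (transField F φ i) :=
  contDiff_setIntegral_param _ isCompact_ball_prod_Icc (contDiff_transField_integrand hF hφ i)

theorem fderiv_transField {F φ : EuclideanSpace ℝ (Fin m) → ℝ} (hF : ContDiff ℝ ∞ F)
    (hφ : ContDiff ℝ ∞ φ) (i : Fin m) (x v : EuclideanSpace ℝ (Fin m)) :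
    fderiv ℝ (transField F φ i) x v
      = ∫ z in Metric.closedBall (0 : EuclideanSpace ℝ (Fin m)) 2 ×ˢ Set.Icc (0 : ℝ) 1,
        F z.1 * z.1 i * fderiv ℝ φ (x - z.2 • z.1) v := by
  have hf := contDiff_transField_integrand hF hφ i
  have h1 := hasFDerivAt_setIntegral_param (P := EuclideanSpace ℝ (Fin m) × ℝ) volume
    isCompact_ball_prod_Icc (hf.of_le (by norm_cast)) x
  have h2 : HasFDerivAt (transField F φ i) _ x := h1
  have hcont : Continuous fun z : EuclideanSpace ℝ (Fin m) × ℝ => (fderiv ℝ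
      (fun w : EuclideanSpace ℝ (Fin m) × EuclideanSpace ℝ (Fin m) × ℝ =>
      F w.2.1 * w.2.1 i * φ (w.1 - w.2.2 • w.2.1)) (x, z)).comp
        (ContinuousLinearMap.inl ℝ (EuclideanSpace ℝ (Fin m)) (EuclideanSpace ℝ (Fin m) × ℝ)) :=
    ((hf.continuous_fderiv (by simp)).comp (by fun_prop)).clm_comp continuous_const
  rw [h2.fderiv, ContinuousLinearMap.integral_apply
    (hcont.continuousOn.integrableOn_compact isCompact_ball_prod_Icc)]
  refine integral_congr_ae (Filter.Eventually.of_forall fun z => ?_)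
  have h3 : HasFDerivAt _ _ ((x, z) : EuclideanSpace ℝ (Fin m) × EuclideanSpace ℝ (Fin m) × ℝ) :=
    (hf.differentiable (by simp) (x, z)).hasFDerivAt
  have h4 := h3.comp x (hasFDerivAt_prodMk_left (𝕜 := ℝ) x z)
  have h5 : HasFDerivAt (fun y : EuclideanSpace ℝ (Fin m) => F z.1 * z.1 i * φ (y - z.2 • z.1))
      ((F z.1 * z.1 i) • (fderiv ℝ φ (x - z.2 • z.1)).comp (ContinuousLinearMap.id ℝ _)) x :=
    (HasFDerivAt.comp x ((hφ.differentiable (by simp) _).hasFDerivAt)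
      ((hasFDerivAt_id x).sub_const (z.2 • z.1))).const_mul (F z.1 * z.1 i)
  have h6 := congrArg (fun L => L v) (h4.unique h5)
  simp only at h6 ⊢
  rw [h6]
  simp

/-- The divergence of the integrand is -d/dt of F(y) φ(x - t y). Integration over t in [0, 1] gives
F(y) (φ(x) - φ(x - y)), and then y is integrated out. -/
theorem sum_fderiv_transField {F φ : EuclideanSpace ℝ (Fin m) → ℝ} (hF : ContDiff ℝ ∞ F)
    (hφ : ContDiff ℝ ∞ φ) (hF0 : ∀ x, 2 ≤ ‖x‖ → F x = 0) (x : EuclideanSpace ℝ (Fin m)) :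
    ∑ i, fderiv ℝ (transField F φ i) x (EuclideanSpace.single i 1)
      = (∫ y, F y) * φ x - conv F φ x := by
  have hcf : Continuous fun z : EuclideanSpace ℝ (Fin m) × ℝ => fderiv ℝ φ (x - z.2 • z.1) :=
    (hφ.continuous_fderiv (by simp)).comp (by fun_prop)
  have hF' : Continuous fun z : EuclideanSpace ℝ (Fin m) × ℝ => F z.1 :=
    hF.continuous.comp continuous_fst
  simp only [fderiv_transField hF hφ]
  rw [← integral_finsetSum]
  swap
  · intro i _
    refine ContinuousOn.integrableOn_compact isCompact_ball_prod_Icc (Continuous.continuousOn ?_)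
    refine (hF'.mul ?_).mul (hcf.clm_apply continuous_const)
    exact (EuclideanSpace.proj (𝕜 := ℝ) i).continuous.comp continuous_fst
  have h1 : ∀ z : EuclideanSpace ℝ (Fin m) × ℝ, ∑ i, F z.1 * z.1 i *
      fderiv ℝ φ (x - z.2 • z.1) (EuclideanSpace.single i 1)
        = F z.1 * fderiv ℝ φ (x - z.2 • z.1) z.1 := by
    intro z
    rw [clm_eq_sum _ z.1, Finset.mul_sum]
    exact Finset.sum_congr rfl fun i _ => by ring
  simp only [h1]
  rw [Measure.volume_eq_prod, setIntegral_prod]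
  swap
  · rw [← Measure.volume_eq_prod]
    exact ContinuousOn.integrableOn_compact isCompact_ball_prod_Icc
      (hF'.mul (hcf.clm_apply continuous_fst)).continuousOn
  have h2 : ∀ y : EuclideanSpace ℝ (Fin m), ∫ t in Set.Icc (0 : ℝ) 1,
      F y * fderiv ℝ φ (x - t • y) y = F y * φ x - F y * φ (x - y) := by
    intro y
    have hd : ∀ t : ℝ, HasDerivAt (fun t : ℝ => -(F y * φ (x - t • y)))
        (F y * fderiv ℝ φ (x - t • y) y) t := by
      intro t
      have h1 : HasDerivAt (fun t : ℝ => x - t • y) (-y) t := by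
        simpa using ((hasDerivAt_id t).smul_const y).const_sub x
      have h2 := (((hφ.differentiable (by simp) (x - t • y)).hasFDerivAt.comp_hasDerivAt t
        h1).const_mul (F y)).neg
      simp at h2
      exact h2
    rw [integral_Icc_eq_integral_Ioc, ← intervalIntegral.integral_of_le zero_le_one,
      intervalIntegral.integral_eq_sub_of_hasDerivAt (fun t _ => hd t)
      (Continuous.intervalIntegrable ?_ _ _)]
    · simp; ring
    · exact continuous_const.mul
        (((hφ.continuous_fderiv (by simp)).comp (by fun_prop)).clm_apply continuous_const)
  simp only [h2]
  rw [integral_sub, integral_mul_const]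
  · congr 2
    refine setIntegral_eq_integral_of_forall_compl_eq_zero fun y hy => ?_
    have : ¬ ‖y‖ ≤ 2 := by simpa using hy
    exact hF0 y (by linarith)
  · exact (hF.continuous.mul continuous_const).continuousOn.integrableOn_compact
      (isCompact_closedBall _ _)
  · exact (hF.continuous.mul (hφ.continuous.comp (by fun_prop))).continuousOn.integrableOn_compact
      (isCompact_closedBall _ _)

/-- Translations by vectors of norm at most 2 cannot bring x back into the ball of radius 2, so the
field still vanishes at the end of the radial interval [0, 8]. -/
theorem transField_eq_zero {F φ : EuclideanSpace ℝ (Fin m) → ℝ} (hφ0 : ∀ x, 2 ≤ ‖x‖ → φ x = 0)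
    (i : Fin m) {x : EuclideanSpace ℝ (Fin m)} (hx : 8 ≤ ‖x‖) : transField F φ i x = 0 := by
  refine setIntegral_eq_zero_of_forall_eq_zero fun z hz => ?_
  have h1 : ‖z.1‖ ≤ 2 := by simpa using hz.1
  have h2 : ‖z.2 • z.1‖ ≤ 2 := by
    rw [norm_smul, Real.norm_eq_abs, abs_of_nonneg hz.2.1]
    nlinarith [hz.2.2, hz.2.1, norm_nonneg z.1]
  rw [hφ0 _ (by linarith [norm_sub_norm_le x (z.2 • z.1)]), mul_zero]

/-- A linear functional on the smooth functions on the sphere which is killed by the infinitesimal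
rotations is a multiple of the integral. -/
theorem exists_eq_smul_sphIntegral (hm : 2 ≤ m) {T : SphFun m →ₗ[ℝ] ℝ}
    (hT : ∀ i j h, T (xop i j h) = 0) : ∃ c : ℝ, T = c • sphIntegral m := by
  -- The weight r^{k+1} is the polar weight r^{m-1}. It is reached from the weight r^k, k = m - 2,
  -- which is why m ≥ 2 is needed.
  obtain ⟨k, rfl⟩ : ∃ k, m = k + 1 + 1 := ⟨m - 2, by omega⟩
  have hdiff : ∀ (i : Fin (k + 1 + 1)) {G : EuclideanSpace ℝ (Fin (k + 1 + 1)) → ℝ}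
      (_ : ContDiff ℝ ∞ G),
      ContDiff ℝ ∞ fun x => fderiv ℝ G x (EuclideanSpace.single i 1) := fun i G hG =>
    (hG.fderiv_right (m := ∞) (by norm_cast)).clm_apply contDiff_const
  -- The term (k + 1) T(ξ_i · radial integral) from `nabla_sphRadInt` equals the term (m - 1) T(ξ_i
  -- · radial integral) from `map_nabla_of_xop`. What remains says that the radially integrated
  -- functional kills partial derivatives.
  have h1 : ∀ (i : Fin (k + 1 + 1)) {G : EuclideanSpace ℝ (Fin (k + 1 + 1)) → ℝ}
      (hG : ContDiff ℝ ∞ G), (∀ x, 8 ≤ ‖x‖ → G x = 0) →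
      T (sphRadInt (k + 1) (fun x => fderiv ℝ G x (EuclideanSpace.single i 1)) (hdiff i hG)) = 0 := by
    intro i G hG hG0
    have h2 := congrArg T (nabla_sphRadInt k i hG hG0 (hdiff i hG))
    rw [map_nabla_of_xop hT, map_add, map_smul] at h2
    push_cast at h2
    rw [add_sub_cancel_right] at h2
    exact right_eq_add.1 h2
  have h2 : ∀ {F φ : EuclideanSpace ℝ (Fin (k + 1 + 1)) → ℝ} (hF : ContDiff ℝ ∞ F)
      (hφ : ContDiff ℝ ∞ φ), (∀ x, 2 ≤ ‖x‖ → F x = 0) → (∀ x, 2 ≤ ‖x‖ → φ x = 0) →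
      T (sphRadInt (k + 1) (conv F φ) (contDiff_conv hF hφ))
        = (∫ y, F y) * T (sphRadInt (k + 1) φ hφ) := by
    intro F φ hF hφ hF0 hφ0
    have h3 : ∑ i, sphRadInt (k + 1) (fun x => fderiv ℝ (transField F φ i) x
        (EuclideanSpace.single i 1)) (hdiff i (contDiff_transField hF hφ i))
        = (∫ y, F y) • sphRadInt (k + 1) φ hφ
          - sphRadInt (k + 1) (conv F φ) (contDiff_conv hF hφ) := by
      refine sphFun_ext fun p => ?_
      rw [sphFun_sum_apply, sphFun_sub_apply, sphFun_smul_apply]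
      simp only [sphRadInt, restr_apply, radInt]
      have hi : ∀ {G : EuclideanSpace ℝ (Fin (k + 1 + 1)) → ℝ}, ContDiff ℝ ∞ G →
          IntegrableOn (fun r : ℝ => r ^ (k + 1) *
            G (r • (p : EuclideanSpace ℝ (Fin (k + 1 + 1))))) (Set.Icc (0 : ℝ) 8) := fun hG =>
        ((by fun_prop : Continuous fun r : ℝ => r ^ (k + 1)).mul
          (hG.continuous.comp (by fun_prop))).continuousOn.integrableOn_compact isCompact_Icc
      rw [← integral_finsetSum _ (fun i _ => hi (hdiff i (contDiff_transField hF hφ i))),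
        ← integral_const_mul, ← integral_sub ((hi hφ).const_mul _) (hi (contDiff_conv hF hφ))]
      refine integral_congr_ae (Filter.Eventually.of_forall fun r => ?_)
      simp only
      rw [← Finset.mul_sum, sum_fderiv_transField hF hφ hF0]
      ring
    have h4 := congrArg T h3
    rw [map_sum, map_sub, map_smul, smul_eq_mul] at h4
    rw [Finset.sum_eq_zero fun i _ => h1 i (contDiff_transField hF hφ i)
      fun x hx => transField_eq_zero hφ0 i hx] at h4
    linarith
  have h3 : ∀ h : SphFun (k + 1 + 1), sphRadInt (k + 1) (ext h) (contDiff_ext h)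
      = radC (k + 1 + 1) • h := by
    intro h
    refine sphFun_ext fun p => ?_
    rw [sphFun_smul_apply, radC, mul_comm, ← integral_const_mul]
    simp only [sphRadInt, restr_apply, radInt]
    refine setIntegral_congr_fun measurableSet_Icc fun r hr => ?_
    change r ^ (k + 1) * ext h _ = h p * (r ^ (k + 1) * _)
    rw [ext_smul_sph h p hr.1]
    ring
  refine ⟨T 1 / sphIntegral (k + 1 + 1) 1, LinearMap.ext fun h => ?_⟩
  have h0 : ∀ (h : SphFun (k + 1 + 1)) x, 2 ≤ ‖x‖ → ext h x = 0 := fun h x hx =>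
    ext_eq_zero h (Or.inr hx)
  -- The convolution of `ext h` and `ext 1` is evaluated in both orders; equality of the two results
  -- is the proportionality of T and the integral.
  have e1 := h2 (contDiff_ext h) (contDiff_ext 1) (h0 _) (h0 _)
  have e2 := h2 (contDiff_ext 1) (contDiff_ext h) (h0 _) (h0 _)
  have e3 : sphRadInt (k + 1) (conv (ext h) (ext 1)) (contDiff_conv (contDiff_ext h)
      (contDiff_ext 1)) = sphRadInt (k + 1) (conv (ext 1) (ext h))
        (contDiff_conv (contDiff_ext 1) (contDiff_ext h)) := by
    congr 1
    exact conv_comm (h0 _) (h0 _)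
  rw [e3, e2, h3, h3, integral_ext, integral_ext, map_smul, map_smul] at e1
  have hr := radC_ne_zero (k + 1 + 1)
  have hs := sphIntegral_one_ne_zero (k + 1 + 1)
  rw [LinearMap.smul_apply, smul_eq_mul, div_mul_eq_mul_div, eq_div_iff hs]
  simp only [smul_eq_mul] at e1
  have e4 : radC (k + 1 + 1) * radC (k + 1 + 1) * (T h * sphIntegral (k + 1 + 1) 1) =
      radC (k + 1 + 1) * radC (k + 1 + 1) * (T 1 * sphIntegral (k + 1 + 1) h) := by
    linear_combination e1
  exact mul_left_cancel₀ (mul_ne_zero hr hr) e4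

end SphereUniqueness

/-! ### Uniqueness of algebra morphisms and derivations on smooth functions -/

section Jets

variable {m : ℕ} [NeZero m]

/-- The vector space of polynomial functions on the sphere. -/
abbrev polySph (m : ℕ) [NeZero m] : Subalgebra ℝ (SphFun m) :=
  Algebra.adjoin ℝ (Set.range (xi : Fin m → SphFun m))

/-- The ideal generated by the coordinate functions centered at a point. -/
def pointIdeal (q : Sph m) : Ideal (SphFun m) :=
  Ideal.span (Set.range fun i : Fin m =>
    xi i - algebraMap ℝ (SphFun m) ((q : EuclideanSpace ℝ (Fin m)) i))

/-- Taylor expansion with remainder in a power of the ideal of a point. -/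
theorem exists_poly_sub_mem_pow (q : Sph m) (L : ℕ) (h : SphFun m) :
    ∃ s ∈ polySph m, h - s ∈ pointIdeal q ^ L := by
  induction L generalizing h with
  | zero => exact ⟨0, Subalgebra.zero_mem _, by simp⟩
  | succ L ih =>
    obtain ⟨g, hg⟩ := exists_hadamard h q
    choose s hs hs' using fun i => ih (g i)
    refine ⟨algebraMap ℝ (SphFun m) (h q) + ∑ i, (xi i -
      algebraMap ℝ (SphFun m) ((q : EuclideanSpace ℝ (Fin m)) i)) * s i, ?_, ?_⟩
    · refine Subalgebra.add_mem _ (Subalgebra.algebraMap_mem _ _) (Subalgebra.sum_mem _ fun i _ => ?_)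
      exact Subalgebra.mul_mem _ (Subalgebra.sub_mem _ (Algebra.subset_adjoin ⟨i, rfl⟩)
        (Subalgebra.algebraMap_mem _ _)) (hs i)
    · rw [← sub_sub, hg, ← Finset.sum_sub_distrib, pow_succ']
      refine Ideal.sum_mem _ fun i _ => ?_
      rw [← mul_sub]
      exact Ideal.mul_mem_mul (Ideal.subset_span ⟨i, rfl⟩) (hs' i)

/-- By Taylor expansion at q, polynomials and any fixed power of the ideal of q span all smooth
functions; no topology on W enters. -/
theorem eq_zero_of_poly_of_pow {W : Type*} [AddCommGroup W] [Module ℝ W] {δ : SphFun m →ₗ[ℝ] W}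
    (h1 : ∀ s ∈ polySph m, δ s = 0) {q : Sph m} {L : ℕ} (h2 : ∀ s ∈ pointIdeal q ^ L, δ s = 0)
    (h : SphFun m) : δ h = 0 := by
  obtain ⟨s, hs, hs'⟩ := exists_poly_sub_mem_pow q L h
  have := h2 _ hs'
  rwa [map_sub, h1 s hs, sub_zero] at this

/-- An algebra morphism to an algebra with a body kills a power of the ideal of a point. -/
theorem exists_pow_le_ker {B : Type*} [Ring B] [Algebra ℝ B] {β : B →ₐ[ℝ] ℝ}
    (hβ : ∀ x, β x = 0 → IsNilpotent x) (ψ : SphFun m →ₐ[ℝ] B) :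
    ∃ q : Sph m, (∀ i, (q : EuclideanSpace ℝ (Fin m)) i = β (ψ (xi i))) ∧
      ∃ L, ∀ s ∈ pointIdeal q ^ L, ψ s = 0 := by
  -- The bodies of the images of the ξ_i satisfy the equation of the sphere, because ψ preserves ∑
  -- ξ_i² = 1.
  have hq : (WithLp.toLp 2 fun i => β (ψ (xi i)) : EuclideanSpace ℝ (Fin m)) ∈
      Metric.sphere (0 : EuclideanSpace ℝ (Fin m)) 1 := by
    rw [mem_sphere_iff_norm, sub_zero, ← sq_eq_sq₀ (norm_nonneg _) zero_le_one,
      EuclideanSpace.norm_sq_eq]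
    have h1 := congrArg (fun f => β (ψ f)) (sum_xi_mul_xi (m := m))
    simp only [map_sum, map_mul, map_one] at h1
    simpa [pow_two] using h1
  refine ⟨⟨_, hq⟩, fun i => rfl, ?_⟩
  -- Each generator has an image with zero body, hence nilpotent. Since the ideal is finitely
  -- generated, some power of it lies in the kernel.
  have hle : pointIdeal (⟨_, hq⟩ : Sph m) ≤ (RingHom.ker ψ).radical := by
    refine Ideal.span_le.2 ?_
    rintro _ ⟨i, rfl⟩
    have hz : β (ψ (xi i - algebraMap ℝ (SphFun m) (β (ψ (xi i))))) = 0 := by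
      rw [map_sub, map_sub, AlgHom.commutes, AlgHom.commutes]
      exact sub_self _
    obtain ⟨N, hN⟩ := hβ _ hz
    exact ⟨N, by rw [RingHom.mem_ker, map_pow]; exact hN⟩
  obtain ⟨L, hL⟩ := Ideal.exists_pow_le_of_le_radical_of_fg hle
    ⟨(Set.finite_range _).toFinset, by rw [Set.Finite.coe_toFinset]; rfl⟩
  exact ⟨L, fun s hs => hL hs⟩

/-- Evaluation at a point. -/
def evalHom (p : Sph m) : SphFun m →ₐ[ℝ] ℝ :=
  AlgHom.ofLinearMap
    (⟨⟨fun f : SphFun m => f p, fun _ _ => rfl⟩, fun _ _ => rfl⟩ : SphFun m →ₗ[ℝ] ℝ)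
    rfl (fun _ _ => rfl)

theorem commute_evalHom {B : Type*} [Ring B] [Algebra ℝ B] (p : Sph m) (f : SphFun m) (b : B) :
    Commute (((Algebra.ofId ℝ B).comp (evalHom p)) f) ((AlgHom.id ℝ B) b) :=
  Algebra.commutes _ _

/-- Evaluation at a point of a function with values in a vector space. -/
def evalAt {B : Type*} [Ring B] [Algebra ℝ B] (p : Sph m) : SphFun m ⊗[ℝ] B →ₐ[ℝ] B :=
  Algebra.TensorProduct.lift ((Algebra.ofId ℝ B).comp (evalHom p))
    (AlgHom.id ℝ B) (commute_evalHom p)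

theorem evalAt_tmul {B : Type*} [Ring B] [Algebra ℝ B] (p : Sph m) (f : SphFun m) (b : B) :
    evalAt p (f ⊗ₜ[ℝ] b) = f p • b := by
  rw [evalAt, Algebra.TensorProduct.lift_tmul, Algebra.smul_def]
  rfl

/-- In a basis of B the coefficients are functions on the sphere, and they vanish at every point. -/
theorem eq_zero_of_evalAt {B : Type*} [Ring B] [Algebra ℝ B] {x : SphFun m ⊗[ℝ] B}
    (hx : ∀ p : Sph m, evalAt p x = 0) : x = 0 := by
  classical
  let b := Module.Basis.ofVectorSpace ℝ B
  obtain ⟨y, rfl⟩ := (TensorProduct.equivFinsuppOfBasisRight (M := SphFun m) b).symm.surjective x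
  have hy : y = 0 := by
    refine Finsupp.ext fun i => sphFun_ext fun p => ?_
    have h1 := hx p
    rw [TensorProduct.equivFinsuppOfBasisRight_symm_apply, Finsupp.sum, map_sum] at h1
    simp only [evalAt_tmul] at h1
    by_cases hi : i ∈ y.support
    · exact linearIndependent_iff'.1 b.linearIndependent _ _ h1 i hi
    · rw [Finsupp.notMem_support_iff.1 hi]
      rfl
  rw [hy, map_zero]

/-- Two derivations along an algebra morphism agree if they agree on the coordinate functions. -/
theorem derivation_eq_zero {B : Type*} [Ring B] [Algebra ℝ B] {β : B →ₐ[ℝ] ℝ}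
    (hβ : ∀ x, β x = 0 → IsNilpotent x) (ψ : SphFun m →ₐ[ℝ] SphFun m ⊗[ℝ] B)
    {δ : SphFun m →ₗ[ℝ] SphFun m ⊗[ℝ] B} (hδ : ∀ f g, δ (f * g) = δ f * ψ g + ψ f * δ g)
    (h0 : ∀ i, δ (xi i) = 0) (f : SphFun m) : δ f = 0 := by
  refine eq_zero_of_evalAt fun p => ?_
  obtain ⟨q, -, L, hL⟩ := exists_pow_le_ker hβ ((evalAt p).comp ψ)
  refine eq_zero_of_poly_of_pow (δ := (evalAt p).toLinearMap ∘ₗ δ) (q := q) (L := L + L)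
    (fun s hs => ?_) (fun s hs => ?_) f
  · have h1 : δ 1 = 0 := by
      have := hδ 1 1
      simp only [mul_one, map_one, one_mul] at this
      exact left_eq_add.1 this
    have : δ s = 0 := by
      induction hs using Algebra.adjoin_induction with
      | mem x hx => obtain ⟨i, rfl⟩ := hx; exact h0 i
      | algebraMap r => rw [Algebra.algebraMap_eq_smul_one, map_smul, h1, smul_zero]
      | add x y _ _ hx hy => rw [map_add, hx, hy, add_zero]
      | mul x y _ _ hx hy => rw [hδ, hx, hy, zero_mul, mul_zero, add_zero]
    rw [LinearMap.comp_apply, this, map_zero]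
  -- Doubling the exponent leaves, after the Leibniz rule, one undifferentiated factor in the L-th
  -- power, which the evaluated morphism kills.
  · rw [pow_add] at hs
    induction hs using Submodule.mul_induction_on' with
    | mem_mul_mem x hx y hy =>
      have hx' := hL x hx
      have hy' := hL y hy
      rw [AlgHom.comp_apply] at hx' hy'
      rw [LinearMap.comp_apply, hδ, AlgHom.toLinearMap_apply, map_add, map_mul, map_mul, hx', hy',
        zero_mul, mul_zero, add_zero]
    | add x _ y _ hx hy => rw [map_add, hx, hy, add_zero]

/-- Two algebra morphisms on smooth functions agree if they agree on the coordinate functions. -/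
theorem algHom_eq_of_xi {B : Type*} [Ring B] [Algebra ℝ B] {β : B →ₐ[ℝ] ℝ}
    (hβ : ∀ x, β x = 0 → IsNilpotent x) {ψ₁ ψ₂ : SphFun m →ₐ[ℝ] SphFun m ⊗[ℝ] B}
    (h0 : ∀ i, ψ₁ (xi i) = ψ₂ (xi i)) : ψ₁ = ψ₂ := by
  refine AlgHom.ext fun f => sub_eq_zero.1 (eq_zero_of_evalAt fun p => ?_)
  obtain ⟨q₁, hq₁, L₁, hL₁⟩ := exists_pow_le_ker hβ ((evalAt p).comp ψ₁)
  obtain ⟨q₂, hq₂, L₂, hL₂⟩ := exists_pow_le_ker hβ ((evalAt p).comp ψ₂)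
  have hq : q₁ = q₂ := by
    refine Subtype.ext (PiLp.ext fun i => ?_)
    rw [hq₁, hq₂, AlgHom.comp_apply, AlgHom.comp_apply, h0]
  subst hq
  refine eq_zero_of_poly_of_pow
    (δ := (evalAt p).toLinearMap ∘ₗ (ψ₁.toLinearMap - ψ₂.toLinearMap)) (q := q₁) (L := L₁ + L₂)
    (fun s hs => ?_) (fun s hs => ?_) f
  · have : ψ₁ s = ψ₂ s := by
      induction hs using Algebra.adjoin_induction with
      | mem x hx => obtain ⟨i, rfl⟩ := hx; exact h0 i
      | algebraMap r => rw [AlgHom.commutes, AlgHom.commutes]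
      | add x y _ _ hx hy => rw [map_add, hx, hy, map_add]
      | mul x y _ _ hx hy => rw [map_mul, hx, hy, map_mul]
    simp [this]
  · have h1 := hL₁ s (Ideal.pow_le_pow_right (by omega) hs)
    have h2 := hL₂ s (Ideal.pow_le_pow_right (by omega) hs)
    rw [AlgHom.comp_apply] at h1 h2
    rw [LinearMap.comp_apply, LinearMap.sub_apply, AlgHom.toLinearMap_apply,
      AlgHom.toLinearMap_apply, AlgHom.toLinearMap_apply, map_sub, h1, h2, sub_zero]

end Jets

/-! ### The infinitesimal action of the orthosymplectic Lie superalgebra -/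

section OrthosymplecticMetric

variable {m n : ℕ}

/-- The inverse of the orthosymplectic metric. -/
def metricInv (m n : ℕ) : Matrix (Fin m ⊕ Fin (2 * n)) (Fin m ⊕ Fin (2 * n)) ℝ :=
  Matrix.fromBlocks 1 0 0 ((-4 : ℝ) • metricJ n)

theorem metricInv_mul_metric : metricInv m n * metric m n = 1 := by
  rw [metricInv, metric, Matrix.fromBlocks_multiply, ← Matrix.fromBlocks_one]
  congr 1 <;> simp [metricJ_mul_self]
  rw [smul_smul]
  norm_num

theorem metricInv_inl_inl (i j : Fin m) :
    metricInv m n (Sum.inl i) (Sum.inl j) = if i = j then 1 else 0 := Matrix.one_apply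

theorem metricInv_inl_inr (i : Fin m) (k : Fin (2 * n)) :
    metricInv m n (Sum.inl i) (Sum.inr k) = 0 := rfl

theorem metricInv_inr_inl (i : Fin m) (k : Fin (2 * n)) :
    metricInv m n (Sum.inr k) (Sum.inl i) = 0 := rfl

theorem metricInv_inr_inr (k l : Fin (2 * n)) :
    metricInv m n (Sum.inr k) (Sum.inr l) = -4 * metricJ n k l := rfl

theorem metric_mul_metricInv : metric m n * metricInv m n = 1 :=
  mul_eq_one_comm.1 metricInv_mul_metric

/-- The sign which is `-1` exactly for a pair of even indices. -/
def evenSign : Fin m ⊕ Fin (2 * n) → Fin m ⊕ Fin (2 * n) → ℝ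
  | Sum.inl _, Sum.inl _ => -1
  | _, _ => 1

end OrthosymplecticMetric

/-! ### The operators of osp(m|2n) on superfunctions -/

section Generators

theorem isSuperDer_mulLeft_contr {k : ℕ} {q : ZMod 2} {z : Gr k} (hz : z ∈ parity k q)
    (d : Module.Dual ℝ (Fin k → ℝ)) : IsSuperDer (q + 1) (LinearMap.mulLeft ℝ z ∘ₗ contr d) where
  mem r x hx := by
    have := mul_mem_parity hz (contr_mem d hx)
    rwa [show q + (r + 1) = r + (q + 1) by ring] at this
  leibniz r x y hx := by
    have h1 : invol k x = sgn r 1 • x := by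
      rcases zmod_two_cases r with rfl | rfl
      · rw [invol_of_mem_even hx]; simp [sgn]
      · rw [invol_of_mem_odd hx]; simp [sgn]
    simp only [LinearMap.comp_apply, LinearMap.mulLeft_apply]
    rw [contr_mul, mul_add, h1, smul_mul_assoc, mul_smul_comm, ← mul_assoc, ← mul_assoc,
      mul_eq_sgn_smul_mul hz hx, smul_mul_assoc, smul_smul, mul_assoc x]
    congr 2
    rcases zmod_two_cases q with rfl | rfl <;> rcases zmod_two_cases r with rfl | rfl <;>
      simp [sgn, show (1 + 1 : ZMod 2) = 0 by decide]

theorem IsSuperDer.add {k : ℕ} {p : ZMod 2} {D D' : Gr k →ₗ[ℝ] Gr k} (h : IsSuperDer p D)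
    (h' : IsSuperDer p D') : IsSuperDer p (D + D') where
  mem q x hx := Submodule.add_mem _ (h.mem q x hx) (h'.mem q x hx)
  leibniz q x y hx := by
    simp only [LinearMap.add_apply, h.leibniz q x y hx, h'.leibniz q x y hx, add_mul, mul_add,
      smul_add]
    abel

variable {m n : ℕ} [NeZero m]

/-- The operators by which the orthosymplectic Lie superalgebra acts on superfunctions. -/
def genOp : Fin m ⊕ Fin (2 * n) → Fin m ⊕ Fin (2 * n) → SFun m n →ₗ[ℝ] SFun m n
  | Sum.inl i, Sum.inl j => TensorProduct.map (xop i j) (LinearMap.mulLeft ℝ 1)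
  | Sum.inl i, Sum.inr k =>
    TensorProduct.map (LinearMap.mulLeft ℝ (xi i))
        (LinearMap.mulLeft ℝ (oneSubThetaSqPow n (1 / 2)) ∘ₗ contr (dualForm k)) +
      TensorProduct.map (nabla i) (LinearMap.mulLeft ℝ (oneSubThetaSqPow n (-1 / 2) * gen k))
  | Sum.inr k, Sum.inl i =>
    TensorProduct.map (LinearMap.mulLeft ℝ (xi i))
        (LinearMap.mulLeft ℝ (oneSubThetaSqPow n (1 / 2)) ∘ₗ contr (dualForm k)) +
      TensorProduct.map (nabla i) (LinearMap.mulLeft ℝ (oneSubThetaSqPow n (-1 / 2) * gen k))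
  | Sum.inr k, Sum.inr l => TensorProduct.map (LinearMap.mulLeft ℝ 1)
      (LinearMap.mulLeft ℝ (gen l) ∘ₗ contr (dualForm k) +
        LinearMap.mulLeft ℝ (gen k) ∘ₗ contr (dualForm l))

theorem genOp_inr_inl (k : Fin (2 * n)) (i : Fin m) :
    (genOp (Sum.inr k) (Sum.inl i) : SFun m n →ₗ[ℝ] SFun m n) = genOp (Sum.inl i) (Sum.inr k) :=
  rfl

theorem genOp_inl_inl_tmul (i j : Fin m) (h : SphFun m) (w : Gr (2 * n)) :
    genOp (Sum.inl i) (Sum.inl j) (h ⊗ₜ[ℝ] w) = xop i j h ⊗ₜ w := by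
  rw [genOp, TensorProduct.map_tmul, LinearMap.mulLeft_apply, one_mul]

theorem genOp_inl_inr_tmul (i : Fin m) (k : Fin (2 * n)) (h : SphFun m) (w : Gr (2 * n)) :
    genOp (Sum.inl i) (Sum.inr k) (h ⊗ₜ[ℝ] w) =
      (xi i * h) ⊗ₜ (oneSubThetaSqPow n (1 / 2) * contr (dualForm k) w) +
        nabla i h ⊗ₜ (oneSubThetaSqPow n (-1 / 2) * gen k * w) := rfl

theorem genOp_inr_inr_tmul (k l : Fin (2 * n)) (h : SphFun m) (w : Gr (2 * n)) :
    genOp (Sum.inr k) (Sum.inr l) (h ⊗ₜ[ℝ] w) =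
      h ⊗ₜ (gen l * contr (dualForm k) w + gen k * contr (dualForm l) w) := by
  rw [genOp, TensorProduct.map_tmul, LinearMap.mulLeft_apply, one_mul]
  rfl

/-- Each summand of `genOp a b` is a superderivation of parity |a| + |b|, made an ordinary
derivation by the matching coefficient c. -/
theorem isLeibniz_ovMap_genOp {N : ℕ} (a b : Fin m ⊕ Fin (2 * n)) {c : Gr N}
    (hc : c ∈ parity N (idxParity a + idxParity b)) :
    IsLeibniz (ovMap (LinearMap.mulRight ℝ c) (genOp a b)) := by
  have key : ∀ (i : Fin m) (k : Fin (2 * n)), c ∈ parity N 1 → IsLeibniz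
      (ovMap (LinearMap.mulRight ℝ c)
        (genOp (Sum.inl i) (Sum.inr k) : SFun m n →ₗ[ℝ] SFun m n)) := by
    intro i k hc
    rw [genOp, ovMap_add_right]
    refine IsLeibniz.add (isLeibniz_ovMap_mulLeft hc _ ?_)
      (isLeibniz_ovMap_tensor hc (fun f g => nabla_mul i f g)
        (even_mul_mem (oneSubThetaSqPow_mem_even _) (gen_mem_odd k)))
    have := isSuperDer_mulLeft_contr (oneSubThetaSqPow_mem_even (n := n) (1 / 2)) (dualForm k)
    rwa [zero_add] at this
  rcases a with i | k <;> rcases b with j | l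
  · have hc' : c ∈ parity N 0 := by simpa [idxParity] using hc
    rw [genOp]
    exact isLeibniz_ovMap_tensor hc' (fun f g => xop_mul i j f g) one_mem_even
  · exact key i l (by simpa [idxParity] using hc)
  · exact key j k (by simpa [idxParity] using hc)
  · have hc' : c ∈ parity N 0 := by
      rwa [idxParity, idxParity, show (1 + 1 : ZMod 2) = 0 by decide] at hc
    rw [genOp]
    refine isLeibniz_ovMap_mulLeft hc' _ (IsSuperDer.add ?_ ?_)
    · have := isSuperDer_mulLeft_contr (gen_mem_odd l) (dualForm k)
      rwa [show (1 + 1 : ZMod 2) = 0 by decide] at this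
    · have := isSuperDer_mulLeft_contr (gen_mem_odd k) (dualForm l)
      rwa [show (1 + 1 : ZMod 2) = 0 by decide] at this

theorem contr_dualForm_gen (k p : Fin (2 * n)) :
    contr (dualForm k) (gen p) = (-4 * metricJ n p k) • (1 : Gr (2 * n)) := by
  rw [contr_gen, dualForm_single, Algebra.algebraMap_eq_smul_one]

/-- The powers ±1/2 of u in the odd operator are dictated here. On Y_j the odd derivative gives ξ_i
ξ_j θ_k and the gradient gives (δ_ij - ξ_i ξ_j) θ_k, so the quadratic terms cancel. -/
theorem genOp_inl_inr_coordY (i : Fin m) (k : Fin (2 * n)) (c : Fin m ⊕ Fin (2 * n)) :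
    genOp (Sum.inl i) (Sum.inr k) (coordY c) =
      metricInv m n c (Sum.inl i) • (coordY (Sum.inr k) : SFun m n) +
        metricInv m n c (Sum.inr k) • coordY (Sum.inl i) := by
  rcases c with j | l
  · simp only [coordY, genOp_inl_inr_tmul]
    have h1 : oneSubThetaSqPow n (1 / 2) * contr (dualForm k) (oneSubThetaSqPow n (1 / 2)) =
        gen k := by
      rw [contr_dualForm_oneSubThetaSqPow, mul_smul_comm, ← mul_assoc, oneSubThetaSqPow_mul]
      norm_num [oneSubThetaSqPow_zero]
    have h2 : oneSubThetaSqPow n (-1 / 2) * gen k * oneSubThetaSqPow n (1 / 2) = gen k := by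
      rw [mul_assoc, ← mul_comm_of_mem_even (oneSubThetaSqPow_mem_even _), ← mul_assoc,
        oneSubThetaSqPow_mul]
      norm_num [oneSubThetaSqPow_zero]
    rw [h1, h2, nabla_xi, ← TensorProduct.add_tmul, add_sub_cancel,
      Algebra.algebraMap_eq_smul_one, ← TensorProduct.smul_tmul', metricInv_inl_inl,
      metricInv_inl_inr, zero_smul, add_zero]
    simp only [eq_comm]
  · simp only [coordY, genOp_inl_inr_tmul]
    have h1 : nabla i (1 : SphFun m) = 0 :=
      IsLeibniz.map_one (δ := nabla i) (fun f g => nabla_mul i f g)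
    rw [h1, TensorProduct.zero_tmul, add_zero, mul_one, contr_dualForm_gen, mul_smul_comm, mul_one,
      TensorProduct.tmul_smul, metricInv_inr_inl, metricInv_inr_inr, zero_smul, zero_add]

theorem genOp_inl_inl_coordY (i j : Fin m) (c : Fin m ⊕ Fin (2 * n)) :
    genOp (Sum.inl i) (Sum.inl j) (coordY c) =
      metricInv m n c (Sum.inl i) • (coordY (Sum.inl j) : SFun m n) -
        metricInv m n c (Sum.inl j) • coordY (Sum.inl i) := by
  rcases c with p | p
  · simp only [coordY, genOp_inl_inl_tmul]
    rw [xop_xi, TensorProduct.sub_tmul, ← Algebra.smul_def, ← Algebra.smul_def,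
      ← TensorProduct.smul_tmul', ← TensorProduct.smul_tmul', metricInv_inl_inl, metricInv_inl_inl]
    simp only [eq_comm]
  · simp only [coordY, genOp_inl_inl_tmul]
    have h1 : xop i j (1 : SphFun m) = 0 :=
      IsLeibniz.map_one (δ := xop i j) (fun f g => xop_mul i j f g)
    rw [h1, TensorProduct.zero_tmul, metricInv_inr_inl, metricInv_inr_inl, zero_smul, zero_smul,
      sub_zero]

theorem genOp_inr_inr_coordY (k l : Fin (2 * n)) (c : Fin m ⊕ Fin (2 * n)) :
    genOp (Sum.inr k) (Sum.inr l) (coordY c) =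
      metricInv m n c (Sum.inr k) • (coordY (Sum.inr l) : SFun m n) +
        metricInv m n c (Sum.inr l) • coordY (Sum.inr k) := by
  rcases c with p | p
  · simp only [coordY, genOp_inr_inr_tmul]
    have h1 : gen l * contr (dualForm k) (oneSubThetaSqPow n (1 / 2)) +
        gen k * contr (dualForm l) (oneSubThetaSqPow n (1 / 2)) = 0 := by
      rw [contr_dualForm_oneSubThetaSqPow, contr_dualForm_oneSubThetaSqPow, mul_smul_comm,
        mul_smul_comm, ← smul_add, mul_comm_of_mem_even (oneSubThetaSqPow_mem_even _),
        mul_comm_of_mem_even (oneSubThetaSqPow_mem_even _), ← mul_assoc, ← mul_assoc, ← add_mul,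
        mul_anticomm_of_mem_odd (gen_mem_odd l) (gen_mem_odd k), neg_add_cancel, zero_mul,
        smul_zero]
    rw [h1, TensorProduct.tmul_zero, metricInv_inl_inr, metricInv_inl_inr, zero_smul, zero_smul,
      add_zero]
  · simp only [coordY, genOp_inr_inr_tmul]
    rw [contr_dualForm_gen, contr_dualForm_gen, mul_smul_comm, mul_smul_comm, mul_one, mul_one,
      TensorProduct.tmul_add, TensorProduct.tmul_smul, TensorProduct.tmul_smul, metricInv_inr_inr,
      metricInv_inr_inr]

/-- The action on the embedding coordinates. -/
theorem genOp_coordY (a b c : Fin m ⊕ Fin (2 * n)) :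
    genOp a b (coordY c) = metricInv m n c a • (coordY b : SFun m n) +
      (evenSign a b * metricInv m n c b) • coordY a := by
  rcases a with i | k <;> rcases b with j | l
  · rw [genOp_inl_inl_coordY, evenSign, neg_one_mul, sub_eq_iff_eq_add, add_assoc,
      ← add_smul, neg_add_cancel, zero_smul, add_zero]
  · rw [genOp_inl_inr_coordY]
    change _ = _ + (1 * _) • _
    rw [one_mul]
  · rw [genOp_inr_inl, genOp_inl_inr_coordY, add_comm]
    change _ = _ + (1 * _) • _
    rw [one_mul]
  · rw [genOp_inr_inr_coordY]
    change _ = _ + (1 * _) • _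
    rw [one_mul]

theorem superSphereIntegral_tmul (h : SphFun m) (w : Gr (2 * n)) :
    superSphereIntegral m n (h ⊗ₜ[ℝ] w) =
      sphIntegral m h * berezin n (oneSubThetaSqPow n ((m : ℝ) / 2 - 1) * w) := rfl

theorem contr_dualForm_oneSubThetaSqPow_mul (k : Fin (2 * n)) (s : ℝ) (w : Gr (2 * n)) :
    contr (dualForm k) (oneSubThetaSqPow n s * w) =
      (2 * s) • (oneSubThetaSqPow n (s - 1) * gen k * w) +
        oneSubThetaSqPow n s * contr (dualForm k) w := by
  rw [contr_mul, contr_dualForm_oneSubThetaSqPow, invol_of_mem_even (oneSubThetaSqPow_mem_even _),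
    smul_mul_assoc]

/-- Each summand is a total derivative up to terms with θ_k θ_l and J_{lk}; both are antisymmetric
in k and l, so they cancel in the sum. -/
theorem berezin_spOp (k l : Fin (2 * n)) (s : ℝ) (w : Gr (2 * n)) :
    berezin n (oneSubThetaSqPow n s *
      (gen l * contr (dualForm k) w + gen k * contr (dualForm l) w)) = 0 := by
  have key : ∀ k l : Fin (2 * n), oneSubThetaSqPow n s * (gen l * contr (dualForm k) w) =
      (2 * s) • (oneSubThetaSqPow n (s - 1) * (gen k * gen l) * w) +
        (-4 * metricJ n l k) • (oneSubThetaSqPow n s * w) -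
        contr (dualForm k) (oneSubThetaSqPow n s * (gen l * w)) := by
    intro k l
    rw [contr_dualForm_oneSubThetaSqPow_mul, contr_mul, contr_dualForm_gen,
      invol_of_mem_odd (gen_mem_odd l), smul_mul_assoc, one_mul, mul_add, mul_smul_comm]
    simp only [mul_assoc, neg_mul, mul_neg]
    abel
  rw [mul_add, key k l, key l k, mul_anticomm_of_mem_odd (gen_mem_odd l) (gen_mem_odd k),
    metricJ_antisymm k l, map_add, map_sub, map_sub, berezin_contr, berezin_contr]
  simp only [map_add, map_smul, mul_neg, neg_mul, map_neg, smul_eq_mul]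
  ring

/-- This fixes the exponent m/2 - 1. The gradient contributes m - 1 by parts on the sphere, and
differentiating the weight u^{(m-1)/2} contributes 2 · (m - 1)/2. -/
theorem superSphereIntegral_oddOp (i : Fin m) (k : Fin (2 * n)) (h : SphFun m) (w : Gr (2 * n)) :
    superSphereIntegral m n (genOp (Sum.inl i) (Sum.inr k) (h ⊗ₜ[ℝ] w)) = 0 := by
  rw [genOp_inl_inr_tmul, map_add, superSphereIntegral_tmul, superSphereIntegral_tmul,
    map_nabla_of_xop sphIntegral_xop]
  have h1 := berezin_contr (dualForm k) (oneSubThetaSqPow n ((m : ℝ) / 2 - 1 + 1 / 2) * w)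
  rw [contr_dualForm_oneSubThetaSqPow_mul, map_add, map_smul] at h1
  rw [← mul_assoc, oneSubThetaSqPow_mul, ← mul_assoc, ← mul_assoc, oneSubThetaSqPow_mul]
  rw [show (m : ℝ) / 2 - 1 + 1 / 2 - 1 = (m : ℝ) / 2 - 1 + -1 / 2 by ring] at h1
  simp only [smul_eq_mul] at h1 ⊢
  linear_combination (sphIntegral m (xi i * h)) * h1

/-- The integral over the supersphere is annihilated by the infinitesimal action. -/
theorem superSphereIntegral_genOp (a b : Fin m ⊕ Fin (2 * n)) (f : SFun m n) :
    superSphereIntegral m n (genOp a b f) = 0 := by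
  induction f using TensorProduct.induction_on with
  | zero => simp
  | add x y hx hy => rw [map_add, map_add, hx, hy, add_zero]
  | tmul h w =>
    rcases a with i | k <;> rcases b with j | l
    · rw [genOp_inl_inl_tmul, superSphereIntegral_tmul, sphIntegral_xop, zero_mul]
    · exact superSphereIntegral_oddOp i l h w
    · exact superSphereIntegral_oddOp j k h w
    · rw [genOp_inr_inr_tmul, superSphereIntegral_tmul, berezin_spOp, mul_zero]

end Generators

/-! ### Supermatrices preserving the metric -/

section Supermatrices

variable {m n N : ℕ}

/-- The sign occurring in the supertranspose. -/
def stSign : Fin m ⊕ Fin (2 * n) → Fin m ⊕ Fin (2 * n) → ℝ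
  | Sum.inr _, Sum.inl _ => -1
  | _, _ => 1

theorem superTranspose_apply (S : SMat m n N) (a c : Fin m ⊕ Fin (2 * n)) :
    superTranspose S a c = stSign a c • S c a := by
  rcases a with i | k <;> rcases c with j | l <;> simp [superTranspose, stSign] <;> rfl

theorem superTranspose_add (S S' : SMat m n N) :
    superTranspose (S + S') = superTranspose S + superTranspose S' := by
  ext a c; simp [superTranspose_apply]

theorem superTranspose_one : superTranspose (1 : SMat m n N) = 1 := by
  ext a c
  rcases a with i | k <;> rcases c with j | l <;>
    simp [superTranspose_apply, stSign, Matrix.one_apply, eq_comm]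

/-- The orthosymplectic metric with values in a Grassmann algebra. -/
abbrev grMetric (m n N : ℕ) : SMat m n N := (metric m n).map (algebraMap ℝ (Gr N))

theorem grMetric_apply (c d : Fin m ⊕ Fin (2 * n)) :
    grMetric m n N c d = algebraMap ℝ (Gr N) (metric m n c d) := rfl

/-- The inverse of the orthosymplectic metric with values in a Grassmann algebra. -/
abbrev grMetricInv (m n N : ℕ) : SMat m n N := (metricInv m n).map (algebraMap ℝ (Gr N))

theorem grMetricInv_mul_grMetric : grMetricInv m n N * grMetric m n N = 1 := by
  rw [← Matrix.map_mul, metricInv_mul_metric]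
  exact Matrix.map_one _ (map_zero _) (map_one _)

/-- The supermatrix `S^{st} g E(S)`, where `E` is the Euler operator. -/
def logEuler (S : SMat m n N) : SMat m n N :=
  superTranspose S * grMetric m n N * S.map (euler N)

theorem logEuler_apply (S : SMat m n N) (a b : Fin m ⊕ Fin (2 * n)) :
    logEuler S a b = ∑ d, ∑ c, (stSign a c * metric m n c d) • (S c a * euler N (S d b)) := by
  rw [logEuler, Matrix.mul_apply]
  refine Finset.sum_congr rfl fun d _ => ?_
  rw [Matrix.mul_apply, Finset.sum_mul]
  refine Finset.sum_congr rfl fun c _ => ?_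
  rw [superTranspose_apply, Matrix.map_apply, grMetric_apply, ← Algebra.commutes,
    ← Algebra.smul_def, smul_mul_assoc, smul_mul_assoc, smul_smul, mul_comm]

theorem metric_eq_zero {c d : Fin m ⊕ Fin (2 * n)} (h : idxParity c ≠ idxParity d) :
    metric m n c d = 0 := by
  rcases c with i | k <;> rcases d with j | l
  · exact absurd rfl h
  · rfl
  · rfl
  · exact absurd rfl h

theorem metricInv_eq_zero {c d : Fin m ⊕ Fin (2 * n)} (h : idxParity c ≠ idxParity d) :
    metricInv m n c d = 0 := by
  rcases c with i | k <;> rcases d with j | l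
  · exact absurd rfl h
  · rfl
  · rfl
  · exact absurd rfl h

theorem zmod_two_add_self (p : ZMod 2) : p + p = 0 := by revert p; decide

theorem logEuler_mem {S : SMat m n N} (hS : ∀ i j, S i j ∈ parity N (idxParity i + idxParity j))
    (a b : Fin m ⊕ Fin (2 * n)) : logEuler S a b ∈ parity N (idxParity a + idxParity b) := by
  rw [logEuler_apply]
  refine Submodule.sum_mem _ fun d _ => Submodule.sum_mem _ fun c _ => ?_
  by_cases h : idxParity c = idxParity d
  · refine Submodule.smul_mem _ _ ?_
    have := mul_mem_parity (hS c a) (euler_mem (hS d b))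
    rwa [h, add_add_add_comm, zmod_two_add_self, zero_add] at this
  · rw [metric_eq_zero h, mul_zero, zero_smul]
    exact Submodule.zero_mem _

/-- The signs of the supertranspose, of the symmetry of g and of exchanging two entries of S combine
into one sign that depends on a and b only. It is used for the symmetry of `logEuler`. -/
theorem sgn_metric (a b c d : Fin m ⊕ Fin (2 * n)) :
    stSign a d * metric m n d c * sgn (idxParity d + idxParity a) (idxParity c + idxParity b) =
      -(evenSign a b * (stSign b c * metric m n c d)) := by
  have h1 : ∀ i j : Fin m, metric m n (Sum.inl i) (Sum.inl j) = metric m n (Sum.inl j) (Sum.inl i) :=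
    fun i j => by simp [metric, Matrix.one_apply, eq_comm]
  have h2 : ∀ k l : Fin (2 * n),
      metric m n (Sum.inr k) (Sum.inr l) = -metric m n (Sum.inr l) (Sum.inr k) :=
    fun k l => metricJ_antisymm k l
  have h11 : (1 + 1 : ZMod 2) = 0 := by decide
  rcases c with p | p <;> rcases d with q | q
  · rw [h1 q p]
    rcases a with i | k <;> rcases b with j | l <;> simp [stSign, evenSign, idxParity, sgn]
  · rw [metric_eq_zero (c := Sum.inl p) (by simp [idxParity]),
      metric_eq_zero (c := Sum.inr q) (by simp [idxParity])]
    simp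
  · rw [metric_eq_zero (c := Sum.inr p) (by simp [idxParity]),
      metric_eq_zero (c := Sum.inl q) (by simp [idxParity])]
    simp
  · rw [h2 q p]
    rcases a with i | k <;> rcases b with j | l <;> simp [stSign, evenSign, idxParity, sgn, h11]

theorem euler_superTranspose_mul {S : SMat m n N} (a b : Fin m ⊕ Fin (2 * n)) :
    euler N ((superTranspose S * grMetric m n N * S) a b) =
      (∑ c, ∑ d, (stSign a d * metric m n d c) • (euler N (S d a) * S c b)) + logEuler S a b := by
  rw [logEuler_apply, Matrix.mul_apply, map_sum, ← Finset.sum_add_distrib]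
  refine Finset.sum_congr rfl fun c _ => ?_
  rw [Matrix.mul_apply, Finset.sum_mul, map_sum, ← Finset.sum_add_distrib]
  refine Finset.sum_congr rfl fun d _ => ?_
  rw [superTranspose_apply, grMetric_apply, ← Algebra.commutes,
    ← Algebra.smul_def, smul_smul, smul_mul_assoc, map_smul, euler_mul, smul_add,
    mul_comm (metric m n d c)]

/-- The supermatrix `S^{st} g E(S)` is super-antisymmetric. -/
theorem logEuler_symm {S : SMat m n N} (hS : IsSOSpPoint S) (a b : Fin m ⊕ Fin (2 * n)) :
    logEuler S a b = evenSign a b • logEuler S b a := by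
  -- The Euler operator kills the constant matrix g, so differentiating S^{st} g S = g leaves the
  -- sum of two terms equal to zero; the second is `logEuler S`.
  have h := euler_superTranspose_mul (S := S) a b
  rw [hS.preserves_metric, Matrix.map_apply, euler_algebraMap] at h
  rw [eq_comm, add_comm, add_eq_zero_iff_eq_neg] at h
  rw [h, logEuler_apply, Finset.smul_sum, Finset.sum_comm, ← Finset.sum_neg_distrib]
  refine Finset.sum_congr rfl fun d _ => ?_
  rw [Finset.smul_sum, ← Finset.sum_neg_distrib]
  refine Finset.sum_congr rfl fun c _ => ?_
  rw [mul_eq_sgn_smul_mul (euler_mem (hS.even d a)) (hS.even c b), smul_smul, sgn_metric, smul_smul,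
    neg_smul, neg_neg]

/-- A supermatrix preserving the metric is invertible. -/
theorem mul_grMetricInv_mul_superTranspose {S : SMat m n N} (hS : IsSOSpPoint S) :
    S * (grMetricInv m n N * superTranspose S * grMetric m n N) = 1 := by
  refine mul_eq_one_comm_of_finite (R := SMat m n N) ?_
  rw [mul_assoc, mul_assoc, ← mul_assoc (superTranspose S), hS.preserves_metric,
    grMetricInv_mul_grMetric]

/-- Since g⁻¹ S^{st} g is the inverse of S, the matrix g⁻¹ `logEuler S` is the logarithmic
derivative S⁻¹ E(S). -/
theorem mul_grMetricInv_mul_logEuler {S : SMat m n N} (hS : IsSOSpPoint S) :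
    S * grMetricInv m n N * logEuler S = S.map (euler N) := by
  have h := congrArg (· * S.map (euler N)) (mul_grMetricInv_mul_superTranspose hS)
  simp only [mul_assoc, one_mul] at h
  rw [logEuler, mul_assoc, mul_assoc, h]

end Supermatrices

/-! ### Invariance of the integral -/

section Generation

variable {m n : ℕ} [NeZero m]

theorem ι_eq_sum_gen {k : ℕ} (v : Fin k → ℝ) : ExteriorAlgebra.ι ℝ v = ∑ i, v i • gen i := by
  simp only [gen]
  rw [← Finset.sum_congr rfl fun i _ => map_smul (ExteriorAlgebra.ι ℝ) (v i) (Pi.single i 1),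
    ← map_sum]
  congr 1
  ext j
  simp [Finset.sum_apply, Pi.single_apply]

/-- A subalgebra containing the embedding coordinates, and which contains all functions on the
sphere as soon as it contains the coordinate functions, is everything. -/
theorem mem_subalgebra_of_coordY {K : Subalgebra ℝ (SFun m n)} (hY : ∀ c, coordY c ∈ K)
    (hK : (∀ i : Fin m, xi i ⊗ₜ[ℝ] 1 ∈ K) → ∀ h : SphFun m, h ⊗ₜ[ℝ] 1 ∈ K) (f : SFun m n) :
    f ∈ K := by
  have h1 : ∀ w : Gr (2 * n), (1 : SphFun m) ⊗ₜ[ℝ] w ∈ K := by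
    intro w
    induction w using ExteriorAlgebra.induction with
    | algebraMap r =>
      rw [Algebra.algebraMap_eq_smul_one, TensorProduct.tmul_smul]
      exact K.smul_mem K.one_mem r
    | ι v =>
      rw [ι_eq_sum_gen, TensorProduct.tmul_sum]
      refine K.sum_mem fun i _ => ?_
      rw [TensorProduct.tmul_smul]
      exact K.smul_mem (hY (Sum.inr i)) _
    | mul a b ha hb =>
      have := K.mul_mem ha hb
      rwa [Algebra.TensorProduct.tmul_mul_tmul, one_mul] at this
    | add a b ha hb => rw [TensorProduct.tmul_add]; exact K.add_mem ha hb
  -- The invertible factor u^{1/2} in Y_i is removed by multiplying with u^{-1/2}.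
  have h2 : ∀ i : Fin m, xi i ⊗ₜ[ℝ] (1 : Gr (2 * n)) ∈ K := by
    intro i
    have := K.mul_mem (hY (Sum.inl i)) (h1 (oneSubThetaSqPow n (-1 / 2)))
    rw [coordY, Algebra.TensorProduct.tmul_mul_tmul, mul_one, oneSubThetaSqPow_mul] at this
    norm_num [oneSubThetaSqPow_zero] at this
    exact this
  induction f using TensorProduct.induction_on with
  | zero => exact K.zero_mem
  | add x y hx hy => exact K.add_mem hx hy
  | tmul h w =>
    have := K.mul_mem (hK h2 h) (h1 w)
    rwa [Algebra.TensorProduct.tmul_mul_tmul, mul_one, one_mul] at this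

/-- The kernel of a derivation along an algebra morphism. -/
def kerSubalgebra {R R' : Type*} [Ring R] [Algebra ℝ R] [Ring R'] [Algebra ℝ R'] (Φ : R →ₐ[ℝ] R')
    {δ : R' →ₗ[ℝ] R'} (hδ : IsLeibniz δ) : Subalgebra ℝ R where
  carrier := {f | δ (Φ f) = 0}
  mul_mem' {f g} hf hg := by
    rw [Set.mem_ofPred_eq] at hf hg ⊢
    rw [map_mul, hδ, hf, hg, zero_mul, mul_zero, add_zero]
  add_mem' {f g} hf hg := by
    rw [Set.mem_ofPred_eq] at hf hg ⊢
    rw [map_add, map_add, hf, hg, add_zero]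
  algebraMap_mem' r := by
    rw [Set.mem_ofPred_eq, AlgHom.commutes, Algebra.algebraMap_eq_smul_one, map_smul, hδ.map_one,
      smul_zero]

theorem mem_kerSubalgebra {R R' : Type*} [Ring R] [Algebra ℝ R] [Ring R'] [Algebra ℝ R']
    (Φ : R →ₐ[ℝ] R') {δ : R' →ₗ[ℝ] R'} (hδ : IsLeibniz δ) {f : R} :
    f ∈ kerSubalgebra Φ hδ ↔ δ (Φ f) = 0 := Iff.rfl

/-- The kernel is a subalgebra containing the coordinates. The passage from the ξ_i to all smooth
functions is the jet argument of `derivation_eq_zero`. -/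
theorem derivation_comp_eq_zero {N : ℕ} (Φ : SFun m n →ₐ[ℝ] SFunOver m n N)
    {δ : SFunOver m n N →ₗ[ℝ] SFunOver m n N} (hδ : IsLeibniz δ)
    (h0 : ∀ c, δ (Φ (coordY c)) = 0) (f : SFun m n) : δ (Φ f) = 0 := by
  refine (mem_kerSubalgebra Φ hδ).1 (mem_subalgebra_of_coordY h0 (fun hx h => ?_) f)
  obtain ⟨β, hβ⟩ := exists_algHom_nilpotent_ker N (2 * n)
  refine derivation_eq_zero hβ
    (Φ.comp (Algebra.TensorProduct.includeLeft : SphFun m →ₐ[ℝ] SFun m n))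
    (δ := δ ∘ₗ (Φ.comp
      (Algebra.TensorProduct.includeLeft : SphFun m →ₐ[ℝ] SFun m n)).toLinearMap)
    (fun f g => ?_) hx h
  simp only [LinearMap.comp_apply, AlgHom.toLinearMap_apply, map_mul]
  exact hδ _ _

theorem algHom_eq_of_coordY {Φ Ψ : SFun m n →ₐ[ℝ] SFun m n}
    (h0 : ∀ c, Φ (coordY c) = Ψ (coordY c)) : Φ = Ψ := by
  refine AlgHom.ext fun f => ?_
  refine (AlgHom.mem_equalizer Φ Ψ f).1
    (mem_subalgebra_of_coordY (fun c => (AlgHom.mem_equalizer Φ Ψ _).2 (h0 c)) (fun hx h => ?_) f)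
  obtain ⟨β, hβ⟩ := exists_algHom_gr_nilpotent_ker (2 * n)
  exact AlgHom.congr_fun (algHom_eq_of_xi hβ
    (ψ₁ := Φ.comp (Algebra.TensorProduct.includeLeft : SphFun m →ₐ[ℝ] SFun m n))
    (ψ₂ := Ψ.comp (Algebra.TensorProduct.includeLeft : SphFun m →ₐ[ℝ] SFun m n)) hx) h

end Generation

/-! ### Independence of the nilpotent parameters -/

section Infinitesimal

variable {m n : ℕ} [NeZero m] {N : ℕ}

/-- The vector field with parameters by which the Euler operator acts along a point of the
supergroup. -/
def logField (S : SMat m n N) : SFunOver m n N →ₗ[ℝ] SFunOver m n N :=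
  -- For a point of the supergroup, `logEuler` has the symmetry `evenSign` that `genOp` has on the
  -- coordinates, so (a, b) and (b, a) act equally there and the sum counts each pair twice.
  (1 / 2 : ℝ) • ∑ a, ∑ b, ovMap (LinearMap.mulRight ℝ (logEuler S a b)) (genOp a b)

theorem isLeibniz_logField {S : SMat m n N} (hS : IsSOSpPoint S) : IsLeibniz (logField S) :=
  IsLeibniz.smul _ (IsLeibniz.sum _ fun a _ => IsLeibniz.sum _ fun b _ =>
    isLeibniz_ovMap_genOp a b (logEuler_mem hS.even a b))

theorem logField_inclParam_mul (S : SMat m n N) (c : Gr N) (x : SFunOver m n N) :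
    logField S (inclParam m n N c * x) = inclParam m n N c * logField S x := by
  simp only [logField, LinearMap.smul_apply, LinearMap.sum_apply, ovMap_mulRight_inclParam_mul,
    Finset.mul_sum, mul_smul_comm]

theorem logField_coordY {S : SMat m n N} (hS : IsSOSpPoint S) (c : Fin m ⊕ Fin (2 * n)) :
    logField S (ov 1 (coordY c)) =
      ∑ b, ov ((grMetricInv m n N * logEuler S) c b) (coordY b) := by
  have h1 : ∀ a b, ovMap (LinearMap.mulRight ℝ (logEuler S a b)) (genOp a b) (ov 1 (coordY c)) =
      metricInv m n c a • ov (logEuler S a b) (coordY b) +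
        metricInv m n c b • ov (logEuler S b a) (coordY a) := by
    intro a b
    rw [ovMap_ov, LinearMap.mulRight_apply, one_mul, genOp_coordY, ov_add_right, ov_smul_right,
      ov_smul_right]
    congr 1
    rw [logEuler_symm hS a b, ov_smul_left, smul_smul]
    congr 1
    rcases a with i | k <;> rcases b with j | l <;> simp [evenSign]
  have h2 : ∑ a, ∑ b, metricInv m n c b • ov (logEuler S b a) (coordY a : SFun m n) =
      ∑ a, ∑ b, metricInv m n c a • ov (logEuler S a b) (coordY b) := Finset.sum_comm
  have h3 : ∀ b, ov ((grMetricInv m n N * logEuler S) c b) (coordY b : SFun m n) =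
      ∑ a, metricInv m n c a • ov (logEuler S a b) (coordY b) := by
    intro b
    rw [Matrix.mul_apply, ov_sum_left]
    refine Finset.sum_congr rfl fun a _ => ?_
    rw [← ov_smul_left, Algebra.smul_def]
    rfl
  simp only [logField, LinearMap.smul_apply, LinearMap.sum_apply, h1, Finset.sum_add_distrib, h2,
    h3]
  rw [← two_smul ℝ, smul_smul, Finset.sum_comm]
  norm_num

theorem isActionPullback_iff {S : SMat m n N} {Φ : SFun m n →ₐ[ℝ] SFunOver m n N} :
    IsActionPullback S Φ ↔ ∀ c, Φ (coordY c) = ∑ d, ov (S c d) (coordY d) := by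
  simp only [IsActionPullback, inclParam_mul_inclFun]

theorem euler_comp_pullback {S : SMat m n N} (hS : IsSOSpPoint S)
    {Φ : SFun m n →ₐ[ℝ] SFunOver m n N} (hΦ : IsActionPullback S Φ) (f : SFun m n) :
    ovMap (euler N) LinearMap.id (Φ f) = logField S (Φ f) := by
  rw [isActionPullback_iff] at hΦ
  -- Both sides are derivations along Φ, so only the coordinates have to be compared; there the
  -- claim is E(S) = S g⁻¹ `logEuler S`.
  refine sub_eq_zero.1 (derivation_comp_eq_zero Φ
    (IsLeibniz.sub isLeibniz_ovMap_euler (isLeibniz_logField hS)) (fun c => ?_) f)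
  rw [LinearMap.sub_apply, sub_eq_zero, hΦ c, map_sum, map_sum]
  have h1 : ∀ d, logField S (ov (S c d) (coordY d)) =
      ∑ b, ov (S c d * (grMetricInv m n N * logEuler S) d b) (coordY b) := by
    intro d
    rw [← mul_one (S c d), ← inclParam_mul_ov, logField_inclParam_mul, logField_coordY hS,
      Finset.mul_sum, mul_one]
    simp only [inclParam_mul_ov]
  simp only [h1, ovMap_ov]
  rw [Finset.sum_comm]
  refine Finset.sum_congr rfl fun b _ => ?_
  rw [← ov_sum_left, ← Matrix.mul_apply, ← mul_assoc, mul_grMetricInv_mul_logEuler hS]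
  rfl

/-- The integral of a translated superfunction does not depend on the odd parameters. -/
theorem idTensor_superSphereIntegral_pullback {S : SMat m n N} (hS : IsSOSpPoint S)
    {Φ : SFun m n →ₐ[ℝ] SFunOver m n N} (hΦ : IsActionPullback S Φ) (f : SFun m n) :
    idTensor N (superSphereIntegral m n) (Φ f) =
      algebraMap ℝ (Gr N) (superSphereIntegral m n (bodyOver m n N (Φ f))) := by
  rw [← body_idTensor]
  -- The Euler operator of the parameters commutes with integration over the supersphere, and the
  -- integral kills every operator in `logField S`.
  refine eq_algebraMap_of_euler_eq_zero ?_
  rw [← idTensor_ovMap_euler, euler_comp_pullback hS hΦ]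
  simp only [logField, LinearMap.smul_apply, LinearMap.sum_apply, map_smul, map_sum,
    idTensor_ovMap_mulRight]
  have h0 : ∀ a b, superSphereIntegral m n ∘ₗ genOp a b = 0 := fun a b =>
    LinearMap.ext fun f => superSphereIntegral_genOp a b f
  have h1 : idTensor N (0 : SFun m n →ₗ[ℝ] ℝ) = 0 := by
    refine LinearMap.ext fun x => ?_
    induction x using ov_induction with
    | hadd x y hx hy => rw [map_add, hx, hy, map_add]
    | hov a g => rw [idTensor_ov, LinearMap.zero_apply, zero_smul, LinearMap.zero_apply]
  simp [h0, h1]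

end Infinitesimal

/-! ### Invariance under the body of a point -/

section Body

variable {m n : ℕ}

/-- The isometry of the Euclidean space given by an orthogonal matrix. -/
def orthIsometry (A : Matrix (Fin m) (Fin m) ℝ) (hA : A.transpose * A = 1) :
    EuclideanSpace ℝ (Fin m) ≃ₗᵢ[ℝ] EuclideanSpace ℝ (Fin m) :=
  LinearIsometry.toLinearIsometryEquiv
    { toLinearMap := Matrix.toEuclideanLin A
      norm_map' := fun x => by
        rw [← sq_eq_sq₀ (norm_nonneg _) (norm_nonneg _), ← real_inner_self_eq_norm_sq,
          ← real_inner_self_eq_norm_sq]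
        simp only [EuclideanSpace.inner_eq_star_dotProduct, Matrix.ofLp_toLpLin,
          Matrix.toLin'_apply, star_trivial]
        rw [Matrix.dotProduct_mulVec, Matrix.vecMul_mulVec, hA, Matrix.vecMul_one] } rfl

theorem isometry_mem_sphere (e : EuclideanSpace ℝ (Fin m) ≃ₗᵢ[ℝ] EuclideanSpace ℝ (Fin m))
    (p : Sph m) : e p ∈ Metric.sphere (0 : EuclideanSpace ℝ (Fin m)) 1 := by
  rw [mem_sphere_iff_norm, sub_zero, e.norm_map]
  exact mem_sphere_zero_iff_norm.1 p.2

section Compose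

variable [NeZero m]

/-- Composition of smooth functions on the sphere with an isometry. -/
def compIsometry (e : EuclideanSpace ℝ (Fin m) ≃ₗᵢ[ℝ] EuclideanSpace ℝ (Fin m)) :
    SphFun m →ₐ[ℝ] SphFun m :=
  AlgHom.ofLinearMap
    (⟨⟨fun f : SphFun m => f.comp ⟨Set.codRestrict _ _ (isometry_mem_sphere e),
      ContMDiff.codRestrict_sphere (e.contDiff.contMDiff.comp contMDiff_coe_sphere) _⟩,
      fun _ _ => rfl⟩, fun _ _ => rfl⟩ : SphFun m →ₗ[ℝ] SphFun m)
    rfl (fun _ _ => rfl)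

theorem compIsometry_apply (e : EuclideanSpace ℝ (Fin m) ≃ₗᵢ[ℝ] EuclideanSpace ℝ (Fin m))
    (f : SphFun m) (p : Sph m) : compIsometry e f p = f ⟨e p, isometry_mem_sphere e p⟩ := rfl

theorem sphIntegral_compIsometry
    (e : EuclideanSpace ℝ (Fin m) ≃ₗᵢ[ℝ] EuclideanSpace ℝ (Fin m)) (f : SphFun m) :
    sphIntegral m (compIsometry e f) = sphIntegral m f := by
  refine sphIntegral_comp_isometry e fun p q hq => ?_
  rw [compIsometry_apply]
  congr 1
  exact Subtype.ext hq.symm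

theorem compIsometry_xi {A : Matrix (Fin m) (Fin m) ℝ} (hA : A.transpose * A = 1) (i : Fin m) :
    compIsometry (orthIsometry A hA) (xi i) = ∑ j, A i j • xi j := by
  refine sphFun_ext fun p => ?_
  rw [sphFun_sum_apply]
  rfl

end Compose

theorem map_vecMulLinear_gen (C : Matrix (Fin (2 * n)) (Fin (2 * n)) ℝ) (k : Fin (2 * n)) :
    ExteriorAlgebra.map (Matrix.vecMulLinear C) (gen k) = ∑ l, C k l • gen l := by
  rw [gen, ExteriorAlgebra.map_apply_ι, ι_eq_sum_gen]
  simp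

theorem map_vecMulLinear_thetaSq {C : Matrix (Fin (2 * n)) (Fin (2 * n)) ℝ}
    (hC : C.transpose * metricJ n * C = metricJ n) :
    ExteriorAlgebra.map (Matrix.vecMulLinear C) (thetaSq n) = thetaSq n := by
  have h1 : ∀ p q, metricJ n p q = ∑ l, ∑ k, C k p * metricJ n k l * C l q := by
    intro p q
    conv_lhs => rw [← hC]
    simp only [Matrix.mul_apply, Matrix.transpose_apply, Finset.sum_mul]
  rw [thetaSq]
  simp only [map_sum, map_smul, map_mul, map_vecMulLinear_gen, Finset.sum_mul, Finset.mul_sum,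
    smul_mul_assoc, mul_smul_comm, Finset.smul_sum, smul_smul]
  conv_rhs =>
    enter [2, p, 2, q]
    rw [h1 p q]
  simp only [Finset.sum_smul]
  symm
  calc _ = ∑ q, ∑ l, ∑ k, ∑ p, (C k p * metricJ n k l * C l q) • (gen p * gen q) := by
        rw [Finset.sum_comm]
        refine Finset.sum_congr rfl fun q _ => ?_
        rw [Finset.sum_comm]
        exact Finset.sum_congr rfl fun l _ => Finset.sum_comm
    _ = ∑ k, ∑ l, ∑ q, ∑ p, (C k p * metricJ n k l * C l q) • (gen p * gen q) := by
        rw [Finset.sum_comm]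
        refine (Finset.sum_congr rfl fun l _ => Finset.sum_comm).trans Finset.sum_comm
    _ = _ := by
        refine Finset.sum_congr rfl fun k _ => Finset.sum_congr rfl fun l _ =>
          Finset.sum_congr rfl fun q _ => Finset.sum_congr rfl fun p _ => ?_
        congr 1
        ring

theorem map_oneSubThetaSqPow {f : (Fin (2 * n) → ℝ) →ₗ[ℝ] (Fin (2 * n) → ℝ)}
    (hf : ExteriorAlgebra.map f (thetaSq n) = thetaSq n) (s : ℝ) :
    ExteriorAlgebra.map f (oneSubThetaSqPow n s) = oneSubThetaSqPow n s := by
  simp only [oneSubThetaSqPow, map_sum, map_smul, map_pow, map_neg, hf]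

theorem berezin_map_vecMulLinear {C : Matrix (Fin (2 * n)) (Fin (2 * n)) ℝ}
    (hC : C.transpose * metricJ n * C = metricJ n) (x : Gr (2 * n)) :
    berezin n (ExteriorAlgebra.map (Matrix.vecMulLinear C) x) = berezin n x := by
  -- The inverse of a symplectic matrix is J⁻¹ Cᵀ J, and J⁻¹ = -4 J.
  have h1 : (((-4 : ℝ) • metricJ n) * (C.transpose * metricJ n)) * C = 1 := by
    rw [mul_assoc, hC, smul_mul_assoc, metricJ_mul_self, smul_smul]
    norm_num
  refine berezin_map_of_thetaSq _
    (Matrix.vecMulLinear (((-4 : ℝ) • metricJ n) * (C.transpose * metricJ n))) ?_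
    (map_vecMulLinear_thetaSq hC) x
  refine LinearMap.ext fun v => ?_
  rw [LinearMap.comp_apply, Matrix.vecMulLinear_apply, Matrix.vecMulLinear_apply,
    Matrix.vecMul_vecMul, mul_eq_one_comm.1 h1, Matrix.vecMul_one, LinearMap.id_apply]

variable {N : ℕ}

theorem body_superTranspose_mul {S : SMat m n N} (hS : IsSOSpPoint S)
    (a b : Fin m ⊕ Fin (2 * n)) :
    ∑ d, ∑ c, stSign a c * metric m n c d * (body (S c a) * body (S d b)) = metric m n a b := by
  have h := congrArg body (congrFun (congrFun hS.preserves_metric a) b)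
  rw [Matrix.mul_apply, map_sum] at h
  have h2 : body (grMetric m n N a b) = metric m n a b := by
    rw [grMetric_apply, AlgHom.commutes]; rfl
  refine Eq.trans (Finset.sum_congr rfl fun d _ => ?_) (h.trans h2)
  rw [Matrix.mul_apply, Finset.sum_mul, map_sum]
  refine Finset.sum_congr rfl fun c _ => ?_
  rw [superTranspose_apply, Matrix.map_apply, ← Algebra.commutes, ← Algebra.smul_def, smul_smul,
    smul_mul_assoc, map_smul, map_mul, smul_eq_mul, mul_comm (stSign a c)]

theorem body_inl_inr {S : SMat m n N} (hS : IsSOSpPoint S) (i : Fin m) (k : Fin (2 * n)) :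
    body (S (Sum.inl i) (Sum.inr k)) = 0 :=
  body_of_mem_odd (by simpa [idxParity] using hS.even (Sum.inl i) (Sum.inr k))

theorem body_inr_inl {S : SMat m n N} (hS : IsSOSpPoint S) (i : Fin m) (k : Fin (2 * n)) :
    body (S (Sum.inr k) (Sum.inl i)) = 0 :=
  body_of_mem_odd (by simpa [idxParity] using hS.even (Sum.inr k) (Sum.inl i))

theorem body_orthogonal {S : SMat m n N} (hS : IsSOSpPoint S) :
    (S.toBlocks₁₁.map body).transpose * S.toBlocks₁₁.map body = 1 := by
  ext i j
  have h := body_superTranspose_mul hS (Sum.inl i) (Sum.inl j)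
  simp only [Fintype.sum_sum_type, body_inr_inl hS, mul_zero, zero_mul, Finset.sum_const_zero,
    add_zero, stSign, metric, Matrix.fromBlocks_apply₁₁, one_mul] at h
  rw [← h, Matrix.mul_apply]
  simp [Matrix.one_apply, Matrix.toBlocks₁₁]

theorem body_symplectic {S : SMat m n N} (hS : IsSOSpPoint S) :
    (S.toBlocks₂₂.map body).transpose * metricJ n * S.toBlocks₂₂.map body = metricJ n := by
  ext i j
  have h := body_superTranspose_mul hS (Sum.inr i) (Sum.inr j)
  simp only [Fintype.sum_sum_type, body_inl_inr hS, mul_zero, zero_mul, Finset.sum_const_zero,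
    zero_add, stSign, metric, Matrix.fromBlocks_apply₂₂, one_mul] at h
  rw [← h, Matrix.mul_apply]
  simp only [Matrix.mul_apply, Finset.sum_mul]
  refine Finset.sum_congr rfl fun d _ => Finset.sum_congr rfl fun c _ => ?_
  simp only [Matrix.transpose_apply, Matrix.map_apply, Matrix.toBlocks₂₂, Matrix.of_apply]
  ring

variable [NeZero m]

theorem superSphereIntegral_bodyOver {S : SMat m n N} (hS : IsSOSpPoint S)
    {Φ : SFun m n →ₐ[ℝ] SFunOver m n N} (hΦ : IsActionPullback S Φ) (f : SFun m n) :
    superSphereIntegral m n (bodyOver m n N (Φ f)) = superSphereIntegral m n f := by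
  have hA := body_orthogonal hS
  have hC := body_symplectic hS
  rw [isActionPullback_iff] at hΦ
  -- The mixed blocks of S are odd, so with the parameters set to zero the coordinates transform by
  -- the orthogonal and the symplectic block separately. The morphism is then determined by its
  -- values on the coordinates.
  have h1 : (bodyOver m n N).comp Φ = Algebra.TensorProduct.map
      (compIsometry (orthIsometry _ hA))
      (ExteriorAlgebra.map (Matrix.vecMulLinear (S.toBlocks₂₂.map body))) := by
    refine algHom_eq_of_coordY fun c => ?_
    rw [AlgHom.comp_apply, hΦ c, map_sum]
    simp only [bodyOver_ov, Fintype.sum_sum_type]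
    rcases c with i | k
    · simp only [body_inl_inr hS, zero_smul, Finset.sum_const_zero, add_zero, coordY]
      rw [Algebra.TensorProduct.map_tmul, compIsometry_xi,
        map_oneSubThetaSqPow (map_vecMulLinear_thetaSq hC), TensorProduct.sum_tmul]
      exact Finset.sum_congr rfl fun j _ => TensorProduct.smul_tmul' _ _ _
    · simp only [body_inr_inl hS, zero_smul, Finset.sum_const_zero, zero_add, coordY]
      rw [Algebra.TensorProduct.map_tmul, map_one, map_vecMulLinear_gen, TensorProduct.tmul_sum]
      exact Finset.sum_congr rfl fun j _ => (TensorProduct.tmul_smul _ _ _).symm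
  change superSphereIntegral m n (((bodyOver m n N).comp Φ) f) = _
  rw [h1]
  induction f using TensorProduct.induction_on with
  | zero => simp
  | add x y hx hy => rw [map_add, map_add, hx, hy, map_add]
  | tmul h w =>
    rw [Algebra.TensorProduct.map_tmul, superSphereIntegral_tmul, superSphereIntegral_tmul,
      sphIntegral_compIsometry,
      ← map_oneSubThetaSqPow (map_vecMulLinear_thetaSq hC) ((m : ℝ) / 2 - 1), ← map_mul,
      berezin_map_vecMulLinear hC, map_oneSubThetaSqPow (map_vecMulLinear_thetaSq hC)]

/-- The integral over the supersphere is invariant. -/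
theorem isSOSpInvariant_superSphereIntegral : IsSOSpInvariant (superSphereIntegral m n) := by
  intro N S hS Φ hΦ f
  rw [idTensor_superSphereIntegral_pullback hS hΦ, superSphereIntegral_bodyOver hS hΦ]

end Body

/-! ### Uniqueness of the invariant functional -/

section OneParameter

variable {m n N : ℕ}

/-- The matrix by which the operator `genOp a b` acts on the embedding coordinates. -/
def genMatrix (a b : Fin m ⊕ Fin (2 * n)) :
    Matrix (Fin m ⊕ Fin (2 * n)) (Fin m ⊕ Fin (2 * n)) ℝ :=
  Matrix.of fun c d => metricInv m n c a * (1 : Matrix _ _ ℝ) b d +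
    evenSign a b * metricInv m n c b * (1 : Matrix _ _ ℝ) a d

theorem genMatrix_eq_zero {a b c d : Fin m ⊕ Fin (2 * n)}
    (h : idxParity c + idxParity d ≠ idxParity a + idxParity b) : genMatrix a b c d = 0 := by
  have h1 : metricInv m n c a * (1 : Matrix _ _ ℝ) b d = 0 := by
    by_cases hbd : b = d
    · subst hbd
      rw [metricInv_eq_zero (fun hc => h (by rw [hc])), zero_mul]
    · rw [Matrix.one_apply_ne hbd, mul_zero]
  have h2 : metricInv m n c b * (1 : Matrix _ _ ℝ) a d = 0 := by
    by_cases had : a = d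
    · subst had
      rw [metricInv_eq_zero (fun hc => h (by rw [hc, add_comm])), zero_mul]
    · rw [Matrix.one_apply_ne had, mul_zero]
  rw [genMatrix, Matrix.of_apply, h1, mul_assoc, h2, mul_zero, add_zero]

/-- The sign of the symmetry of the metric. -/
def metricSign : Fin m ⊕ Fin (2 * n) → ℝ
  | Sum.inl _ => 1
  | Sum.inr _ => -1

theorem stSign_mul_metric (x y z : Fin m ⊕ Fin (2 * n)) :
    stSign x y * metric m n y z = stSign x z * (metricSign z * metric m n z y) := by
  rcases y with i | k <;> rcases z with j | l
  · simp [metric, Matrix.one_apply, eq_comm, metricSign]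
    rcases x with x | x <;> simp [stSign]
  · simp [metric]
  · simp [metric]
  · simp only [metric, Matrix.fromBlocks_apply₂₂, metricSign]
    rw [metricJ_antisymm k l]
    rcases x with x | x <;> simp [stSign]

theorem metric_mul_genMatrix (a b x z : Fin m ⊕ Fin (2 * n)) :
    (metric m n * genMatrix a b) x z = (1 : Matrix _ _ ℝ) x a * (1 : Matrix _ _ ℝ) b z +
      evenSign a b * ((1 : Matrix _ _ ℝ) x b * (1 : Matrix _ _ ℝ) a z) := by
  have h : ∀ e, (1 : Matrix _ _ ℝ) x e = ∑ y, metric m n x y * metricInv m n y e := fun e => by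
    rw [← metric_mul_metricInv, Matrix.mul_apply]
  rw [h a, h b, Matrix.mul_apply, Finset.sum_mul, Finset.sum_mul, Finset.mul_sum,
    ← Finset.sum_add_distrib]
  refine Finset.sum_congr rfl fun y _ => ?_
  rw [genMatrix, Matrix.of_apply]
  ring

theorem stSign_mul_metricSign (a b : Fin m ⊕ Fin (2 * n)) :
    stSign b a * metricSign a = -evenSign a b := by
  rcases a with i | k <;> rcases b with j | l <;> simp [stSign, metricSign, evenSign]

theorem stSign_mul_metricSign_mul_evenSign (a b : Fin m ⊕ Fin (2 * n)) :
    stSign a b * metricSign b * evenSign a b = -1 := by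
  rcases a with i | k <;> rcases b with j | l <;> simp [stSign, metricSign, evenSign]

/-- The linearised condition X^{st} g + g X = 0 for X = `genMatrix a b`. Both terms are combinations
of products of Kronecker deltas, and their signs are opposite wherever these are nonzero. -/
theorem genMatrix_preserves (a b x z : Fin m ⊕ Fin (2 * n)) :
    ∑ y, stSign x y * metric m n y z * genMatrix a b y x + (metric m n * genMatrix a b) x z = 0 := by
  have h1 : ∑ y, stSign x y * metric m n y z * genMatrix a b y x =
      stSign x z * metricSign z * (metric m n * genMatrix a b) z x := by
    rw [Matrix.mul_apply, Finset.mul_sum]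
    refine Finset.sum_congr rfl fun y _ => ?_
    rw [stSign_mul_metric]; ring
  have h2 : (stSign x z * metricSign z + evenSign a b) *
      ((1 : Matrix _ _ ℝ) z a * (1 : Matrix _ _ ℝ) b x) = 0 := by
    by_cases hz : z = a
    · by_cases hx : b = x
      · subst hz hx
        rw [stSign_mul_metricSign, neg_add_cancel, zero_mul]
      · rw [Matrix.one_apply_ne hx, mul_zero, mul_zero]
    · rw [Matrix.one_apply_ne hz, zero_mul, mul_zero]
  have h3 : (stSign x z * metricSign z * evenSign a b + 1) *
      ((1 : Matrix _ _ ℝ) z b * (1 : Matrix _ _ ℝ) a x) = 0 := by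
    by_cases hz : z = b
    · by_cases hx : a = x
      · subst hz hx
        rw [stSign_mul_metricSign_mul_evenSign, neg_add_cancel, zero_mul]
      · rw [Matrix.one_apply_ne hx, mul_zero, mul_zero]
    · rw [Matrix.one_apply_ne hz, zero_mul, mul_zero]
  have h4 : ∀ c d : Fin m ⊕ Fin (2 * n), (1 : Matrix _ _ ℝ) c d = (1 : Matrix _ _ ℝ) d c :=
    fun c d => by simp only [Matrix.one_apply, eq_comm]
  rw [h1, metric_mul_genMatrix, metric_mul_genMatrix, h4 x a, h4 x b, h4 b z, h4 a z]
  rw [h4 b x] at h2 ⊢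
  linear_combination h2 + h3

/-- The point of the supergroup in the direction of `genOp a b`, with parameter `c`. -/
def genPoint (a b : Fin m ⊕ Fin (2 * n)) (c : Gr N) : SMat m n N :=
  1 + (genMatrix a b).map (fun r => r • c)

/-- The term linear in c vanishes by the infinitesimal condition and the quadratic one because c² =
0, so the first-order deformation preserves g exactly. -/
theorem isSOSpPoint_genPoint (a b : Fin m ⊕ Fin (2 * n)) {c : Gr N}
    (hc : c ∈ parity N (idxParity a + idxParity b)) (hc2 : c * c = 0) (hc0 : body c = 0) :
    IsSOSpPoint (genPoint a b c) where
  even i j := by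
    refine Submodule.add_mem _ ?_ ?_
    · by_cases h : i = j
      · subst h
        rw [Matrix.one_apply_eq, zmod_two_add_self]
        exact one_mem_even
      · rw [Matrix.one_apply_ne h]; exact Submodule.zero_mem _
    · rw [Matrix.map_apply]
      by_cases h : idxParity i + idxParity j = idxParity a + idxParity b
      · rw [h]; exact Submodule.smul_mem _ _ hc
      · rw [genMatrix_eq_zero h, zero_smul]; exact Submodule.zero_mem _
  preserves_metric := by
    set Q : SMat m n N := (genMatrix a b).map (fun r => r • c) with hQ
    have hgQ : ∀ x z, (grMetric m n N * Q) x z = (metric m n * genMatrix a b) x z • c := by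
      intro x z
      rw [Matrix.mul_apply, Matrix.mul_apply, Finset.sum_smul]
      refine Finset.sum_congr rfl fun y _ => ?_
      rw [grMetric_apply, ← Algebra.smul_def, hQ, Matrix.map_apply, smul_smul]
    have hQg : ∀ x z, (superTranspose Q * grMetric m n N) x z =
        (∑ y, stSign x y * metric m n y z * genMatrix a b y x) • c := by
      intro x z
      rw [Matrix.mul_apply, Finset.sum_smul]
      refine Finset.sum_congr rfl fun y _ => ?_
      rw [superTranspose_apply, grMetric_apply, ← Algebra.commutes, ← Algebra.smul_def, hQ,
        Matrix.map_apply, smul_smul, smul_smul]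
      congr 1
      ring
    have h1 : superTranspose Q * grMetric m n N + grMetric m n N * Q = 0 := by
      ext x z
      rw [Matrix.add_apply, hQg, hgQ, ← add_smul, genMatrix_preserves, zero_smul, Matrix.zero_apply]
    have h2 : superTranspose Q * grMetric m n N * Q = 0 := by
      ext x z
      rw [Matrix.mul_apply]
      refine Finset.sum_eq_zero fun y _ => ?_
      rw [hQg, hQ, Matrix.map_apply, smul_mul_smul_comm, hc2, smul_zero]
    have h3 : superTranspose (genPoint a b c) = 1 + superTranspose Q := by
      rw [genPoint, superTranspose_add, superTranspose_one]
    change superTranspose (genPoint a b c) * grMetric m n N * (1 + Q) = grMetric m n N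
    rw [h3, add_mul, add_mul, mul_add, mul_add, h2, one_mul, mul_one, mul_one, add_zero, add_assoc,
      add_comm (grMetric m n N * Q), h1, add_zero]
  det_body := by
    have : (genPoint a b c).toBlocks₁₁.map body = 1 := by
      ext i j
      simp [genPoint, Matrix.toBlocks₁₁, hc0, Matrix.one_apply]
    rw [this, Matrix.det_one]

/-- One generator serves for odd parity; an even parameter with square and body zero needs the
product of two. -/
theorem exists_nilpotent_parameter (p : ZMod 2) :
    ∃ c : Gr 2, c ∈ parity 2 p ∧ c * c = 0 ∧ body c = 0 ∧ c ≠ 0 := by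
  have hsq : ∀ i : Fin 2, (gen i : Gr 2) * gen i = 0 := fun i => ExteriorAlgebra.ι_sq_zero _
  have h0 : body (gen 0 : Gr 2) = 0 := body_of_mem_odd (gen_mem_odd 0)
  have hne : ∀ i : Fin 2, (gen i : Gr 2) ≠ 0 := by
    intro i h
    have := grDeriv_gen i i
    rw [h, map_zero, if_pos rfl] at this
    exact zero_ne_one this
  rcases zmod_two_cases p with rfl | rfl
  · refine ⟨gen 0 * gen 1, odd_mul_odd_mem (gen_mem_odd 0) (gen_mem_odd 1), ?_, ?_, fun h => ?_⟩
    · rw [mul_assoc, ← mul_assoc (gen 1), mul_anticomm_of_mem_odd (gen_mem_odd 1) (gen_mem_odd 0),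
        neg_mul, mul_neg, mul_assoc, hsq, mul_zero, mul_zero, neg_zero]
    · rw [map_mul, h0, zero_mul]
    · have h1 := grDeriv_gen_mul 0 0 (gen 1 : Gr 2)
      rw [h, map_zero, if_pos rfl, grDeriv_gen, if_neg (by decide), mul_zero,
        sub_zero] at h1
      exact hne 1 h1.symm
  · exact ⟨gen 0, gen_mem_odd 0, hsq 0, h0, hne 0⟩

variable [NeZero m]

theorem genOp_coordY_eq_sum (a b c : Fin m ⊕ Fin (2 * n)) :
    genOp a b (coordY c) = ∑ d, genMatrix a b c d • (coordY d : SFun m n) := by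
  rw [genOp_coordY]
  simp only [genMatrix, Matrix.of_apply, add_smul, Finset.sum_add_distrib, Matrix.one_apply,
    mul_ite, mul_one, mul_zero, ite_smul, zero_smul, Finset.sum_ite_eq, Finset.mem_univ, if_true]

/-- An invariant functional is annihilated by the infinitesimal action. -/
theorem IsSOSpInvariant.map_genOp {T : SFun m n →ₗ[ℝ] ℝ} (hT : IsSOSpInvariant T)
    (a b : Fin m ⊕ Fin (2 * n)) (f : SFun m n) : T (genOp a b f) = 0 := by
  obtain ⟨c, hc, hc2, hc0, hne⟩ := exists_nilpotent_parameter (idxParity a + idxParity b)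
  have hsq : ∀ x, ovMap (LinearMap.mulRight ℝ c) (genOp a b)
      (ovMap (LinearMap.mulRight ℝ c) (genOp a b) x) = (0 : SFunOver m n 2) := by
    intro x
    induction x using ov_induction with
    | hadd x y hx hy => rw [map_add, map_add, hx, hy, add_zero]
    | hov u g =>
      rw [ovMap_ov, ovMap_ov, LinearMap.mulRight_apply, LinearMap.mulRight_apply, mul_assoc, hc2,
        mul_zero, ov_zero_left]
  -- This explicit morphism f ↦ f + c · genOp a b f is a pullback for `genPoint a b c`; invariance
  -- then reads T(f) + T(genOp a b f) c = T(f).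
  let Φ := (oneAddHom (isLeibniz_ovMap_genOp a b hc) hsq).comp (inclFun m n 2)
  have hΦ : ∀ g, Φ g = ov 1 g + ov c (genOp a b g) := by
    intro g
    change inclFun m n 2 g + ovMap (LinearMap.mulRight ℝ c) (genOp a b) (inclFun m n 2 g) = _
    rw [inclFun_eq, ovMap_ov, LinearMap.mulRight_apply, one_mul]
  have h1 : IsActionPullback (genPoint a b c) Φ := by
    rw [isActionPullback_iff]
    intro e
    have h2 : ∀ d, ov (genPoint a b c e d) (coordY d : SFun m n) =
        (1 : Matrix _ _ ℝ) e d • ov (1 : Gr 2) (coordY d) +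
          ov c (genMatrix a b e d • coordY d) := by
      intro d
      rw [genPoint, Matrix.add_apply, ov_add_left, Matrix.map_apply, ov_smul_left, ov_smul_right]
      congr 1
      by_cases h : e = d
      · subst h; rw [Matrix.one_apply_eq, Matrix.one_apply_eq, one_smul]
      · rw [Matrix.one_apply_ne h, Matrix.one_apply_ne h, zero_smul, ov_zero_left]
    rw [hΦ, genOp_coordY_eq_sum, ov_sum_right]
    simp only [h2, Finset.sum_add_distrib]
    congr 1
    simp only [Matrix.one_apply, ite_smul, zero_smul, one_smul, Finset.sum_ite_eq, Finset.mem_univ,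
      if_true]
  have h2 := hT 2 _ (isSOSpPoint_genPoint a b hc hc2 hc0) Φ h1 f
  rw [hΦ, map_add, idTensor_ov, idTensor_ov, Algebra.algebraMap_eq_smul_one, add_eq_left] at h2
  exact (smul_eq_zero.1 h2).resolve_right hne

end OneParameter

/-! ### Solving the infinitesimal relations -/

section Uniqueness

variable {m n : ℕ}

/-- The forms `dualForm k` are a basis because J is invertible; J² = -1/4 gives the coefficients. -/
theorem grDeriv_eq_sum_contr_dualForm (q : Fin (2 * n)) (w : Gr (2 * n)) :
    grDeriv q w = ∑ k, metricJ n k q • contr (dualForm k) w := by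
  have h1 : (LinearMap.proj q : Module.Dual ℝ (Fin (2 * n) → ℝ)) =
      ∑ k, metricJ n k q • dualForm k := by
    refine LinearMap.pi_ext' fun p => LinearMap.ext_ring ?_
    have h2 := metricJ_mul_metricJ (n := n) p q
    simp only [LinearMap.comp_apply, LinearMap.sum_apply, LinearMap.smul_apply,
      LinearMap.single_apply, dualForm_single, smul_eq_mul, LinearMap.proj_apply]
    have h3 : ∑ k, metricJ n k q * (-4 * metricJ n p k) =
        -4 * ∑ k, metricJ n p k * metricJ n k q := by
      rw [Finset.mul_sum]; exact Finset.sum_congr rfl fun k _ => by ring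
    rw [h3, h2, Pi.single_apply]
    by_cases h : q = p
    · subst h; norm_num
    · rw [if_neg h, if_neg (Ne.symm h), mul_zero]
  change contr (LinearMap.proj q) w = _
  rw [h1, contr, map_sum, LinearMap.sum_apply]
  exact Finset.sum_congr rfl fun k _ => by rw [map_smul, LinearMap.smul_apply]

variable [NeZero m]

/-- An invariant functional is a multiple of the integral over the supersphere. -/
theorem IsSOSpInvariant.exists_eq_smul (hm : 2 ≤ m) {T : SFun m n →ₗ[ℝ] ℝ}
    (hT : IsSOSpInvariant T) : ∃ c : ℝ, T = c • superSphereIntegral m n := by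
  have hI := sphIntegral_one_ne_zero m
  -- For fixed w, T(· ⊗ w) is a multiple of the sphere integral; evaluating at the constant 1
  -- identifies the multiple as τ w.
  let τ : Gr (2 * n) →ₗ[ℝ] ℝ :=
    (sphIntegral m 1)⁻¹ • (T ∘ₗ TensorProduct.mk ℝ (SphFun m) (Gr (2 * n)) 1)
  have hτ : ∀ h w, T (h ⊗ₜ[ℝ] w) = sphIntegral m h * τ w := by
    intro h w
    obtain ⟨c, hc⟩ := exists_eq_smul_sphIntegral hm
      (T := T ∘ₗ (TensorProduct.mk ℝ (SphFun m) (Gr (2 * n))).flip w) (fun i j h => by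
        have := hT.map_genOp (Sum.inl i) (Sum.inl j) (h ⊗ₜ[ℝ] w)
        rw [genOp_inl_inl_tmul] at this
        exact this)
    have h1 : ∀ g, T (g ⊗ₜ[ℝ] w) = c * sphIntegral m g := fun g => LinearMap.congr_fun hc g
    have h2 : τ w = c := by
      change (sphIntegral m 1)⁻¹ * T (1 ⊗ₜ[ℝ] w) = c
      rw [h1]; field_simp
    rw [h1, h2, mul_comm]
  have hodd : ∀ k w, τ (oneSubThetaSqPow n (1 / 2) * contr (dualForm k) w) +
      ((m : ℝ) - 1) * τ (oneSubThetaSqPow n (-1 / 2) * gen k * w) = 0 := by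
    intro k w
    -- Testing the odd relation on ξ_i ⊗ w and summing over i replaces the possibly zero factors ∫
    -- ξ_i² by ∫ 1 ≠ 0.
    have h1 : ∀ i : Fin m, sphIntegral m (xi i * xi i) *
        (τ (oneSubThetaSqPow n (1 / 2) * contr (dualForm k) w) +
          ((m : ℝ) - 1) * τ (oneSubThetaSqPow n (-1 / 2) * gen k * w)) = 0 := by
      intro i
      have := hT.map_genOp (Sum.inl i) (Sum.inr k) (xi i ⊗ₜ[ℝ] w)
      rw [genOp_inl_inr_tmul, map_add, hτ, hτ, map_nabla_of_xop sphIntegral_xop, smul_eq_mul] at this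
      linear_combination this
    have h2 := Finset.sum_eq_zero fun i (_ : i ∈ Finset.univ) => h1 i
    rw [← Finset.sum_mul, ← map_sum, sum_xi_mul_xi] at h2
    exact (mul_eq_zero.1 h2).resolve_left hI
  let s : ℝ := (m : ℝ) / 2 - 1
  obtain ⟨c, hc⟩ := exists_eq_smul_berezin
    (τ ∘ₗ LinearMap.mulLeft ℝ (oneSubThetaSqPow n (-s))) (fun q w => by
      rw [grDeriv_eq_sum_contr_dualForm, map_sum]
      refine Finset.sum_eq_zero fun k _ => ?_
      rw [map_smul]
      -- The power of u is an integrating factor: its derivative contributes 2(-s - 1/2) = -(m - 1),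
      -- which cancels the undifferentiated term.
      have h1 := hodd k (oneSubThetaSqPow n (-s - 1 / 2) * w)
      rw [contr_dualForm_oneSubThetaSqPow_mul, mul_assoc (oneSubThetaSqPow n (-1 / 2)),
        ← mul_assoc (gen k), ← mul_comm_of_mem_even (oneSubThetaSqPow_mem_even _), mul_add,
        mul_smul_comm] at h1
      simp only [← mul_assoc, oneSubThetaSqPow_mul] at h1
      rw [show (1 / 2 : ℝ) + (-s - 1 / 2 - 1) = -s - 1 by ring,
        show (-1 / 2 : ℝ) + (-s - 1 / 2) = -s - 1 by ring,
        show (1 / 2 : ℝ) + (-s - 1 / 2) = -s by ring, map_add, map_smul, smul_eq_mul] at h1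
      have h2 : τ (oneSubThetaSqPow n (-s) * contr (dualForm k) w) = 0 := by
        have h3 : 2 * (-s - 1 / 2) + ((m : ℝ) - 1) = 0 := by simp only [s]; ring
        linear_combination h1 - τ (oneSubThetaSqPow n (-s - 1) * gen k * w) * h3
      rw [LinearMap.comp_apply, LinearMap.mulLeft_apply, h2, smul_zero])
  refine ⟨c, TensorProduct.ext' fun h w => ?_⟩
  have h1 : τ (oneSubThetaSqPow n (-s) * (oneSubThetaSqPow n s * w)) =
      c * berezin n (oneSubThetaSqPow n s * w) :=
    LinearMap.congr_fun hc (oneSubThetaSqPow n s * w)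
  rw [← mul_assoc, oneSubThetaSqPow_mul, neg_add_cancel, oneSubThetaSqPow_zero, one_mul] at h1
  rw [hτ, h1, LinearMap.smul_apply, superSphereIntegral_tmul, smul_eq_mul]
  ring

/-- The test function u^{-(m/2-1)} (θ²)^n removes the weight and leaves (∫ 1) times the nonzero
Berezin integral of the top power. -/
theorem superSphereIntegral_ne_zero : superSphereIntegral m n ≠ 0 := by
  intro h
  have h1 := LinearMap.congr_fun h
    (1 ⊗ₜ[ℝ] (oneSubThetaSqPow n (-((m : ℝ) / 2 - 1)) * thetaSq n ^ n))
  rw [superSphereIntegral_tmul, ← mul_assoc, oneSubThetaSqPow_mul, add_neg_cancel,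
    oneSubThetaSqPow_zero, one_mul, LinearMap.zero_apply] at h1
  exact (mul_ne_zero (sphIntegral_one_ne_zero m) (berezin_thetaSq_pow_ne_zero n)) h1

end Uniqueness

end SuperSphere

end

theorem mainTheorem5 (m n : ℕ) [NeZero m] :
    SuperSphere.superSphereIntegral m n ≠ 0 ∧
    SuperSphere.IsSOSpInvariant (SuperSphere.superSphereIntegral m n) ∧
    (2 ≤ m → ∀ T : SuperSphere.SFun m n →ₗ[ℝ] ℝ, SuperSphere.IsSOSpInvariant T →
      ∃ c : ℝ, T = c • SuperSphere.superSphereIntegral m n) :=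
  ⟨SuperSphere.superSphereIntegral_ne_zero, SuperSphere.isSOSpInvariant_superSphereIntegral,
    fun hm _ hT => hT.exists_eq_smul hm⟩
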